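/- Let $p$ be a prime and let $K$ be a finite extension of $\mathbb{Q}_p$, with the absolute value $|\cdot|_K$ normalized by $|p|_K=p^{-1}$. Let $\mathfrak g$ be a finite-dimensional split reductive Lie algebra over $K$ with split Cartan subalgebra $\mathfrak t$, root system $\Phi$, a base $\Delta\subset\Phi$, and corresponding positive roots $\Phi^+=\{\beta_1,\dots,\beta_r\}$ (enumerated in any order). For $I\subseteq\Delta$ let $\Phi_I=\Phi\cap\mathbb{Z}I$, $\Phi_I^+=\Phi_I\cap\Phi^+$, and let $\mathfrak p_I=\mathfrak l_I\oplus\mathfrak u_I$ be the standard parabolic subalgebra with $\mathfrak l_I=\mathfrak t\oplus\bigoplus_{\beta\in\Phi_I}\mathfrak g_\beta$ and $\mathfrak u_I=\bigoplus_{\beta\in\Phi^+\setminus\Phi_I^+}\mathfrak g_\beta$. Let $\mathcal O^{\mathfrak p_I}$ be the category of finitely generated $U(\mathfrak g)$-modules on which $\mathfrak u_I$ acts locally finitely and $\mathfrak l_I$ acts semisimply and locally finitely. Let $M$ be a highest weight module for $\mathfrak g$ over $K$, generated by a highest weight vector $v^+\neq 0$ of weight $\lambda\in\mathfrak t^*$,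 and let $I\subseteq\Delta$ be such that $\mathfrak p_I$ is maximal among the standard parabolic subalgebras $\mathfrak q$ with $M\in\mathcal O^{\mathfrak q}$. Assume that $|\langle\lambda,\alpha^\vee\rangle|_K\le 1$ for all $\alpha\in\Delta$ (for instance, that $\lambda$ is an integral weight). Assume also that $p$ does not divide any of the non-zero integers among the $\langle\beta,\alpha^\vee\rangle$ with $\alpha,\beta\in\Phi$, $\alpha\ne\beta$. Let $(x_\beta,y_\beta,h_\alpha \mid \beta\in\Phi^+,\alpha\in\Delta)$ be a Chevalley basis of $[\mathfrak g,\mathfrak g]$: $x_\beta\in\mathfrak g_\beta$, $y_\beta\in\mathfrak g_{-\beta}$, $[x_\beta,y_\beta]$ is the coroot of $\beta$, $h_\alpha=[x_\alpha,y_\alpha]$, and the structure constants are integers. Write $y_i=y_{\beta_i}$. Let $\gamma\in\Phi^+\setminus\Phi_I^+$, let $n\ge 0$ be an integer, and put $\mathcal I_n=\{\nu\in\mathbb{Z}_{\ge0}^r \mid \nu_1\beta_1+\dots+\nu_r\beta_r=n\gamma\}$. Then for any relation $$y_\gamma^n\cdot v^+=\sum_{\nu\in\mathcal I_n}c_\nu\,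 y_1^{\nu_1}\cdots y_r^{\nu_r}\cdot v^+,\qquad c_\nu\in K,$$ there is at least one $\nu\in\mathcal I_n$ such that $\nu_1+\dots+\nu_r\ge n$ and $|c_\nu|_K\ge 1$. -/

import Mathlib

namespace SplitReductive

section RootData

variable {K 𝔤 : Type*} [Field K] [LieRing 𝔤] [LieAlgebra K 𝔤] [FiniteDimensional K 𝔤]
variable (𝔱 : LieSubalgebra K 𝔤) [𝔱.IsCartanSubalgebra]

/-- The set `Φ` of roots: the nonzero weights of `𝔱` on `𝔤`. -/
def roots : Set (LieModule.Weight K 𝔱 𝔤) :=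
  {β | β.IsNonZero}

/-- `h` is the coroot `α^∨` of the root `α`: the element of `[𝔤_α, 𝔤_{-α}] ⊆ 𝔱` on which `α`
takes the value `2`.  For another root `β`, the value `β h` is then the Cartan integer
`⟨β, α^∨⟩`. -/
def IsCoroot (α : LieModule.Weight K 𝔱 𝔤) (h : 𝔱) : Prop :=
  h ∈ LieAlgebra.corootSpace (α : 𝔱 → K) ∧ α h = 2

/-- `Δ` is a base of the root system `Φ`: it consists of linearly independent roots, and every
root is a combination of elements of `Δ` with coefficients in `ℕ`, or the negative of such a
combination. -/
structure IsBase (Δ : Finset (LieModule.Weight K 𝔱 𝔤)) : Prop where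
  subset_roots : ∀ α ∈ Δ, α ∈ roots 𝔱
  linearIndependent : LinearIndependent K (fun α : Δ => ((α : LieModule.Weight K 𝔱 𝔤) : 𝔱 → K))
  pos_or_neg : ∀ β ∈ roots 𝔱, ∃ f : LieModule.Weight K 𝔱 𝔤 → ℕ,
    (β : 𝔱 → K) = ∑ α ∈ Δ, f α • (α : 𝔱 → K) ∨
    (β : 𝔱 → K) = -∑ α ∈ Δ, f α • (α : 𝔱 → K)

/-- The set `Φ⁺` of positive roots with respect to the base `Δ`. -/
def posRoots (Δ : Finset (LieModule.Weight K 𝔱 𝔤)) : Set (LieModule.Weight K 𝔱 𝔤) :=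
  {β | β ∈ roots 𝔱 ∧ ∃ f : LieModule.Weight K 𝔱 𝔤 → ℕ,
    (β : 𝔱 → K) = ∑ α ∈ Δ, f α • (α : 𝔱 → K)}

/-- The root subsystem `Φ_I = Φ ∩ ℤI` attached to a set `I` of simple roots. -/
def leviRoots (I : Finset (LieModule.Weight K 𝔱 𝔤)) : Set (LieModule.Weight K 𝔱 𝔤) :=
  {β | β ∈ roots 𝔱 ∧ ∃ f : LieModule.Weight K 𝔱 𝔤 → ℤ,
    (β : 𝔱 → K) = ∑ α ∈ I, f α • (α : 𝔱 → K)}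

/-- The Levi subalgebra `𝔩_I` of the standard parabolic subalgebra `𝔭_I = 𝔩_I ⊕ 𝔲_I`: it is
generated (in fact spanned) by `𝔱` and the root spaces `𝔤_β`, `β ∈ Φ_I`. -/
def levi (I : Finset (LieModule.Weight K 𝔱 𝔤)) : LieSubalgebra K 𝔤 :=
  LieSubalgebra.lieSpan K 𝔤
    ((𝔱 : Set 𝔤) ∪ ⋃ β ∈ leviRoots 𝔱 I, (LieAlgebra.rootSpace 𝔱 (β : 𝔱 → K) : Set 𝔤))

/-- The nilradical `𝔲_I` of the standard parabolic subalgebra `𝔭_I`: it is generated (in fact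
spanned) by the root spaces `𝔤_β`, `β ∈ Φ⁺ ∖ Φ_I`. -/
def nilrad (Δ I : Finset (LieModule.Weight K 𝔱 𝔤)) : LieSubalgebra K 𝔤 :=
  LieSubalgebra.lieSpan K 𝔤
    (⋃ β ∈ posRoots 𝔱 Δ \ leviRoots 𝔱 I, (LieAlgebra.rootSpace 𝔱 (β : 𝔱 → K) : Set 𝔤))

/-- `(x_β, y_β, h_α | β ∈ Φ⁺, α ∈ Δ)`, with `h_α = [x_α, y_α]`, is a Chevalley basis of the derived
algebra `[𝔤, 𝔤]`: the `x_β` and `y_β` are root vectors for `β` and `-β`, the bracket `[x_β, y_β]`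
is the coroot of `β`, the family is a basis of `[𝔤, 𝔤]`, and its structure constants are
integers. -/
structure IsChevalleyBasis (Δ : Finset (LieModule.Weight K 𝔱 𝔤))
    (x y : posRoots 𝔱 Δ → 𝔤) : Prop where
  x_mem : ∀ β : posRoots 𝔱 Δ, x β ∈ LieAlgebra.rootSpace 𝔱 (β.1 : 𝔱 → K)
  y_mem : ∀ β : posRoots 𝔱 Δ, y β ∈ LieAlgebra.rootSpace 𝔱 (-(β.1 : 𝔱 → K))
  lie_x_y : ∀ β : posRoots 𝔱 Δ, ∃ h : 𝔱, IsCoroot 𝔱 β.1 h ∧ ⁅x β, y β⁆ = (h : 𝔤)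
  linearIndependent : LinearIndependent K
    (Sum.elim x (Sum.elim y (fun α : {α : posRoots 𝔱 Δ // α.1 ∈ Δ} => ⁅x α.1, y α.1⁆)))
  span_eq : Submodule.span K
    (Set.range x ∪ Set.range y ∪ {h | ∃ α : posRoots 𝔱 Δ, α.1 ∈ Δ ∧ h = ⁅x α, y α⁆}) =
      (LieAlgebra.derivedSeries K 𝔤 1).toSubmodule
  integral :
    ∀ a ∈ Set.range x ∪ Set.range y ∪ {h | ∃ α : posRoots 𝔱 Δ, α.1 ∈ Δ ∧ h = ⁅x α, y α⁆},
    ∀ b ∈ Set.range x ∪ Set.range y ∪ {h | ∃ α : posRoots 𝔱 Δ, α.1 ∈ Δ ∧ h = ⁅x α, y α⁆},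
      ⁅a, b⁆ ∈ Submodule.span ℤ
        (Set.range x ∪ Set.range y ∪ {h | ∃ α : posRoots 𝔱 Δ, α.1 ∈ Δ ∧ h = ⁅x α, y α⁆})

variable (M : Type*) [AddCommGroup M] [Module K M] [LieRingModule 𝔤 M] [LieModule K 𝔤 M]

/-- `M` is an object of the parabolic category `𝒪^𝔭` for `𝔭 = 𝔭_I`: the action of `𝔲_I` is
locally finite, the action of `𝔩_I` is semisimple and locally finite, and `M` is finitely
generated over `U(𝔤)`. -/
structure IsInCategoryO (Δ I : Finset (LieModule.Weight K 𝔱 𝔤)) : Prop where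
  nilrad_locallyFinite : ∀ m : M,
    FiniteDimensional K (LieSubmodule.lieSpan K (nilrad 𝔱 Δ I) ({m} : Set M))
  levi_semisimple : ComplementedLattice (LieSubmodule K (levi 𝔱 I) M)
  levi_locallyFinite : ∀ m : M,
    FiniteDimensional K (LieSubmodule.lieSpan K (levi 𝔱 I) ({m} : Set M))
  finitelyGenerated : ∃ s : Finset M, LieSubmodule.lieSpan K 𝔤 (s : Set M) = ⊤

/-- The standard parabolic subalgebra `𝔭_I` is maximal for `M`: `M` is an object of `𝒪^𝔭` for
`𝔭 = 𝔭_I`, but not for any strictly larger standard parabolic subalgebra. -/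
def IsMaximalParabolicFor (Δ I : Finset (LieModule.Weight K 𝔱 𝔤)) : Prop :=
  I ⊆ Δ ∧ IsInCategoryO 𝔱 M Δ I ∧
    ∀ J : Finset (LieModule.Weight K 𝔱 𝔤), I ⊆ J → J ⊆ Δ → IsInCategoryO 𝔱 M Δ J → J = I

variable {M}

/-- `M` is a highest weight module of highest weight `lam` with highest weight vector `v`: the
vector `v` is nonzero, of weight `lam`, killed by all positive root spaces, and generates `M`. -/
structure IsHighestWeightVector (Δ : Finset (LieModule.Weight K 𝔱 𝔤))
    (lam : Module.Dual K 𝔱) (v : M) : Prop where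
  ne_zero : v ≠ 0
  weight : ∀ h : 𝔱, ⁅h, v⁆ = lam h • v
  pos : ∀ β ∈ posRoots 𝔱 Δ, ∀ z ∈ LieAlgebra.rootSpace 𝔱 (β : 𝔱 → K), ⁅z, v⁆ = 0
  generates : LieSubmodule.lieSpan K 𝔤 ({v} : Set M) = ⊤

end RootData

/-- The vector `y_1^{ν_1} y_2^{ν_2} ⋯ y_r^{ν_r} . v`. -/
noncomputable def monomialApply (K : Type*) {𝔤 M : Type*} [Field K] [LieRing 𝔤] [LieAlgebra K 𝔤]
    [AddCommGroup M] [Module K M] [LieRingModule 𝔤 M] [LieModule K 𝔤 M]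
    {r : ℕ} (y : Fin r → 𝔤) (ν : Fin r → ℕ) (v : M) : M :=
  (List.ofFn fun i => (LieModule.toEnd K 𝔤 M (y i)) ^ ν i).prod v

end SplitReductive

/-! The relation is moved to a weight where it can be read off. For a simple root `α`, the only
product of negative root vectors of weight `-nα` is `y_α ^ n`, which has exactly `n` factors. So an
operator `E` that sends `y_γ ^ n v` to `u • y_α ^ n v` with `u⁻¹` integral, preserves the `𝒪_K`-span
of the products applied to `v`, and does not increase the number of factors turns the relation into
`u = ∑ c_ν a_ν`, with `|a_ν| ≤ 1` and `a_ν = 0` when `ν` has fewer than `n` factors. As `|u| ≥ 1`,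
the ultrametric inequality yields the required `ν`. This needs `y_α ^ n v ≠ 0`, which holds for
simple `α` outside `I`.

Existence of `E` (`exists_operator`) is an induction on the height of `γ`. Choose a simple `α` with
`⟨γ, α^∨⟩ > 0`. If `α ∈ I`, a divided power of `x_α` strips the whole `α`-string off `γ`, leaving a
lower root still outside `Φ_I`. If `α ∉ I`, the `n`-th divided power of `x_{γ-α}` reaches `y_α ^ n
v` at once. Divided powers preserve the lattice and its filtration (`dpow_mem_Fil`). The hypothesis
on `p` makes `p` odd and larger than the length of every root string, so the factorials that matter
and the structure constants between roots whose sum is a root are `p`-units (`not_dvd_factorial`,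
`exists_structure_const`).

Nonvanishing (`IsMaximalParabolicFor.pow_ne_zero`): if `y_α ^ n v = 0` with `α ∉ I`, then `y_α` is
locally nilpotent on `M`, hence so is every root vector of the Levi subalgebra of `I ∪ {α}`
(`locNil_y`). That Levi then acts locally finitely, and semisimply by a Casimir argument
(`casEig_ne`, `socle_eq_top`), so `M` lies in the parabolic category of `I ∪ {α}`, against the
maximality of `𝔭_I`.

All of this is done for a `ChevalleyDatum`, which `IsChevalleyBasis.exists_datum` extracts from the
given Chevalley basis. -/

set_option linter.unusedSectionVars false

/-! ### Chevalley data, weight spaces and reflections of weights. -/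

namespace SplitReductive

open LieModule

/-- Root vectors, coroots, roots and fundamental coweights of a split reductive Lie algebra, indexed
by the positive roots `P`; the signed root `Sum.inl β` is `β` and `Sum.inr β` is `-β`. -/
structure ChevalleyDatum (K 𝔤 : Type*) [Field K] [LieRing 𝔤] [LieAlgebra K 𝔤]
    (𝔱 : LieSubalgebra K 𝔤) (P : Type*) where
  S : Finset P
  e : P ⊕ P → 𝔤
  h : P ⊕ P → 𝔱
  rt : P ⊕ P → Module.Dual K 𝔱
  coweight : P → 𝔱
  cf : P → P → ℕ
  lie_t : ∀ (t : 𝔱) s, ⁅(t : 𝔤), e s⁆ = rt s t • e s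
  e_ne_zero : ∀ s, e s ≠ 0
  lie_e_swap : ∀ s, ⁅e s, e s.swap⁆ = (h s : 𝔤)
  rt_h : ∀ s, rt s (h s) = 2
  rt_swap : ∀ s, rt s.swap = -rt s
  rt_injective : Function.Injective rt
  exists_of_weight : ∀ (χ : Module.Dual K 𝔱) (w : 𝔤), χ ≠ 0 → w ≠ 0 →
    (∀ t : 𝔱, ⁅(t : 𝔤), w⁆ = χ t • w) → ∃ s, rt s = χ ∧ ∃ c : K, w = c • e s
  lie_int : ∀ s t u, rt u = rt s + rt t → ∃ N : ℤ, ⁅e s, e t⁆ = N • e u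
  h_int : ∀ s, ∃ z : P → ℤ, h s = ∑ α ∈ S, z α • h (Sum.inl α)
  rt_cf : ∀ β, rt (Sum.inl β) = ∑ α ∈ S, cf β α • rt (Sum.inl α)
  rt_coweight_self : ∀ α ∈ S, rt (Sum.inl α) (coweight α) = 1
  rt_coweight_ne : ∀ α ∈ S, ∀ α' ∈ S, α ≠ α' → rt (Sum.inl α) (coweight α') = 0
  top_le : ∀ N : Submodule K 𝔤, (∀ t : 𝔱, (t : 𝔤) ∈ N) → (∀ s, e s ∈ N) → ∀ z, z ∈ N

section WeightSpace

variable {K 𝔤 : Type*} [Field K] [LieRing 𝔤] [LieAlgebra K 𝔤] (𝔱 : LieSubalgebra K 𝔤)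
  (V : Type*) [AddCommGroup V] [Module K V] [LieRingModule 𝔤 V] [LieModule K 𝔤 V]

/-- The simultaneous eigenspace of `𝔱` on `V` for the linear functional `χ`. -/
def wsp (χ : Module.Dual K 𝔱) : Submodule K V where
  carrier := {m | ∀ t : 𝔱, ⁅(t : 𝔤), m⁆ = χ t • m}
  add_mem' {a b} ha hb t := by rw [lie_add, ha t, hb t, smul_add]
  zero_mem' t := by simp
  smul_mem' c m hm t := by rw [lie_smul, hm t, smul_comm]

variable (K) in
/-- Every vector of `V` is killed by a power of `z`. -/
def LocNil (z : 𝔤) : Prop := ∀ m : V, ∃ k : ℕ, (toEnd K 𝔤 V z ^ k) m = 0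

variable {𝔱 V}

lemma lie_mem_wsp {χ ψ : Module.Dual K 𝔱} {z : 𝔤} {m : V} (hz : z ∈ wsp 𝔱 𝔤 ψ)
    (hm : m ∈ wsp 𝔱 V χ) : ⁅z, m⁆ ∈ wsp 𝔱 V (χ + ψ) := by
  intro t
  rw [leibniz_lie, hz t, hm t, smul_lie, lie_smul, ← add_smul, LinearMap.add_apply, add_comm]

lemma pow_mem_wsp {χ ψ : Module.Dual K 𝔱} {z : 𝔤} {m : V} (hz : z ∈ wsp 𝔱 𝔤 ψ)
    (hm : m ∈ wsp 𝔱 V χ) (k : ℕ) : (toEnd K 𝔤 V z ^ k) m ∈ wsp 𝔱 V (χ + k • ψ) := by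
  induction k with
  | zero => simpa using hm
  | succ k ih =>
    have := lie_mem_wsp hz ih
    rw [pow_succ', Module.End.mul_apply, toEnd_apply_apply]
    convert this using 2
    rw [succ_nsmul, add_assoc]

/-- Components of distinct weights of an element of a `𝔱`-stable subspace lie in the subspace. -/
lemma component_mem {ι : Type*} (N : Submodule K V) (hN : ∀ t : 𝔱, ∀ m ∈ N, ⁅(t : 𝔤), m⁆ ∈ N)
    (χ : ι → Module.Dual K 𝔱) (hχ : Function.Injective χ) (s : Finset ι) (w : ι → V)
    (hw : ∀ i ∈ s, w i ∈ wsp 𝔱 V (χ i)) (hsum : ∑ i ∈ s, w i ∈ N) : ∀ i ∈ s, w i ∈ N := by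
  classical
  induction s using Finset.induction_on generalizing w with
  | empty => simp
  | insert i₀ s hi₀ ih =>
    rw [Finset.sum_insert hi₀] at hsum
    have key : ∀ i ∈ s, w i ∈ N := by
      intro i hi
      have hne : χ i ≠ χ i₀ := fun h => hi₀ (hχ h ▸ hi)
      obtain ⟨t, ht⟩ : ∃ t, χ i t ≠ χ i₀ t := by
        by_contra! h
        exact hne (LinearMap.ext h)
      -- Acting by `t - χ i₀ t` kills the `i₀`-component and rescales the others, so the induction
      -- hypothesis applies; only the factor at `i` has to be nonzero.
      have h1 : ∑ j ∈ s, (χ j t - χ i₀ t) • w j ∈ N := by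
        have := N.sub_mem (hN t _ hsum) (N.smul_mem (χ i₀ t) hsum)
        convert this using 1
        rw [lie_add, lie_sum, hw i₀ (Finset.mem_insert_self _ _) t, smul_add,
          add_sub_add_left_eq_sub, Finset.smul_sum, ← Finset.sum_sub_distrib]
        refine Finset.sum_congr rfl fun j hj => ?_
        rw [hw j (Finset.mem_insert_of_mem hj) t, sub_smul]
      have h2 := ih (fun j => (χ j t - χ i₀ t) • w j)
        (fun j hj => Submodule.smul_mem _ _ (hw j (Finset.mem_insert_of_mem hj))) h1 i hi
      exact (N.smul_mem_iff (sub_ne_zero.mpr ht)).mp h2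
    intro i hi
    rcases Finset.mem_insert.mp hi with rfl | hi
    · exact (N.add_mem_iff_left (N.sum_mem key)).mp hsum
    · exact key i hi

/-- A weight vector in the span of a set of weight vectors lies in the span of those of the same
weight. -/
lemma mem_span_same_weight {ι : Type*} (w : ι → V) (χ : ι → Module.Dual K 𝔱)
    (hw : ∀ i, w i ∈ wsp 𝔱 V (χ i)) {ψ : Module.Dual K 𝔱} {u : V} (hu : u ∈ wsp 𝔱 V ψ)
    (hspan : u ∈ Submodule.span K (Set.range w)) :
    u ∈ Submodule.span K (w '' {i | χ i = ψ}) := by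
  classical
  obtain ⟨c, rfl⟩ := (Finsupp.mem_span_range_iff_exists_finsupp).mp hspan
  let T := insert ψ (c.support.image χ)
  let f : Module.Dual K 𝔱 → V := fun θ =>
    ∑ i ∈ c.support.filter (fun i => χ i = θ), c i • w i
  have hf : ∀ θ, f θ ∈ wsp 𝔱 V θ := fun θ => Submodule.sum_mem _ fun i hi => by
    rw [← (Finset.mem_filter.mp hi).2]
    exact Submodule.smul_mem _ _ (hw i)
  have hsum : c.sum (fun i a => a • w i) = ∑ θ ∈ T, f θ := by
    rw [Finsupp.sum]
    refine (Finset.sum_fiberwise_of_maps_to (t := T) (g := χ) (fun i hi => ?_) _).symm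
    exact Finset.mem_insert_of_mem (Finset.mem_image_of_mem _ hi)
  -- Subtracting the vector itself from its `ψ`-part gives a vanishing sum of vectors of distinct
  -- weights, so each term vanishes.
  have hsum0 : ∑ θ ∈ T, (f θ - if θ = ψ then c.sum (fun i a => a • w i) else 0) ∈
      (⊥ : Submodule K V) := by
    rw [Finset.sum_sub_distrib, ← hsum, Finset.sum_ite_eq' T ψ, if_pos (Finset.mem_insert_self _ _),
      sub_self]
    exact Submodule.zero_mem _
  have := component_mem (𝔱 := 𝔱) (⊥ : Submodule K V) (by simp) id Function.injective_id T
    (fun θ => f θ - if θ = ψ then c.sum (fun i a => a • w i) else 0)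
    (fun θ _ => by
      by_cases h : θ = ψ
      · subst h; simpa using Submodule.sub_mem _ (hf θ) hu
      · simpa [h] using hf θ) hsum0 ψ (Finset.mem_insert_self _ _)
  rw [if_pos rfl, Submodule.mem_bot, sub_eq_zero] at this
  rw [← this]
  refine Submodule.sum_mem _ fun i hi => Submodule.smul_mem _ _ (Submodule.subset_span ⟨i, ?_, rfl⟩)
  exact (Finset.mem_filter.mp hi).2

end WeightSpace

namespace ChevalleyDatum

variable {K 𝔤 : Type*} [Field K] [CharZero K] [LieRing 𝔤] [LieAlgebra K 𝔤]
  {𝔱 : LieSubalgebra K 𝔤} {P : Type*} (D : ChevalleyDatum K 𝔤 𝔱 P)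
  {V : Type*} [AddCommGroup V] [Module K V] [LieRingModule 𝔤 V] [LieModule K 𝔤 V]

lemma e_mem_wsp (s : P ⊕ P) : D.e s ∈ wsp 𝔱 𝔤 (D.rt s) := fun t => D.lie_t t s


lemma h_swap (s : P ⊕ P) : D.h s.swap = -D.h s := by
  apply Subtype.ext
  rw [← D.lie_e_swap s.swap, Sum.swap_swap, ← lie_skew, D.lie_e_swap]
  rfl

lemma rt_ne_zero (s : P ⊕ P) : D.rt s ≠ 0 := by
  intro h
  have := D.rt_h s
  rw [h] at this
  simp at this

lemma sl2 (s : P ⊕ P) : IsSl2Triple (D.h s : 𝔤) (D.e s) (D.e s.swap) where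
  h_ne_zero h := by
    have h' : D.h s = 0 := Subtype.ext h
    have := D.rt_h s
    rw [h'] at this
    simp at this
  lie_e_f := D.lie_e_swap s
  lie_h_e_nsmul := by rw [D.lie_t, D.rt_h, ofNat_smul_eq_nsmul K 2]
  lie_h_f_nsmul := by
    rw [D.lie_t, D.rt_swap, LinearMap.neg_apply, D.rt_h, neg_smul, ofNat_smul_eq_nsmul K 2]

/-- The last nonzero `e_s ^ k u` is a primitive vector. Local nilpotency of `e_{-s}` alone forces
its `h_s`-eigenvalue to be a natural number `N`, and its first `N` images under `e_{-s}` are then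
nonzero. -/
lemma exists_string {s : P ⊕ P} (hE : LocNil K V (D.e s)) (hF : LocNil K V (D.e s.swap))
    {χ : Module.Dual K 𝔱} {u : V} (hu : u ∈ wsp 𝔱 V χ) (hu0 : u ≠ 0) :
    ∃ N k : ℕ, χ (D.h s) = N - 2 * k ∧
      ∀ j ≤ N, ∃ w ∈ wsp 𝔱 V (χ + k • D.rt s + j • D.rt s.swap), w ≠ 0 := by
  obtain ⟨k, hk1, hk2⟩ := Nat.exists_not_and_succ_of_not_zero_of_exists
    (p := fun k => (toEnd K 𝔤 V (D.e s) ^ k) u = 0) (by simpa using hu0) (hE u)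
  set w := (toEnd K 𝔤 V (D.e s) ^ k) u with hw
  have hwk : w ∈ wsp 𝔱 V (χ + k • D.rt s) := pow_mem_wsp (D.e_mem_wsp s) hu k
  have prim : (D.sl2 s).HasPrimitiveVectorWith w (χ (D.h s) + 2 * k : K) :=
    { ne_zero := hk1
      lie_h := by rw [hwk (D.h s)]; simp [D.rt_h, mul_comm]
      lie_e := by
        rw [← toEnd_apply_apply K, ← Module.End.mul_apply, ← pow_succ']; exact hk2 }
  obtain ⟨N, hN⟩ : ∃ N : ℕ, (χ (D.h s) + 2 * k : K) = N := by
    obtain ⟨n, hn₁, hn₂⟩ := Nat.exists_not_and_succ_of_not_zero_of_exists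
      (p := fun k => (toEnd K 𝔤 V (D.e s.swap) ^ k) w = 0) (by simpa using hk1) (hF w)
    refine ⟨n, ?_⟩
    have := prim.lie_e_pow_succ_toEnd_f n
    rw [hn₂, lie_zero, eq_comm, smul_eq_zero_iff_left hn₁, mul_eq_zero, sub_eq_zero] at this
    exact this.resolve_left <| Nat.cast_add_one_ne_zero n
  refine ⟨N, k, by rw [← hN]; ring, fun j hj => ⟨_, pow_mem_wsp (D.e_mem_wsp s.swap) hwk j, ?_⟩⟩
  exact prim.pow_toEnd_f_ne_zero_of_eq_nat hN hj

/-- The set of weights is stable under the simple reflection if `e_s`, `e_{-s}` act locally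
nilpotently. -/
lemma exists_reflect {s : P ⊕ P} (hE : LocNil K V (D.e s)) (hF : LocNil K V (D.e s.swap))
    {χ : Module.Dual K 𝔱} {u : V} (hu : u ∈ wsp 𝔱 V χ) (hu0 : u ≠ 0) :
    ∃ m : ℤ, χ (D.h s) = m ∧ ∃ w ∈ wsp 𝔱 V (χ - m • D.rt s), w ≠ 0 := by
  obtain ⟨N, k, hχ, hw⟩ := D.exists_string hE hF hu hu0
  obtain ⟨N', k', hχ', hw'⟩ := D.exists_string (s := s.swap) hF (by rwa [Sum.swap_swap]) hu hu0
  refine ⟨N - 2 * k, by rw [hχ]; push_cast; ring, ?_⟩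
  have hNN : (N : ℤ) - 2 * k = 2 * k' - N' := by
    rw [D.h_swap, map_neg, hχ] at hχ'
    have : ((N - 2 * k : ℤ) : K) = ((2 * k' - N' : ℤ) : K) := by
      push_cast
      linear_combination -hχ'
    exact_mod_cast this
  -- The target weight is `N - k` steps below the top of the string if `k ≤ N`. Otherwise it is `N'
  -- - k'` steps above the bottom, by the equality of the two expressions for `χ(h_s)`.
  rcases le_total k N with hkN | hkN
  · obtain ⟨w, hw1, hw2⟩ := hw (N - k) (Nat.sub_le _ _)
    refine ⟨w, ?_, hw2⟩
    convert hw1 using 2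
    rw [D.rt_swap]
    obtain ⟨j, rfl⟩ := Nat.exists_eq_add_of_le hkN
    simp only [Nat.add_sub_cancel_left]
    module
  · obtain ⟨j, hj⟩ : ∃ j : ℕ, N' = k' + j := ⟨N' - k', by omega⟩
    obtain ⟨w, hw1, hw2⟩ := hw' j (by omega)
    refine ⟨w, ?_, hw2⟩
    convert hw1 using 2
    rw [Sum.swap_swap, D.rt_swap, hNN, hj]
    push_cast
    module

end ChevalleyDatum
end SplitReductive

/-! ### Root strings and Cartan integers. -/

namespace SplitReductive
open LieModule
namespace ChevalleyDatum

section RootTheory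

variable {K 𝔤 : Type*} [Field K] [CharZero K] [LieRing 𝔤] [LieAlgebra K 𝔤]
  [FiniteDimensional K 𝔤]
  {𝔱 : LieSubalgebra K 𝔤} [𝔱.IsCartanSubalgebra] [LieModule.IsTriangularizable K 𝔱 𝔤]
  {P : Type*} (D : ChevalleyDatum K 𝔤 𝔱 P)

lemma isNilpotent_ad_e (s : P ⊕ P) : IsNilpotent (toEnd K 𝔤 𝔤 (D.e s)) := by
  refine LieModule.isNilpotent_toEnd_of_mem_rootSpace (L := 𝔤) (M := 𝔤) 𝔱 (χ := D.rt s) ?_ ?_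
  · intro h
    exact D.rt_ne_zero s (LinearMap.ext fun t => congrFun h t)
  · rw [mem_genWeightSpace]
    intro t
    refine ⟨1, ?_⟩
    have := D.lie_t t s
    simp [this]

lemma locNil_ad_e (s : P ⊕ P) : LocNil K 𝔤 (D.e s) := by
  intro m
  obtain ⟨k, hk⟩ := D.isNilpotent_ad_e s
  exact ⟨k, by rw [hk, LinearMap.zero_apply]⟩

lemma exists_int_reflect (s t : P ⊕ P) :
    ∃ m : ℤ, D.rt t (D.h s) = m ∧ ∃ u, D.rt u = D.rt t - m • D.rt s := by
  obtain ⟨m, hm, w, hw, hw0⟩ := D.exists_reflect (D.locNil_ad_e s) (D.locNil_ad_e s.swap)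
    (D.e_mem_wsp t) (D.e_ne_zero t)
  refine ⟨m, hm, ?_⟩
  have hne : D.rt t - m • D.rt s ≠ 0 := by
    intro h
    rw [sub_eq_zero] at h
    have h2 := hm
    rw [h, LinearMap.smul_apply, D.rt_h, zsmul_eq_mul] at h2
    have h3 : (m : K) = 0 := by linear_combination h2
    have h4 : m = 0 := by exact_mod_cast h3
    rw [h4, zero_smul] at h
    exact D.rt_ne_zero t h
  obtain ⟨u, hu, -⟩ := D.exists_of_weight _ w hne hw0 hw
  exact ⟨u, hu⟩

lemma exists_int (s t : P ⊕ P) : ∃ m : ℤ, D.rt t (D.h s) = m :=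
  let ⟨m, hm, _⟩ := D.exists_int_reflect s t
  ⟨m, hm⟩

lemma lie_eq_zero {s t : P ⊕ P} (h0 : D.rt s + D.rt t ≠ 0) (h : ∀ u, D.rt u ≠ D.rt s + D.rt t) :
    ⁅D.e s, D.e t⁆ = 0 := by
  by_contra hne
  obtain ⟨u, hu, -⟩ := D.exists_of_weight _ _ h0 hne
    (by rw [add_comm]; exact lie_mem_wsp (D.e_mem_wsp s) (D.e_mem_wsp t))
  exact h u hu

lemma wsp_unique (D : ChevalleyDatum K 𝔤 𝔱 P) {χ : Module.Dual K 𝔱} (hχ : χ ≠ 0) {a b : 𝔤}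
    (ha : a ∈ wsp 𝔱 𝔤 χ) (ha0 : a ≠ 0)
    (hb : b ∈ wsp 𝔱 𝔤 χ) : ∃ c : K, b = c • a := by
  by_cases hb0 : b = 0
  · exact ⟨0, by rw [hb0, zero_smul]⟩
  obtain ⟨s, hs, c, rfl⟩ := D.exists_of_weight χ a hχ ha0 ha
  obtain ⟨t, ht, d, rfl⟩ := D.exists_of_weight χ b hχ hb0 hb
  have hst : t = s := D.rt_injective (ht.trans hs.symm)
  have hc : c ≠ 0 := by rintro rfl; simp at ha0
  exact ⟨d * c⁻¹, by rw [smul_smul, mul_assoc, inv_mul_cancel₀ hc, mul_one, hst]⟩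

/-- If `t = 2s`, then `3s` is not a root, since its coroot would pair with `s` to `2/3`. So `e_s`
kills `e_t`, and `e_{-s}` sends it to a multiple of `e_s`. Hence `h_s = [e_s, e_{-s}]` kills `e_t`,
on which it acts by `4`. -/
lemma rt_ne_two_smul (s t : P ⊕ P) : D.rt t ≠ (2 : K) • D.rt s := by
  intro h
  have h1 : ⁅D.e s, D.e t⁆ = 0 := by
    refine D.lie_eq_zero (fun h0 => ?_) fun u hu => ?_
    · have : (3 : K) • D.rt s = 0 := by rw [← h0, h]; module
      exact D.rt_ne_zero s ((smul_eq_zero.mp this).resolve_left (by norm_num))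
    · have hu3 : D.rt u = (3 : K) • D.rt s := by rw [hu, h]; module
      obtain ⟨m, hm⟩ := D.exists_int u s
      have := D.rt_h u
      rw [hu3, LinearMap.smul_apply, hm, smul_eq_mul] at this
      have : (3 * m : ℤ) = 2 := by exact_mod_cast this
      omega
  obtain ⟨N, hN⟩ := D.lie_int s.swap t s (by rw [D.rt_swap, h]; module)
  have h2 : ⁅(D.h s : 𝔤), D.e t⁆ = 0 := by
    rw [← D.lie_e_swap, lie_lie, hN, h1, lie_zero, lie_zsmul, lie_self, smul_zero, sub_zero]
  rw [D.lie_t, h, LinearMap.smul_apply, D.rt_h, smul_eq_zero] at h2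
  rcases h2 with h2 | h2
  · norm_num at h2
  · exact D.e_ne_zero t h2

/-- The two Cartan integers are `m = 2c` and `n = 2/c`, with product `4`. Thus `m` is `±1`, `±2` or
`±4`, and the odd and fourfold cases make one root twice another. -/
lemma eq_or_eq_swap {s t : P ⊕ P} {c : K} (h : D.rt t = c • D.rt s) : t = s ∨ t = s.swap := by
  obtain ⟨m, hm⟩ := D.exists_int s t
  obtain ⟨n, hn⟩ := D.exists_int t s
  have h1 : c * 2 = m := by rw [← hm, h, LinearMap.smul_apply, D.rt_h, smul_eq_mul]
  have h2 : c * n = 2 := by rw [← D.rt_h t, ← hn, h, LinearMap.smul_apply, smul_eq_mul]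
  have hmn : m * n = 4 := by
    have : (m : K) * n = 4 := by rw [← h1]; linear_combination 2 * h2
    exact_mod_cast this
  have hm4 : m ∣ 4 := ⟨n, hmn.symm⟩
  have hle : m ≤ 4 := Int.le_of_dvd (by norm_num) hm4
  have hge : -4 ≤ m := by
    have := Int.le_of_dvd (by norm_num) ((neg_dvd).mpr hm4)
    omega
  have hc : c = m / 2 := by rw [← h1]; field_simp
  have key : m = 2 ∨ m = -2 ∨ m = 4 ∨ m = -4 ∨ m = 1 ∨ m = -1 := by
    interval_cases m <;> omega
  rcases key with rfl | rfl | rfl | rfl | rfl | rfl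
  · left; apply D.rt_injective; rw [h, hc]; norm_num
  · right; apply D.rt_injective; rw [h, hc, D.rt_swap]; push_cast; module
  · refine (D.rt_ne_two_smul s t ?_).elim; rw [h, hc]; norm_num
  · refine (D.rt_ne_two_smul s.swap t ?_).elim; rw [h, hc, D.rt_swap]; push_cast; module
  · refine (D.rt_ne_two_smul t s ?_).elim; rw [h, hc]; push_cast; module
  · refine (D.rt_ne_two_smul t.swap s ?_).elim; rw [D.rt_swap, h, hc]; push_cast; module

lemma add_smul_rt_ne_zero {s t : P ⊕ P} (h1 : t ≠ s) (h2 : t ≠ s.swap) (c : K) :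
    D.rt t + c • D.rt s ≠ 0 := by
  intro h
  have : D.rt t = (-c) • D.rt s := by
    rw [eq_neg_of_add_eq_zero_left h]; module
  rcases D.eq_or_eq_swap this with h | h
  exacts [h1 h, h2 h]

/-- On a root vector `e_t` with `[e_s, ·]`-chain of length exactly `q`, the operator
`ad e_{-s} ∘ ad e_s` acts by `q (m + q + 1)`, where `m = ⟨t, s^∨⟩`. -/
lemma lie_swap_lie {s t : P ⊕ P} (h1 : t ≠ s) (h2 : t ≠ s.swap) {q : ℕ}
    (hq : (toEnd K 𝔤 𝔤 (D.e s) ^ q) (D.e t) ≠ 0)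
    (hq' : (toEnd K 𝔤 𝔤 (D.e s) ^ (q + 1)) (D.e t) = 0) :
    ⁅D.e s.swap, ⁅D.e s, D.e t⁆⁆ = ((q : K) * (D.rt t (D.h s) + q + 1)) • D.e t := by
  set u : ℕ → 𝔤 := fun i => (toEnd K 𝔤 𝔤 (D.e s) ^ i) (D.e t) with hu
  have hsucc : ∀ i, ⁅D.e s, u i⁆ = u (i + 1) := fun i => by simp [hu, pow_succ']
  have hne : ∀ i ≤ q, u i ≠ 0 := fun i hi h0 => hq (Module.End.pow_map_zero_of_le hi h0)
  have hw : ∀ i, u i ∈ wsp 𝔱 𝔤 (D.rt t + i • D.rt s) :=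
    fun i => pow_mem_wsp (D.e_mem_wsp s) (D.e_mem_wsp t) i
  -- The coefficients are found downwards from the top of the string, `k` being the distance from
  -- it. Each bracket is a multiple of `u j` because root spaces are lines; applying `e_s` and
  -- commuting identifies the multiple.
  have key : ∀ k ≤ q, ⁅D.e s.swap, u (q - k + 1)⁆ =
      ((k : K) * (D.rt t (D.h s) + q + (q - k) + 1)) • u (q - k) := by
    intro k
    induction k with
    | zero =>
      intro _
      have : u (q + 1) = 0 := hq'
      simp [this]
    | succ k ih =>
      intro hk
      obtain ⟨j, rfl⟩ : ∃ j, q = j + (k + 1) := ⟨q - (k + 1), by omega⟩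
      have ih := ih (by omega)
      rw [show j + (k + 1) - k = j + 1 by omega] at ih
      rw [show j + (k + 1) - (k + 1) = j by omega]
      have hwt : ⁅D.e s.swap, u (j + 1)⁆ ∈ wsp 𝔱 𝔤 (D.rt t + j • D.rt s) := by
        have := lie_mem_wsp (D.e_mem_wsp s.swap) (hw (j + 1))
        rw [D.rt_swap] at this
        convert this using 2
        module
      obtain ⟨c, hc⟩ := D.wsp_unique
        (by rw [← Nat.cast_smul_eq_nsmul K]; exact D.add_smul_rt_ne_zero h1 h2 _)
        (hw j) (hne j (by omega)) hwt
      have h3 : ⁅D.e s, ⁅D.e s.swap, u (j + 1)⁆⁆ =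
          ⁅(D.h s : 𝔤), u (j + 1)⁆ + ⁅D.e s.swap, u (j + 1 + 1)⁆ := by
        rw [leibniz_lie, D.lie_e_swap, hsucc]
      rw [hc, lie_smul, hsucc, hw (j + 1) (D.h s), ih, ← add_smul] at h3
      have h4 := smul_left_injective K (hne (j + 1) (by omega)) h3
      rw [hc, h4]
      congr 1
      simp only [LinearMap.add_apply, LinearMap.smul_apply, D.rt_h, nsmul_eq_mul]
      push_cast
      ring
  have := key q le_rfl
  rw [Nat.sub_self] at this
  have h0 : u 0 = D.e t := by simp [hu]
  rw [← hsucc, h0] at this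
  rw [this]
  congr 1
  ring

/-- Computing `e_s e_{-s} - e_{-s} e_s = h_s` on `e_t` from both ends of the string, with `m = ⟨t,
s^∨⟩`, gives `(r - q - m)(r + q + 1) = 0`, hence `m = r - q`. -/
lemma exists_nat_string {s t : P ⊕ P} (h1 : t ≠ s) (h2 : t ≠ s.swap) :
    ∃ q r : ℕ, D.rt t (D.h s) = r - q ∧
      (toEnd K 𝔤 𝔤 (D.e s) ^ q) (D.e t) ≠ 0 ∧ (toEnd K 𝔤 𝔤 (D.e s) ^ (q + 1)) (D.e t) = 0 ∧
      (toEnd K 𝔤 𝔤 (D.e s.swap) ^ r) (D.e t) ≠ 0 ∧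
      (toEnd K 𝔤 𝔤 (D.e s.swap) ^ (r + 1)) (D.e t) = 0 ∧
      ⁅D.e s.swap, ⁅D.e s, D.e t⁆⁆ = ((q : K) * (r + 1)) • D.e t := by
  obtain ⟨q, hq, hq'⟩ := Nat.exists_not_and_succ_of_not_zero_of_exists
    (p := fun k => (toEnd K 𝔤 𝔤 (D.e s) ^ k) (D.e t) = 0) (by simpa using D.e_ne_zero t)
    (D.locNil_ad_e s _)
  obtain ⟨r, hr, hr'⟩ := Nat.exists_not_and_succ_of_not_zero_of_exists
    (p := fun k => (toEnd K 𝔤 𝔤 (D.e s.swap) ^ k) (D.e t) = 0) (by simpa using D.e_ne_zero t)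
    (D.locNil_ad_e s.swap _)
  have e1 := D.lie_swap_lie h1 h2 hq hq'
  have e2 := D.lie_swap_lie (s := s.swap) h2 (by rwa [Sum.swap_swap]) hr hr'
  rw [Sum.swap_swap, D.h_swap, map_neg] at e2
  have e3 : ⁅D.e s, ⁅D.e s.swap, D.e t⁆⁆ = ⁅(D.h s : 𝔤), D.e t⁆ + ⁅D.e s.swap, ⁅D.e s, D.e t⁆⁆ := by
    rw [leibniz_lie, D.lie_e_swap]
  rw [e1, e2, D.lie_t, ← add_smul] at e3
  have e4 := smul_left_injective K (D.e_ne_zero t) e3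
  have e5 : ((r : K) - q - D.rt t (D.h s)) * ((r + q + 1 : ℕ) : K) = 0 := by
    push_cast
    linear_combination e4
  have e6 : D.rt t (D.h s) = r - q := by
    rcases mul_eq_zero.mp e5 with h | h
    · linear_combination -h
    · exact absurd h (Nat.cast_ne_zero.mpr (by omega))
  refine ⟨q, r, e6, hq, hq', hr, hr', ?_⟩
  rw [e1, e6]
  congr 1
  ring

/-! ### The Killing form -/

lemma killing_rt_mul (s : P ⊕ P) (t : 𝔱) :
    D.rt s t * killingForm K 𝔤 (D.e s) (D.e s.swap) = killingForm K 𝔤 (D.h s : 𝔤) t := by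
  rw [← D.lie_e_swap, traceForm_apply_lie_apply, ← lie_skew, map_neg, D.lie_t, D.rt_swap]
  simp

lemma killing_e_e {s t : P ⊕ P} (h : D.rt s + D.rt t ≠ 0) :
    killingForm K 𝔤 (D.e s) (D.e t) = 0 := by
  obtain ⟨x, hx⟩ : ∃ x, (D.rt s + D.rt t) x ≠ 0 := by
    by_contra! h'
    exact h (LinearMap.ext h')
  have := traceForm_apply_lie_apply' K 𝔤 𝔤 (x : 𝔤) (D.e s) (D.e t)
  rw [D.lie_t, D.lie_t, map_smul, map_smul, LinearMap.smul_apply, ← add_eq_zero_iff_eq_neg,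
    ← add_smul] at this
  exact (smul_eq_zero.mp this).resolve_left hx

lemma lie_h_h (t : 𝔱) (s : P ⊕ P) : ⁅(t : 𝔤), (D.h s : 𝔤)⁆ = 0 := by
  rw [← D.lie_e_swap, leibniz_lie, D.lie_t, D.lie_t, D.rt_swap]
  simp

lemma killing_h_e (s t : P ⊕ P) : killingForm K 𝔤 (D.h s : 𝔤) (D.e t) = 0 := by
  obtain ⟨x, hx⟩ : ∃ x, D.rt t x ≠ 0 := by
    by_contra! h'
    exact D.rt_ne_zero t (LinearMap.ext h')
  have := traceForm_apply_lie_apply' K 𝔤 𝔤 (x : 𝔤) (D.h s : 𝔤) (D.e t)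
  rw [D.lie_t, D.lie_h_h, map_smul, map_zero, LinearMap.zero_apply, eq_comm, neg_eq_zero] at this
  exact (smul_eq_zero.mp this).resolve_left hx

lemma weight_eq_zero_or (χ : LieModule.Weight K 𝔱 𝔤) :
    (∀ t, χ t = 0) ∨ ∃ s, ∀ t, χ t = D.rt s t := by
  obtain ⟨m, hm0, hm⟩ := exists_forall_lie_eq_smul K 𝔱 𝔤 χ
  by_cases h : χ.toLinear = 0
  · exact Or.inl fun t => LinearMap.congr_fun h t
  · obtain ⟨s, hs, -⟩ := D.exists_of_weight χ.toLinear m h hm0 hm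
    exact Or.inr ⟨s, fun t => (LinearMap.congr_fun hs t).symm⟩

lemma killing_apply (t t' : 𝔱) : killingForm K 𝔤 (t : 𝔤) t' =
    ∑ χ : Weight K 𝔱 𝔤, Module.finrank K (genWeightSpace 𝔤 χ) • (χ t * χ t') :=
  traceForm_eq_sum_finrank_nsmul_mul K 𝔱 𝔤 t t'

/-- Substitute for positive definiteness, `K` being unordered: `κ(t, t)` is a sum of squares of
integers weighted by multiplicities, so it vanishes only if every weight vanishes at `t`. -/
lemma killing_self_nat (t : 𝔱) (ht : ∀ s, ∃ m : ℤ, D.rt s t = m) :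
    ∃ n : ℕ, killingForm K 𝔤 (t : 𝔤) t = n ∧ (n = 0 → ∀ t' : 𝔱, killingForm K 𝔤 (t : 𝔤) t' = 0) := by
  have hχ : ∀ χ : Weight K 𝔱 𝔤, ∃ m : ℤ, χ t = m := fun χ => by
    rcases D.weight_eq_zero_or χ with h | ⟨s, h⟩
    · exact ⟨0, by rw [h]; simp⟩
    · obtain ⟨m, hm⟩ := ht s
      exact ⟨m, by rw [h, hm]⟩
  choose m hm using hχ
  refine ⟨∑ χ : Weight K 𝔱 𝔤, Module.finrank K (genWeightSpace 𝔤 χ) * (m χ).natAbs ^ 2, ?_, ?_⟩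
  · rw [killing_apply]
    push_cast
    refine Finset.sum_congr rfl fun χ _ => ?_
    rw [hm, nsmul_eq_mul, ← sq]
    congr 1
    have := congrArg (Int.cast : ℤ → K) (Int.natAbs_sq (m χ))
    push_cast at this
    rw [← this]
    rw [Nat.cast_natAbs]
  · intro h0 t'
    rw [killing_apply]
    refine Finset.sum_eq_zero fun χ _ => ?_
    have := (Finset.sum_eq_zero_iff.mp h0) χ (Finset.mem_univ _)
    rcases mul_eq_zero.mp this with h | h
    · rw [h, zero_smul]
    · have : m χ = 0 := by simpa using h
      rw [hm, this]
      simp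

lemma killing_h_h (s : P ⊕ P) : ∃ n : ℕ, 0 < n ∧ killingForm K 𝔤 (D.h s : 𝔤) (D.h s) = n := by
  obtain ⟨n, hn, hn0⟩ := D.killing_self_nat (D.h s) (D.exists_int s)
  refine ⟨n, Nat.pos_of_ne_zero fun h => ?_, hn⟩
  have h1 : ∀ χ : Weight K 𝔱 𝔤, ∃ m : ℤ, χ (D.h s) = m := fun χ => by
    rcases D.weight_eq_zero_or χ with h | ⟨t, h⟩
    · exact ⟨0, by rw [h]; simp⟩
    · obtain ⟨m, hm⟩ := D.exists_int s t
      exact ⟨m, by rw [h, hm]⟩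
  choose m hm using h1
  have hsum : (∑ χ : Weight K 𝔱 𝔤, (Module.finrank K (genWeightSpace 𝔤 χ) : ℤ) * (m χ * m χ)) = 0 := by
    have := hn
    rw [h, killing_apply] at this
    simp only [hm, nsmul_eq_mul] at this
    exact_mod_cast this
  have hne : genWeightSpace 𝔤 (D.rt s : 𝔱 → K) ≠ ⊥ := by
    intro hbot
    have : D.e s ∈ genWeightSpace 𝔤 (D.rt s : 𝔱 → K) := by
      rw [mem_genWeightSpace]
      intro t
      refine ⟨1, ?_⟩
      have := D.lie_t t s
      simp [this]
    rw [hbot, LieSubmodule.mem_bot] at this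
    exact D.e_ne_zero s this
  have h2 := (Finset.sum_eq_zero_iff_of_nonneg
    (fun χ _ => mul_nonneg (Int.natCast_nonneg _) (mul_self_nonneg (m χ)))).mp hsum
      ⟨D.rt s, hne⟩ (Finset.mem_univ _)
  have h3 : m ⟨D.rt s, hne⟩ = 2 := by
    have h4 := (hm ⟨D.rt s, hne⟩).symm
    have h5 : (⟨D.rt s, hne⟩ : Weight K 𝔱 𝔤) (D.h s) = 2 := D.rt_h s
    rw [h5] at h4
    exact_mod_cast h4
  rw [h3] at h2
  have h6 : Module.finrank K (genWeightSpace 𝔤 (D.rt s : 𝔱 → K)) = 0 := by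
    have : (Module.finrank K (genWeightSpace 𝔤 (D.rt s : 𝔱 → K)) : ℤ) * (2 * 2) = 0 := h2
    omega
  have h7 := Submodule.finrank_eq_zero.mp h6
  exact hne ((LieSubmodule.toSubmodule_eq_bot _).mp h7)

/-- The Killing form may be degenerate on the centre; this is the nondegeneracy that survives, and
it follows from `κ(h_s, h_s) > 0`. -/
lemma killing_e_swap_ne_zero (s : P ⊕ P) : killingForm K 𝔤 (D.e s) (D.e s.swap) ≠ 0 := by
  intro h
  obtain ⟨n, hn0, hn⟩ := D.killing_h_h s
  rw [← D.killing_rt_mul, h, mul_zero] at hn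
  exact hn0.ne' (by exact_mod_cast hn.symm)

lemma two_mul_killing_e_swap (s : P ⊕ P) :
    2 * killingForm K 𝔤 (D.e s) (D.e s.swap) = killingForm K 𝔤 (D.h s : 𝔤) (D.h s) := by
  rw [← D.killing_rt_mul, D.rt_h]

/-- Symmetry of signs of Cartan integers, and the bound `⟨u, s^∨⟩⟨s, u^∨⟩ ≤ 3`. -/
lemma cartan_symm (s u : P ⊕ P) : ∃ a b : ℤ, D.rt u (D.h s) = a ∧ D.rt s (D.h u) = b ∧
    (0 < a ↔ 0 < b) ∧ (a = 0 ↔ b = 0) ∧ (u ≠ s → u ≠ s.swap → a * b ≤ 3) := by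
  obtain ⟨a, ha⟩ := D.exists_int s u
  obtain ⟨b, hb⟩ := D.exists_int u s
  obtain ⟨n, hn0, hn⟩ := D.killing_h_h s
  obtain ⟨k, hk0, hk⟩ := D.killing_h_h u
  have e1 : (a : K) * k = 2 * killingForm K 𝔤 (D.h u : 𝔤) (D.h s) := by
    rw [← hk, ← D.two_mul_killing_e_swap, ← D.killing_rt_mul, ha]; ring
  have e2 : (b : K) * n = 2 * killingForm K 𝔤 (D.h u : 𝔤) (D.h s) := by
    rw [← hn, ← D.two_mul_killing_e_swap, traceForm_comm K 𝔤 𝔤 (D.h u : 𝔤), ← D.killing_rt_mul, hb]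
    ring
  have e3 : a * k = b * n := by exact_mod_cast e1.trans e2.symm
  have hn0' : (0 : ℤ) < n := by exact_mod_cast hn0
  have hk0' : (0 : ℤ) < k := by exact_mod_cast hk0
  refine ⟨a, b, ha, hb, ?_, ?_, fun h1 h2 => ?_⟩
  · rw [← mul_pos_iff_of_pos_right hk0', e3, mul_pos_iff_of_pos_right hn0']
  · rw [← mul_eq_zero_iff_right hk0'.ne', e3, mul_eq_zero_iff_right hn0'.ne']
  -- Cauchy–Schwarz: `2 h_u - b h_s` has square length `(4 - ab) κ(h_u, h_u)`. If `ab ≥ 4`, this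
  -- vector is orthogonal to `𝔱`, which makes `u` and `s` proportional.
  · obtain ⟨j, hj, hj0⟩ := D.killing_self_nat ((2 : ℤ) • D.h u - b • D.h s) fun v => by
      obtain ⟨c, hc⟩ := D.exists_int u v
      obtain ⟨d, hd⟩ := D.exists_int s v
      exact ⟨2 * c - b * d, by
        rw [map_sub, map_zsmul, map_zsmul, hc, hd]; push_cast; simp⟩
    have e4 : (j : ℤ) = (4 - a * b) * k := by
      have : (j : K) = 4 * k - 4 * b * killingForm K 𝔤 (D.h u : 𝔤) (D.h s) + b * b * n := by
        rw [← hj, ← hk, ← hn]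
        simp only [AddSubgroupClass.coe_sub, AddSubgroupClass.coe_zsmul, map_sub, map_zsmul,
          LinearMap.sub_apply, LinearMap.smul_apply, zsmul_eq_mul]
        rw [traceForm_comm K 𝔤 𝔤 (D.h s : 𝔤) (D.h u : 𝔤)]
        push_cast
        ring
      have h5 : (j : K) = (4 - a * b) * k := by
        rw [this]
        linear_combination (b : K) * e1 + (b : K) * e2
      exact_mod_cast h5
    by_contra! hlt
    have hjz : j = 0 := by
      have : (j : ℤ) ≤ 0 := by rw [e4]; nlinarith
      omega
    have h6 : ∀ t : 𝔱, (2 : K) * (D.rt u t * killingForm K 𝔤 (D.e u) (D.e u.swap)) =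
        b * (D.rt s t * killingForm K 𝔤 (D.e s) (D.e s.swap)) := fun t => by
      have := hj0 hjz t
      simp only [AddSubgroupClass.coe_sub, AddSubgroupClass.coe_zsmul, map_sub, map_zsmul,
        LinearMap.sub_apply, LinearMap.smul_apply, zsmul_eq_mul] at this
      rw [D.killing_rt_mul, D.killing_rt_mul]
      push_cast at this
      linear_combination this
    have hu0 := D.killing_e_swap_ne_zero u
    have : D.rt u = (b * killingForm K 𝔤 (D.e s) (D.e s.swap) /
        (2 * killingForm K 𝔤 (D.e u) (D.e u.swap))) • D.rt s := by
      ext t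
      rw [LinearMap.smul_apply, smul_eq_mul]
      field_simp
      linear_combination h6 t
    rcases D.eq_or_eq_swap this with h | h
    exacts [h1 h, h2 h]

end RootTheory
end ChevalleyDatum
end SplitReductive

/-! ### Positive roots, heights and bounds on root strings. -/

namespace SplitReductive
open LieModule
namespace ChevalleyDatum

section Positivity

variable {K 𝔤 : Type*} [Field K] [CharZero K] [LieRing 𝔤] [LieAlgebra K 𝔤]
  [FiniteDimensional K 𝔤]
  {𝔱 : LieSubalgebra K 𝔤} [𝔱.IsCartanSubalgebra] [LieModule.IsTriangularizable K 𝔱 𝔤]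
  {P : Type*} (D : ChevalleyDatum K 𝔤 𝔱 P)

/-- The sum of the fundamental coweights. -/
def rho : 𝔱 := ∑ α ∈ D.S, D.coweight α

/-- The height of a positive root. -/
def ht (β : P) : ℕ := ∑ α ∈ D.S, D.cf β α

/-- The positive roots that are combinations of the simple roots in `J`. -/
def PJ (J : Finset P) : Set P := {β | ∀ α ∈ D.S, α ∉ J → D.cf β α = 0}

lemma rt_coweight (β : P) {α : P} (hα : α ∈ D.S) :
    D.rt (Sum.inl β) (D.coweight α) = D.cf β α := by
  rw [D.rt_cf, LinearMap.sum_apply, Finset.sum_eq_single α]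
  · rw [LinearMap.smul_apply, D.rt_coweight_self α hα, nsmul_one]
  · intro α' hα' hne
    rw [LinearMap.smul_apply, D.rt_coweight_ne α' hα' α hα hne, smul_zero]
  · exact fun h => absurd hα h

lemma rt_rho (β : P) : D.rt (Sum.inl β) D.rho = D.ht β := by
  rw [rho, map_sum, ht, Nat.cast_sum]
  exact Finset.sum_congr rfl fun α hα => D.rt_coweight β hα

lemma exists_cf_pos (β : P) : ∃ α ∈ D.S, 0 < D.cf β α := by
  by_contra! h
  apply D.rt_ne_zero (Sum.inl β)
  rw [D.rt_cf]
  exact Finset.sum_eq_zero fun α hα => by rw [Nat.le_zero.mp (h α hα), zero_smul]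

lemma ht_pos (β : P) : 0 < D.ht β := by
  obtain ⟨α, hα, h⟩ := D.exists_cf_pos β
  exact h.trans_le (Finset.single_le_sum (f := D.cf β) (fun _ _ => Nat.zero_le _) hα)

lemma cf_ne {α α' : P} (hα : α ∈ D.S) (hα' : α' ∈ D.S) (h : α ≠ α') : D.cf α α' = 0 := by
  have := D.rt_coweight α hα'
  rw [D.rt_coweight_ne α hα α' hα' h] at this
  exact_mod_cast this.symm

lemma mem_PJ_of_mem {J : Finset P} (hJ : J ⊆ D.S) {α : P} (hα : α ∈ J) : α ∈ D.PJ J :=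
  fun _ hα' hne => D.cf_ne (hJ hα) hα' fun h => hne (h ▸ hα)

lemma exists_eq_inl {u : P ⊕ P} {α : P} (hα : α ∈ D.S) {n : ℤ} (hn : 0 < n)
    (h : D.rt u (D.coweight α) = n) : ∃ β, u = Sum.inl β := by
  rcases u with β | β
  · exact ⟨β, rfl⟩
  · have h1 : D.rt (Sum.inr β) = -D.rt (Sum.inl β) := D.rt_swap (Sum.inl β)
    rw [h1, LinearMap.neg_apply, D.rt_coweight β hα] at h
    have : -(D.cf β α : ℤ) = n := by exact_mod_cast h
    omega

lemma exists_cf_pos_of_ne {α β : P} (hα : α ∈ D.S) (h : β ≠ α) :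
    ∃ α' ∈ D.S, α' ≠ α ∧ 0 < D.cf β α' := by
  by_contra! h'
  have : D.rt (Sum.inl β) = (D.cf β α : K) • D.rt (Sum.inl α) := by
    rw [D.rt_cf, Finset.sum_eq_single α, Nat.cast_smul_eq_nsmul]
    · intro α' hα' hne
      rw [Nat.le_zero.mp (h' α' hα' hne), zero_smul]
    · exact fun h => absurd hα h
  rcases D.eq_or_eq_swap this with h1 | h1
  · exact h (Sum.inl_injective h1)
  · simp at h1

/-- Subtracting multiples of `α` leaves the other simple coefficients alone; one of them is
positive, and that decides the sign of the root. -/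
lemma exists_inl_of_sub_smul {α β : P} (hα : α ∈ D.S) (h : β ≠ α) {m : ℤ} {u : P ⊕ P}
    (hu : D.rt u = D.rt (Sum.inl β) - m • D.rt (Sum.inl α)) : ∃ δ, u = Sum.inl δ := by
  obtain ⟨α', hα', hne, hpos⟩ := D.exists_cf_pos_of_ne hα h
  refine D.exists_eq_inl hα' (n := D.cf β α') (by exact_mod_cast hpos) ?_
  rw [hu, LinearMap.sub_apply, LinearMap.smul_apply, D.rt_coweight β hα',
    D.rt_coweight_ne α hα α' hα' hne.symm]
  simp

/-- Expanding `2 = ⟨γ, γ^∨⟩` over simple roots, some term is positive; the signs of `⟨α, γ^∨⟩` and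
`⟨γ, α^∨⟩` agree by `cartan_symm`. -/
lemma exists_simple_pos_pairing (γ : P) : ∃ α ∈ D.S, 0 < D.cf γ α ∧
    ∃ m : ℤ, 0 < m ∧ D.rt (Sum.inl γ) (D.h (Sum.inl α)) = m := by
  choose a b ha hb hpos _ _ using fun α : P => D.cartan_symm (Sum.inl α) (Sum.inl γ)
  have h2 : ∑ α ∈ D.S, (D.cf γ α : ℤ) * b α = 2 := by
    have := D.rt_h (Sum.inl γ)
    rw [D.rt_cf, LinearMap.sum_apply] at this
    simp only [LinearMap.smul_apply, hb, nsmul_eq_mul] at this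
    exact_mod_cast this
  obtain ⟨α, hα, h3⟩ : ∃ α ∈ D.S, 0 < (D.cf γ α : ℤ) * b α := by
    by_contra! h
    have := Finset.sum_nonpos h
    omega
  have h4 : 0 < (D.cf γ α : ℤ) := by
    rcases Nat.eq_zero_or_pos (D.cf γ α) with h | h
    · rw [h] at h3; simp at h3
    · exact_mod_cast h
  exact ⟨α, hα, by exact_mod_cast h4, a α, (hpos α).mpr (pos_of_mul_pos_right h3 h4.le), ha α⟩

lemma exists_rt_sub {s t : P ⊕ P} (h1 : t ≠ s) (h2 : t ≠ s.swap) {m : ℤ} (hm : 0 < m)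
    (h : D.rt t (D.h s) = m) : ∃ u, D.rt u = D.rt t - D.rt s := by
  obtain ⟨q, r, hqr, -, -, hr, -, -⟩ := D.exists_nat_string h1 h2
  have : (m : ℤ) = r - q := by rw [h] at hqr; exact_mod_cast hqr
  have hr1 : (toEnd K 𝔤 𝔤 (D.e s.swap) ^ 1) (D.e t) ≠ 0 := fun h0 =>
    hr (Module.End.pow_map_zero_of_le (by omega) h0)
  have hw := pow_mem_wsp (D.e_mem_wsp s.swap) (D.e_mem_wsp t) 1
  have hne : D.rt t + 1 • D.rt s.swap ≠ 0 := by
    rw [← Nat.cast_smul_eq_nsmul K]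
    exact D.add_smul_rt_ne_zero h2 (by rwa [Sum.swap_swap]) _
  obtain ⟨u, hu, -⟩ := D.exists_of_weight _ _ hne hr1 hw
  exact ⟨u, by rw [hu, D.rt_swap]; module⟩

/-- The bottom `u = t - r s` of the string pairs with `s^∨` to `-(q + r)`, so `q + r` is up to sign
a Cartan integer, and it is at most `3` by `cartan_symm`. -/
lemma string_bound {s t : P ⊕ P} (h1 : t ≠ s) (h2 : t ≠ s.swap) {q r : ℕ}
    (hqr : D.rt t (D.h s) = r - q)
    (hr : (toEnd K 𝔤 𝔤 (D.e s.swap) ^ r) (D.e t) ≠ 0) :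
    q + r ≤ 3 ∧ ∃ u, u ≠ s ∧ u ≠ s.swap ∧ D.rt u (D.h s) = ((-(q + r : ℕ) : ℤ) : K) := by
  have hw := pow_mem_wsp (D.e_mem_wsp s.swap) (D.e_mem_wsp t) r
  have hne : D.rt t + r • D.rt s.swap ≠ 0 := by
    rw [← Nat.cast_smul_eq_nsmul K]
    exact D.add_smul_rt_ne_zero h2 (by rwa [Sum.swap_swap]) _
  obtain ⟨u, hu, -⟩ := D.exists_of_weight _ _ hne hr hw
  have hus : ∀ c : K, D.rt u ≠ c • D.rt s := fun c hc => by
    refine D.add_smul_rt_ne_zero h1 h2 (-(r : K) - c) ?_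
    rw [D.rt_swap, hc] at hu
    have : D.rt t = c • D.rt s + (r : K) • D.rt s := by
      rw [hu, Nat.cast_smul_eq_nsmul]; module
    rw [this]
    module
  have h3 : u ≠ s := fun h => hus 1 (by rw [h, one_smul])
  have h4 : u ≠ s.swap := fun h => hus (-1) (by rw [h, D.rt_swap]; module)
  have h5 : D.rt u (D.h s) = ((-(q + r : ℕ) : ℤ) : K) := by
    rw [hu, LinearMap.add_apply, LinearMap.smul_apply, D.rt_swap, LinearMap.neg_apply, D.rt_h, hqr,
      nsmul_eq_mul]
    push_cast
    ring
  refine ⟨?_, u, h3, h4, h5⟩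
  obtain ⟨a, b, ha, hb, hpos, hz, hab⟩ := D.cartan_symm s u
  have h6 : a = -(q + r : ℕ) := by
    rw [h5] at ha
    exact_mod_cast ha.symm
  have h7 := hab h3 h4
  by_contra! hlt
  have h8 : b ≤ -1 := by
    by_contra! hb0
    rcases eq_or_lt_of_le (show 0 ≤ b by omega) with hb1 | hb1
    · have := hz.mpr hb1.symm; omega
    · have := hpos.mpr hb1; omega
  have h9 : a ≤ -4 := by omega
  nlinarith

/-! ### Factorials and structure constants are units at `p`. -/

section Prime

variable {p : ℕ} [hprime : Fact p.Prime]

/-- The pair `-β ≠ β` has Cartan integer `-2`. -/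
lemma prime_ne_two (D : ChevalleyDatum K 𝔤 𝔱 P)
    (hp : ∀ β : P, ∀ t, t ≠ Sum.inl β → ∀ m : ℤ, D.rt t (D.h (Sum.inl β)) = m → m ≠ 0 →
      ¬ (p : ℤ) ∣ m) (β : P) : p ≠ 2 := by
  rintro rfl
  refine hp β (Sum.inr β) (by simp) (-2) ?_ (by norm_num) (by norm_num)
  have h1 : D.rt (Sum.inr β) = -D.rt (Sum.inl β) := D.rt_swap (Sum.inl β)
  rw [h1, LinearMap.neg_apply, D.rt_h]
  norm_num

/-- Since `p ≠ 2` and `q + r ≤ 3`, failure of `q + r < p` means `p = 3 = q + r`; but `-(q + r)` is a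
Cartan integer. -/
lemma not_dvd_of_le (D : ChevalleyDatum K 𝔤 𝔱 P)
    (hp : ∀ β : P, ∀ t, t ≠ Sum.inl β → ∀ m : ℤ, D.rt t (D.h (Sum.inl β)) = m → m ≠ 0 →
      ¬ (p : ℤ) ∣ m) {β : P} {t : P ⊕ P} (h1 : t ≠ Sum.inl β) (h2 : t ≠ Sum.inr β) {q r : ℕ}
    (hqr : D.rt t (D.h (Sum.inl β)) = r - q)
    (hr : (toEnd K 𝔤 𝔤 (D.e (Sum.inr β)) ^ r) (D.e t) ≠ 0) :
    q + r ≤ 3 ∧ q + r < p := by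
  obtain ⟨hle, u, hu1, -, hu⟩ := D.string_bound (s := Sum.inl β) h1 h2 hqr hr
  refine ⟨hle, ?_⟩
  have hp2 := D.prime_ne_two hp β
  have hp2' := hprime.out.two_le
  by_contra! h
  have hp3 : p = 3 := by omega
  have hL : q + r = 3 := by omega
  refine hp β u hu1 _ hu (by rw [hL]; norm_num) ?_
  rw [hL, hp3]
  norm_num

/-- A nonvanishing power of `ad e_β` is at most the string length, which is less than `p`. On
`e_{-β}` the cube already vanishes, and `p` is odd. -/
lemma not_dvd_factorial (D : ChevalleyDatum K 𝔤 𝔱 P)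
    (hp : ∀ β : P, ∀ t, t ≠ Sum.inl β → ∀ m : ℤ, D.rt t (D.h (Sum.inl β)) = m → m ≠ 0 →
      ¬ (p : ℤ) ∣ m) {β : P} {t : P ⊕ P} (h1 : t ≠ Sum.inl β) {k : ℕ}
    (hk : (toEnd K 𝔤 𝔤 (D.e (Sum.inl β)) ^ k) (D.e t) ≠ 0) : ¬ p ∣ k.factorial := by
  rw [hprime.out.dvd_factorial, not_le]
  by_cases h2 : t = Sum.inr β
  · subst h2
    have hk2 : k ≤ 2 := by
      by_contra! hk3
      refine hk (Module.End.pow_map_zero_of_le (k := 3) hk3 ?_)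
      have : ⁅D.e (Sum.inl β), D.e (Sum.inr β)⁆ = (D.h (Sum.inl β) : 𝔤) := D.lie_e_swap (Sum.inl β)
      simp only [pow_succ, pow_zero, one_mul, Module.End.mul_apply, toEnd_apply_apply, this]
      rw [← lie_skew (D.e (Sum.inl β)) (D.h (Sum.inl β) : 𝔤), D.lie_t]
      simp
    have := D.prime_ne_two hp β
    have := hprime.out.two_le
    omega
  · obtain ⟨q, r, hqr, hq, hq', hr, -, -⟩ := D.exists_nat_string h1 h2
    have := D.not_dvd_of_le hp h1 h2 hqr hr
    have hkq : k ≤ q := by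
      by_contra! h
      exact hk (Module.End.pow_map_zero_of_le h hq')
    omega

/-- Going up by `e_β` and back by `e_{-β}` multiplies `e_t` by `N N' = q (r + 1)`, and both factors
lie strictly between `0` and `p`. -/
lemma exists_structure_const (D : ChevalleyDatum K 𝔤 𝔱 P)
    (hp : ∀ β : P, ∀ t, t ≠ Sum.inl β → ∀ m : ℤ, D.rt t (D.h (Sum.inl β)) = m → m ≠ 0 →
      ¬ (p : ℤ) ∣ m) {β : P} {t u : P ⊕ P} (h1 : t ≠ Sum.inl β) (h2 : t ≠ Sum.inr β)
    (hu : D.rt u = D.rt (Sum.inl β) + D.rt t) :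
    ∃ N : ℤ, ⁅D.e (Sum.inl β), D.e t⁆ = N • D.e u ∧ ¬ (p : ℤ) ∣ N := by
  obtain ⟨N, hN⟩ := D.lie_int _ _ _ hu
  have hu' : D.rt t = D.rt (Sum.inl β).swap + D.rt u := by rw [hu, D.rt_swap]; module
  obtain ⟨N', hN'⟩ := D.lie_int _ _ _ hu'
  obtain ⟨q, r, hqr, hq, hq', hr, -, hlie⟩ := D.exists_nat_string h1 h2
  have hbound := D.not_dvd_of_le hp h1 h2 hqr hr
  -- If `q = 0`, then `e_β e_{-β}` also kills `e_u`, so the string through `u` cannot be lowered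
  -- either. Then `⟨u, β^∨⟩ = 2 + r` would equal `-r' ≤ 0`.
  have hq0 : q ≠ 0 := by
    rintro rfl
    have h0 : ⁅D.e (Sum.inl β), D.e t⁆ = 0 := by simpa using hq'
    have hu1 : u ≠ (Sum.inl β : P ⊕ P).swap := by
      rintro rfl
      refine D.add_smul_rt_ne_zero h1 h2 2 ?_
      rw [D.rt_swap] at hu
      have : D.rt t = -D.rt (Sum.inl β) - D.rt (Sum.inl β) := by rw [hu]; module
      rw [this]; module
    have hu2 : u ≠ (Sum.inl β : P ⊕ P).swap.swap := by
      rw [Sum.swap_swap]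
      rintro rfl
      refine D.rt_ne_zero t ?_
      have : D.rt t = D.rt (Sum.inl β) + D.rt t - D.rt (Sum.inl β) := by module
      rw [this, ← hu, sub_self]
    obtain ⟨q', r', hqr', -, -, -, -, hlie'⟩ := D.exists_nat_string hu1 hu2
    rw [hN', lie_zsmul, Sum.swap_swap, h0, smul_zero, eq_comm, smul_eq_zero] at hlie'
    have h3 := hlie'.resolve_right (D.e_ne_zero u)
    have hq0' : q' = 0 := by
      have : ((q' * (r' + 1) : ℕ) : K) = 0 := by push_cast; exact h3
      have := Nat.cast_eq_zero.mp this
      rcases Nat.mul_eq_zero.mp this with h | h <;> omega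
    rw [D.h_swap, map_neg, hu, LinearMap.add_apply, D.rt_h, hqr, hq0'] at hqr'
    have : ((2 + r + r' : ℕ) : K) = 0 := by
      push_cast at hqr' ⊢
      linear_combination -hqr'
    have := Nat.cast_eq_zero.mp this
    omega
  refine ⟨N, hN, fun hdvd => ?_⟩
  rw [hN, lie_zsmul, hN', smul_smul, ← Int.cast_smul_eq_zsmul K] at hlie
  have h3 := smul_left_injective K (D.e_ne_zero t) hlie
  have h4 : N * N' = ((q * (r + 1) : ℕ) : ℤ) := by exact_mod_cast h3
  have h5 : (p : ℤ) ∣ ((q * (r + 1) : ℕ) : ℤ) := h4 ▸ Dvd.dvd.mul_right hdvd N'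
  rw [Int.natCast_dvd_natCast, hprime.out.dvd_mul] at h5
  rcases h5 with h5 | h5
  · have := Nat.le_of_dvd (by omega) h5; omega
  · have := Nat.le_of_dvd (by omega) h5; omega

end Prime

end Positivity
end ChevalleyDatum
end SplitReductive

/-! ### The integral filtration by number of factors, and divided powers. -/

namespace SplitReductive
open LieModule
namespace ChevalleyDatum

section Filtration

variable {K 𝔤 : Type*} [Field K] [CharZero K] [LieRing 𝔤] [LieAlgebra K 𝔤]
  [FiniteDimensional K 𝔤]
  {𝔱 : LieSubalgebra K 𝔤} [𝔱.IsCartanSubalgebra] [LieModule.IsTriangularizable K 𝔱 𝔤]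
  {P : Type*} (D : ChevalleyDatum K 𝔤 𝔱 P)
  {M : Type*} [AddCommGroup M] [Module K M] [LieRingModule 𝔤 M] [LieModule K 𝔤 M]
  (A : Subring K) (J : Finset P)

/-- The vector `y_{β₁} ⋯ y_{βₖ} w` for a list of positive roots. -/
def prodY (l : List P) (w : M) : M := l.foldr (fun β m => ⁅D.e (Sum.inr β), m⁆) w

/-- The sum of the roots in a list. -/
def wt (l : List P) : Module.Dual K 𝔱 := (l.map fun β => D.rt (Sum.inl β)).sum

/-- The `A`-span of the products of at most `d` negative root vectors, with roots in `Φ_J` and of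
total weight `-μ`, applied to `w`. -/
def Fil (w : M) (d : ℕ) (μ : Module.Dual K 𝔱) : Submodule A M :=
  Submodule.span A {m | ∃ l : List P, (∀ β ∈ l, β ∈ D.PJ J) ∧ l.length ≤ d ∧ D.wt l = μ ∧
    D.prodY l w = m}

/-- `w` has weight `lam` and is killed by the positive root vectors of `Φ_J`. -/
structure IsMaxVec (lam : Module.Dual K 𝔱) (w : M) : Prop where
  mem_wsp : w ∈ wsp 𝔱 M lam
  lie_x : ∀ β ∈ D.PJ J, ⁅D.e (Sum.inl β), w⁆ = 0

lemma rt_inr (β : P) : D.rt (Sum.inr β) = -D.rt (Sum.inl β) := D.rt_swap (Sum.inl β)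

lemma mem_PJ_iff {β : P} :
    β ∈ D.PJ J ↔ ∀ α ∈ D.S, α ∉ J → D.rt (Sum.inl β) (D.coweight α) = 0 := by
  refine forall₃_congr fun α hα hJ => ?_
  rw [D.rt_coweight β hα, Nat.cast_eq_zero]

lemma prodY_cons (β : P) (l : List P) (w : M) :
    D.prodY (β :: l) w = ⁅D.e (Sum.inr β), D.prodY l w⁆ := rfl

lemma wt_cons (β : P) (l : List P) : D.wt (β :: l) = D.rt (Sum.inl β) + D.wt l := by simp [wt]

lemma prodY_append (l l' : List P) (w : M) : D.prodY (l ++ l') w = D.prodY l (D.prodY l' w) :=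
  List.foldr_append

lemma prodY_mem_wsp {lam : Module.Dual K 𝔱} {w : M} (hw : w ∈ wsp 𝔱 M lam) (l : List P) :
    D.prodY l w ∈ wsp 𝔱 M (lam - D.wt l) := by
  induction l with
  | nil => simpa [prodY, wt] using hw
  | cons β l ih =>
    have := lie_mem_wsp (D.e_mem_wsp (Sum.inr β)) ih
    rw [D.rt_inr] at this
    rw [prodY_cons, wt_cons]
    convert this using 2
    module

variable {A J}

lemma prodY_mem_Fil {w : M} {l : List P} (hl : ∀ β ∈ l, β ∈ D.PJ J) {d : ℕ} (hd : l.length ≤ d) :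
    D.prodY l w ∈ D.Fil A J w d (D.wt l) :=
  Submodule.subset_span ⟨l, hl, hd, rfl, rfl⟩

lemma Fil_mono {w : M} {d d' : ℕ} (h : d ≤ d') (μ : Module.Dual K 𝔱) :
    D.Fil A J w d μ ≤ D.Fil A J w d' μ :=
  Submodule.span_mono fun _ ⟨l, hl, hd, hμ, hm⟩ => ⟨l, hl, hd.trans h, hμ, hm⟩

lemma Fil_induction {w : M} {d : ℕ} {μ : Module.Dual K 𝔱} {N : Submodule A M} (T : M →ₗ[K] M)
    (h : ∀ l : List P, (∀ β ∈ l, β ∈ D.PJ J) → l.length ≤ d → D.wt l = μ → T (D.prodY l w) ∈ N)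
    {m : M} (hm : m ∈ D.Fil A J w d μ) : T m ∈ N := by
  have : D.Fil A J w d μ ≤ N.comap (T.restrictScalars A) := by
    refine Submodule.span_le.mpr ?_
    rintro _ ⟨l, hl, hd, hμ, rfl⟩
    exact h l hl hd hμ
  exact this hm

lemma lie_y_mem_Fil {w : M} {β : P} (hβ : β ∈ D.PJ J) {d : ℕ} {μ : Module.Dual K 𝔱} {m : M}
    (hm : m ∈ D.Fil A J w d μ) :
    ⁅D.e (Sum.inr β), m⁆ ∈ D.Fil A J w (d + 1) (D.rt (Sum.inl β) + μ) := by
  refine D.Fil_induction (toEnd K 𝔤 M (D.e (Sum.inr β))) (fun l hl hd hμ => ?_) hm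
  rw [← hμ, ← D.wt_cons, toEnd_apply_apply, ← D.prodY_cons]
  refine D.prodY_mem_Fil (fun δ hδ => ?_) (by simpa using hd)
  rcases List.mem_cons.mp hδ with rfl | h
  exacts [hβ, hl δ h]

lemma smul_mem_Fil {w : M} {d : ℕ} {μ : Module.Dual K 𝔱} {a : K} (ha : a ∈ A) {m : M}
    (hm : m ∈ D.Fil A J w d μ) : a • m ∈ D.Fil A J w d μ :=
  (D.Fil A J w d μ).smul_mem (⟨a, ha⟩ : A) hm

lemma rt_h_wt_mem (A : Subring K) (s : P ⊕ P) (l : List P) : D.wt l (D.h s) ∈ A := by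
  induction l with
  | nil => simp [wt]
  | cons β l ih =>
    rw [wt_cons, LinearMap.add_apply]
    obtain ⟨m, hm⟩ := D.exists_int s (Sum.inl β)
    rw [hm]
    exact A.add_mem (intCast_mem A m) ih

lemma lie_h_mem_Fil {lam : Module.Dual K 𝔱} {w : M} (hw : D.IsMaxVec J lam w) {β : P}
    (hA : lam (D.h (Sum.inl β)) ∈ A) {d : ℕ} {μ : Module.Dual K 𝔱} {m : M}
    (hm : m ∈ D.Fil A J w d μ) : ⁅(D.h (Sum.inl β) : 𝔤), m⁆ ∈ D.Fil A J w d μ := by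
  refine D.Fil_induction (toEnd K 𝔤 M (D.h (Sum.inl β) : 𝔤)) (fun l hl hd hμ => ?_) hm
  rw [toEnd_apply_apply, D.prodY_mem_wsp hw.mem_wsp l (D.h (Sum.inl β)), ← hμ]
  exact D.smul_mem_Fil (A.sub_mem hA (D.rt_h_wt_mem A _ l)) (D.prodY_mem_Fil hl hd)

/-- Moving `x_β` to the right replaces a factor `y_δ` by `[x_β, y_δ]`, which is a coroot, an integer
multiple of a single `y_ε`, or one of an `x_ε` acting on a shorter product. So the number of factors
never grows, and integral structure constants and integral weights keep the coefficients in `A`. -/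
lemma lie_x_mem_Fil_aux {lam : Module.Dual K 𝔱} {w : M} (hw : D.IsMaxVec J lam w)
    (hA : ∀ β ∈ D.PJ J, lam (D.h (Sum.inl β)) ∈ A) (l : List P) (hl : ∀ β ∈ l, β ∈ D.PJ J) :
    ∀ β ∈ D.PJ J, ⁅D.e (Sum.inl β), D.prodY l w⁆ ∈
      D.Fil A J w l.length (D.wt l - D.rt (Sum.inl β)) := by
  induction l with
  | nil =>
    intro β hβ
    have : ⁅D.e (Sum.inl β), D.prodY [] w⁆ = 0 := hw.lie_x β hβ
    rw [this]
    exact Submodule.zero_mem _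
  | cons δ l ih =>
    intro β hβ
    have hl' : ∀ β ∈ l, β ∈ D.PJ J := fun β h => hl β (List.mem_cons_of_mem _ h)
    have hδ : δ ∈ D.PJ J := hl δ List.mem_cons_self
    have ih := ih hl'
    have hprod : D.prodY l w ∈ D.Fil A J w l.length (D.wt l) := D.prodY_mem_Fil hl' le_rfl
    rw [prodY_cons, leibniz_lie, wt_cons, List.length_cons]
    refine Submodule.add_mem _ ?_ ?_
    · by_cases hβδ : β = δ
      · subst hβδ
        have h1 : ⁅D.e (Sum.inl β), D.e (Sum.inr β)⁆ = (D.h (Sum.inl β) : 𝔤) :=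
          D.lie_e_swap (Sum.inl β)
        rw [h1, add_sub_cancel_left]
        exact D.Fil_mono (Nat.le_succ _) _ (D.lie_h_mem_Fil hw (hA β hβ) hprod)
      have h0 : D.rt (Sum.inl β) + D.rt (Sum.inr δ) ≠ 0 := by
        rw [D.rt_inr]
        intro h
        exact hβδ (Sum.inl_injective (D.rt_injective (sub_eq_zero.mp (by rw [sub_eq_add_neg, h]))))
      by_cases hu : ∃ u, D.rt u = D.rt (Sum.inl β) + D.rt (Sum.inr δ)
      · obtain ⟨u, hu⟩ := hu
        obtain ⟨N, hN⟩ := D.lie_int _ _ _ hu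
        rw [hN, zsmul_lie, ← Int.cast_smul_eq_zsmul K]
        refine D.smul_mem_Fil (intCast_mem A N) ?_
        rw [D.rt_inr] at hu
        have hcoef : ∀ α ∈ D.S, α ∉ J → D.rt u (D.coweight α) = 0 := fun α hα hJ => by
          rw [hu, LinearMap.add_apply, LinearMap.neg_apply, (D.mem_PJ_iff J).mp hβ α hα hJ,
            (D.mem_PJ_iff J).mp hδ α hα hJ, neg_zero, add_zero]
        rcases u with ε | ε
        · have hε : ε ∈ D.PJ J := (D.mem_PJ_iff J).mpr hcoef
          have := ih ε hε
          rw [hu] at this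
          refine D.Fil_mono (Nat.le_succ _) _ ?_
          convert this using 2
          module
        · have hε : ε ∈ D.PJ J := (D.mem_PJ_iff J).mpr fun α hα hJ => by
            have := hcoef α hα hJ
            rwa [D.rt_inr, LinearMap.neg_apply, neg_eq_zero] at this
          have := D.lie_y_mem_Fil hε hprod
          rw [D.rt_inr] at hu
          rw [← neg_eq_iff_eq_neg.mpr hu.symm] at this
          convert this using 2
          module
      · push Not at hu
        rw [D.lie_eq_zero h0 hu, zero_lie]
        exact Submodule.zero_mem _
    · have := D.lie_y_mem_Fil hδ (ih β hβ)
      convert this using 2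
      module

lemma lie_x_mem_Fil {lam : Module.Dual K 𝔱} {w : M} (hw : D.IsMaxVec J lam w)
    (hA : ∀ β ∈ D.PJ J, lam (D.h (Sum.inl β)) ∈ A) {β : P} (hβ : β ∈ D.PJ J) {d : ℕ}
    {μ : Module.Dual K 𝔱} {m : M} (hm : m ∈ D.Fil A J w d μ) :
    ⁅D.e (Sum.inl β), m⁆ ∈ D.Fil A J w d (μ - D.rt (Sum.inl β)) := by
  refine D.Fil_induction (toEnd K 𝔤 M (D.e (Sum.inl β))) (fun l hl hd hμ => ?_) hm
  rw [← hμ]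
  exact D.Fil_mono hd _ (D.lie_x_mem_Fil_aux hw hA l hl β hβ)

lemma lie_e_mem_Fil {lam : Module.Dual K 𝔱} {w : M} (hw : D.IsMaxVec J lam w)
    (hA : ∀ β ∈ D.PJ J, lam (D.h (Sum.inl β)) ∈ A) {u : P ⊕ P}
    (hu : ∀ α ∈ D.S, α ∉ J → D.rt u (D.coweight α) = 0) {d : ℕ}
    {μ : Module.Dual K 𝔱} {m : M} (hm : m ∈ D.Fil A J w d μ) :
    ⁅D.e u, m⁆ ∈ D.Fil A J w (d + 1) (μ - D.rt u) := by
  rcases u with β | β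
  · exact D.Fil_mono (Nat.le_succ _) _ (D.lie_x_mem_Fil hw hA ((D.mem_PJ_iff J).mpr hu) hm)
  · have hβ : β ∈ D.PJ J := (D.mem_PJ_iff J).mpr fun α hα hJ => by
      have := hu α hα hJ
      rwa [D.rt_inr, LinearMap.neg_apply, neg_eq_zero] at this
    have := D.lie_y_mem_Fil hβ hm
    rw [D.rt_inr]
    convert this using 2
    module

/-- The divided power `z^k / k!` acting on `M`. -/
noncomputable def dpow (M : Type*) [AddCommGroup M] [Module K M] [LieRingModule 𝔤 M]
    [LieModule K 𝔤 M] (z : 𝔤) (k : ℕ) : M →ₗ[K] M :=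
  ((k.factorial : K)⁻¹) • (toEnd K 𝔤 M z ^ k)

/-- Leibniz rule; dividing by factorials absorbs the binomial coefficients. -/
lemma dpow_lie (z y : 𝔤) (m : M) (k : ℕ) : dpow (K := K) M z k ⁅y, m⁆ =
    ∑ ij ∈ Finset.HasAntidiagonal.antidiagonal k,
      ⁅dpow (K := K) 𝔤 z ij.1 y, dpow (K := K) M z ij.2 m⁆ := by
  rw [dpow, LinearMap.smul_apply, toEnd_pow_lie, Finset.smul_sum]
  refine Finset.sum_congr rfl fun ij hij => ?_
  have hk : ij.1 + ij.2 = k := Finset.HasAntidiagonal.mem_antidiagonal.mp hij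
  subst hk
  rw [dpow, dpow, LinearMap.smul_apply, LinearMap.smul_apply, smul_lie, lie_smul, smul_smul,
    ← Nat.cast_smul_eq_nsmul K, smul_smul]
  congr 1
  have h1 := Nat.add_choose_mul_factorial_mul_factorial ij.1 ij.2
  rw [← Nat.choose_symm_add] at h1
  have h2 : (((ij.1 + ij.2).choose ij.1 : ℕ) : K) * (ij.1.factorial : K) * (ij.2.factorial : K) =
      ((ij.1 + ij.2).factorial : K) := by exact_mod_cast h1
  have n1 : (ij.1.factorial : K) ≠ 0 := Nat.cast_ne_zero.mpr (Nat.factorial_ne_zero _)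
  have n2 : (ij.2.factorial : K) ≠ 0 := Nat.cast_ne_zero.mpr (Nat.factorial_ne_zero _)
  have n3 : ((ij.1 + ij.2).factorial : K) ≠ 0 := Nat.cast_ne_zero.mpr (Nat.factorial_ne_zero _)
  field_simp
  linear_combination h2

lemma ad_pow_e_eq {s t : P ⊕ P} (h1 : t ≠ s) (h2 : t ≠ s.swap) (k : ℕ) :
    (toEnd K 𝔤 𝔤 (D.e s) ^ k) (D.e t) = 0 ∨ ∃ u, ∃ N : ℤ, D.rt u = D.rt t + k • D.rt s ∧
      (toEnd K 𝔤 𝔤 (D.e s) ^ k) (D.e t) = N • D.e u := by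
  induction k with
  | zero => exact Or.inr ⟨t, 1, by simp, by simp⟩
  | succ k ih =>
    rw [pow_succ', Module.End.mul_apply]
    rcases ih with h | ⟨u, N, hu, hN⟩
    · left; rw [h, map_zero]
    · rw [hN, map_zsmul, toEnd_apply_apply]
      have hsum : D.rt s + D.rt u = D.rt t + (k + 1) • D.rt s := by rw [hu]; module
      by_cases hv : ∃ v, D.rt v = D.rt s + D.rt u
      · obtain ⟨v, hv⟩ := hv
        obtain ⟨N', hN'⟩ := D.lie_int _ _ _ hv
        exact Or.inr ⟨v, N * N', hv.trans hsum, by rw [hN', smul_smul]⟩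
      · push Not at hv
        left
        rw [D.lie_eq_zero _ hv, smul_zero]
        rw [hsum, ← Nat.cast_smul_eq_nsmul K]
        exact D.add_smul_rt_ne_zero h1 h2 _

section Prime

variable {p : ℕ} [hprime : Fact p.Prime]

/-- A divided power of `ad x_β` sends `y_δ` to an `A`-multiple of a root vector or of a coroot: it
vanishes unless `k!` is prime to `p`. For `δ = β` the successive values before division are `y_β`,
`h_β`, `-2 x_β` and `0`. -/
lemma lie_dpow_e_mem_Fil
    (hp : ∀ β : P, ∀ t, t ≠ Sum.inl β → ∀ m : ℤ, D.rt t (D.h (Sum.inl β)) = m → m ≠ 0 →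
      ¬ (p : ℤ) ∣ m) (hpA : ∀ n : ℕ, ¬ p ∣ n → (n : K)⁻¹ ∈ A)
    {lam : Module.Dual K 𝔱} {w : M} (hw : D.IsMaxVec J lam w)
    (hA : ∀ β ∈ D.PJ J, lam (D.h (Sum.inl β)) ∈ A) {β δ : P} (hβ : β ∈ D.PJ J) (hδ : δ ∈ D.PJ J)
    (k : ℕ) {d : ℕ} {μ : Module.Dual K 𝔱} {m : M} (hm : m ∈ D.Fil A J w d μ) :
    ⁅dpow (K := K) 𝔤 (D.e (Sum.inl β)) k (D.e (Sum.inr δ)), m⁆ ∈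
      D.Fil A J w (d + 1) (D.rt (Sum.inl δ) + μ - k • D.rt (Sum.inl β)) := by
  by_cases h0 : (toEnd K 𝔤 𝔤 (D.e (Sum.inl β)) ^ k) (D.e (Sum.inr δ)) = 0
  · rw [dpow, LinearMap.smul_apply, h0, smul_zero, zero_lie]
    exact Submodule.zero_mem _
  have hk := D.not_dvd_factorial hp (by simp) h0
  rw [dpow, LinearMap.smul_apply, smul_lie]
  refine D.smul_mem_Fil (hpA _ hk) ?_
  by_cases hβδ : δ = β
  · subst hβδ
    have e1 : ⁅D.e (Sum.inl δ), D.e (Sum.inr δ)⁆ = (D.h (Sum.inl δ) : 𝔤) := D.lie_e_swap (Sum.inl δ)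
    have e2 : ⁅D.e (Sum.inl δ), (D.h (Sum.inl δ) : 𝔤)⁆ = (-2 : K) • D.e (Sum.inl δ) := by
      rw [← lie_skew (D.e (Sum.inl δ)) (D.h (Sum.inl δ) : 𝔤), D.lie_t, D.rt_h, neg_smul]
    match k with
    | 0 =>
      have := D.lie_y_mem_Fil hδ hm
      simpa using this
    | 1 =>
      rw [pow_one, toEnd_apply_apply, e1]
      convert D.Fil_mono (Nat.le_succ _) _ (D.lie_h_mem_Fil hw (hA δ hδ) hm) using 2
      module
    | 2 =>
      rw [pow_two, Module.End.mul_apply, toEnd_apply_apply, toEnd_apply_apply, e1, e2, smul_lie]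
      refine D.smul_mem_Fil (by exact_mod_cast intCast_mem A (-2)) ?_
      convert D.Fil_mono (Nat.le_succ _) _ (D.lie_x_mem_Fil hw hA hδ hm) using 2
      module
    | k + 3 =>
      refine absurd (Module.End.pow_map_zero_of_le (k := 3) (by omega) ?_) h0
      simp only [pow_succ, pow_zero, one_mul, Module.End.mul_apply, toEnd_apply_apply, e1, e2,
        lie_smul, lie_self, smul_zero]
  · rcases D.ad_pow_e_eq (s := Sum.inl β) (t := Sum.inr δ) (by simp) (by simpa using hβδ) k with
      h | ⟨u, N, hu, hN⟩
    · exact absurd h h0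
    rw [hN, zsmul_lie, ← Int.cast_smul_eq_zsmul K]
    refine D.smul_mem_Fil (intCast_mem A N) ?_
    rw [D.rt_inr] at hu
    convert D.lie_e_mem_Fil hw hA (u := u) (fun α hα hJ => ?_) hm using 2
    · rw [hu]; module
    · rw [hu, LinearMap.add_apply, LinearMap.neg_apply, LinearMap.smul_apply,
        (D.mem_PJ_iff J).mp hβ α hα hJ, (D.mem_PJ_iff J).mp hδ α hα hJ, neg_zero, smul_zero,
        add_zero]

/-- The denominator `k!` need not be a unit here. By the Leibniz rule, only divided powers acting on
single factors in `𝔤` are ever evaluated, and those have harmless denominators; positive divided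
powers kill `w`. -/
lemma dpow_mem_Fil
    (hp : ∀ β : P, ∀ t, t ≠ Sum.inl β → ∀ m : ℤ, D.rt t (D.h (Sum.inl β)) = m → m ≠ 0 →
      ¬ (p : ℤ) ∣ m) (hpA : ∀ n : ℕ, ¬ p ∣ n → (n : K)⁻¹ ∈ A)
    {lam : Module.Dual K 𝔱} {w : M} (hw : D.IsMaxVec J lam w)
    (hA : ∀ β ∈ D.PJ J, lam (D.h (Sum.inl β)) ∈ A) {β : P} (hβ : β ∈ D.PJ J) (k : ℕ) {d : ℕ}
    {μ : Module.Dual K 𝔱} {m : M} (hm : m ∈ D.Fil A J w d μ) :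
    dpow (K := K) M (D.e (Sum.inl β)) k m ∈ D.Fil A J w d (μ - k • D.rt (Sum.inl β)) := by
  refine D.Fil_induction (dpow (K := K) M (D.e (Sum.inl β)) k) (fun l hl hd hμ => ?_) hm
  subst hμ
  refine D.Fil_mono hd _ ?_
  clear hd hm
  induction l generalizing k with
  | nil =>
    rcases Nat.eq_zero_or_pos k with rfl | hk
    · have h1 : dpow (K := K) M (D.e (Sum.inl β)) 0 (D.prodY [] w) = D.prodY [] w := by simp [dpow]
      rw [h1, zero_smul, sub_zero]
      exact D.prodY_mem_Fil hl le_rfl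
    · have h1 : dpow (K := K) M (D.e (Sum.inl β)) k (D.prodY [] w) = 0 := by
        rw [dpow, LinearMap.smul_apply, Module.End.pow_map_zero_of_le (k := 1) hk, smul_zero]
        rw [pow_one]
        exact hw.lie_x β hβ
      rw [h1]
      exact Submodule.zero_mem _
  | cons δ l ih =>
    have hl' : ∀ β ∈ l, β ∈ D.PJ J := fun β h => hl β (List.mem_cons_of_mem _ h)
    rw [prodY_cons, dpow_lie]
    refine Submodule.sum_mem _ fun ij hij => ?_
    have hk : ij.1 + ij.2 = k := Finset.HasAntidiagonal.mem_antidiagonal.mp hij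
    have := D.lie_dpow_e_mem_Fil hp hpA hw hA hβ (hl δ List.mem_cons_self) ij.1 (ih ij.2 hl')
    rw [wt_cons, List.length_cons]
    convert this using 2
    rw [← hk]
    module

end Prime
end Filtration
end ChevalleyDatum
end SplitReductive

/-! ### Carrying `y_γ ^ n v` to a unit multiple of `y_α ^ n v`. -/

namespace SplitReductive
open LieModule

/-- The ring of integers of an ultrametric normed field. -/
def normIntegers (K : Type*) [NormedField K] [IsUltrametricDist K] : Subring K where
  carrier := {a | ‖a‖ ≤ 1}
  mul_mem' {a b} ha hb := by
    rw [Set.mem_ofPred_eq, norm_mul]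
    exact mul_le_one₀ ha (norm_nonneg b) hb
  one_mem' := by simp
  add_mem' {a b} ha hb := (IsUltrametricDist.norm_add_le_max a b).trans (max_le ha hb)
  zero_mem' := by simp
  neg_mem' {a} ha := by simpa using ha

lemma mem_normIntegers {K : Type*} [NormedField K] [IsUltrametricDist K] {a : K} :
    a ∈ normIntegers K ↔ ‖a‖ ≤ 1 := Iff.rfl

namespace ChevalleyDatum

section Reach

variable {K 𝔤 : Type*} [Field K] [CharZero K] [LieRing 𝔤] [LieAlgebra K 𝔤]
  [FiniteDimensional K 𝔤]
  {𝔱 : LieSubalgebra K 𝔤} [𝔱.IsCartanSubalgebra] [LieModule.IsTriangularizable K 𝔱 𝔤]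
  {P : Type*} (D : ChevalleyDatum K 𝔤 𝔱 P)
  {M : Type*} [AddCommGroup M] [Module K M] [LieRingModule 𝔤 M] [LieModule K 𝔤 M]
  {A : Subring K} {J : Finset P}

lemma prodY_replicate (n : ℕ) (γ : P) (w : M) :
    D.prodY (List.replicate n γ) w = (toEnd K 𝔤 M (D.e (Sum.inr γ)) ^ n) w := by
  induction n with
  | zero => simp [prodY]
  | succ n ih => rw [List.replicate_succ, prodY_cons, ih, pow_succ']; rfl

lemma wt_replicate (n : ℕ) (γ : P) : D.wt (List.replicate n γ) = n • D.rt (Sum.inl γ) := by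
  simp [wt]

lemma wt_coweight {α : P} (hα : α ∈ D.S) (l : List P) :
    D.wt l (D.coweight α) = ((l.map fun β => D.cf β α).sum : ℕ) := by
  induction l with
  | nil => simp [wt]
  | cons β l ih => rw [wt_cons, LinearMap.add_apply, ih, D.rt_coweight β hα]; simp

lemma eq_replicate_of_wt {α : P} (hα : α ∈ D.S) {k : ℕ} {l : List P}
    (h : D.wt l = k • D.rt (Sum.inl α)) : l = List.replicate k α := by
  have hall : ∀ β ∈ l, β = α := by
    intro β hβ
    by_contra hne
    obtain ⟨α', hα', hne', hpos⟩ := D.exists_cf_pos_of_ne hα hne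
    have h1 := D.wt_coweight hα' l
    rw [h, LinearMap.smul_apply, D.rt_coweight_ne α hα α' hα' hne'.symm, smul_zero] at h1
    have h2 : (l.map fun β => D.cf β α').sum = 0 := by exact_mod_cast h1.symm
    have h3 := List.sum_eq_zero_iff.mp h2 (D.cf β α') (List.mem_map_of_mem hβ)
    omega
  obtain ⟨j, rfl⟩ : ∃ j, l = List.replicate j α := ⟨l.length, List.eq_replicate_of_mem hall⟩
  have h1 := congrArg (fun f => f (D.coweight α)) ((D.wt_replicate j α).symm.trans h)
  simp only [LinearMap.smul_apply, D.rt_coweight_self α hα, nsmul_one] at h1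
  rw [Nat.cast_injective h1]

/-- The only list of positive roots with sum `kα` is `k` copies of `α`, so no product with fewer
than `k` factors contributes. This is the source of the condition `n ≤ ∑ ν i`. -/
lemma exists_smul_of_mem_Fil {α : P} (hα : α ∈ D.S) {k d : ℕ} {w m : M}
    (hm : m ∈ D.Fil A J w d (k • D.rt (Sum.inl α))) :
    ∃ a ∈ A, m = a • (toEnd K 𝔤 M (D.e (Sum.inr α)) ^ k) w ∧ (d < k → a = 0) := by
  induction hm using Submodule.span_induction with
  | mem m hm =>
    obtain ⟨l, -, hd, hμ, rfl⟩ := hm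
    rw [D.eq_replicate_of_wt hα hμ, D.prodY_replicate]
    have hlen : l.length = k := by rw [D.eq_replicate_of_wt hα hμ, List.length_replicate]
    exact ⟨1, A.one_mem, by rw [one_smul], fun h => by omega⟩
  | zero => exact ⟨0, A.zero_mem, by simp, fun _ => rfl⟩
  | add m m' _ _ h h' =>
    obtain ⟨a, ha, rfl, h1⟩ := h
    obtain ⟨b, hb, rfl, h2⟩ := h'
    exact ⟨a + b, A.add_mem ha hb, by rw [add_smul], fun h => by rw [h1 h, h2 h, add_zero]⟩
  | smul c m _ h =>
    obtain ⟨a, ha, rfl, h1⟩ := h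
    exact ⟨c * a, A.mul_mem c.2 ha, by rw [mul_smul]; rfl, fun h => by rw [h1 h, mul_zero]⟩

lemma eq_zero_of_mem_Fil {α : P} (hα : α ∈ D.S) {k d : ℕ} (hdk : d < k) {w m : M}
    (hm : m ∈ D.Fil A J w d (k • D.rt (Sum.inl α))) : m = 0 := by
  obtain ⟨a, -, rfl, ha⟩ := D.exists_smul_of_mem_Fil hα hm
  rw [ha hdk, zero_smul]

lemma eq_zero_of_mem_Fil_of_neg {α : P} (hα : α ∈ D.S) {n d : ℕ} (hn : 0 < n)
    {μ : Module.Dual K 𝔱} (hμ : μ (D.coweight α) = -(n : K)) {w m : M}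
    (hm : m ∈ D.Fil A J w d μ) : m = 0 := by
  induction hm using Submodule.span_induction with
  | mem m hm =>
    obtain ⟨l, -, hd, hl, rfl⟩ := hm
    have h1 := D.wt_coweight hα l
    rw [hl, hμ] at h1
    have h2 : (((l.map fun β => D.cf β α).sum + n : ℕ) : K) = 0 := by
      push_cast
      rw [← Nat.cast_list_sum] at *
      linear_combination -h1
    have := Nat.cast_eq_zero.mp h2
    omega
  | zero => rfl
  | add m m' _ _ h h' => rw [h, h', add_zero]
  | smul c m _ h => rw [h, smul_zero]

/-- Divided powers of an operator killing `w` on a power, when the iterated commutators stop after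
`q` steps. -/
lemma dpow_pow_apply {z y : 𝔤} {w : M} (hz : ⁅z, w⁆ = 0) {q : ℕ}
    (hq : (toEnd K 𝔤 𝔤 z ^ (q + 1)) y = 0) (n : ℕ) :
    (∀ m, q * n < m → dpow (K := K) M z m ((toEnd K 𝔤 M y ^ n) w) = 0) ∧
      dpow (K := K) M z (q * n) ((toEnd K 𝔤 M y ^ n) w) =
        (toEnd K 𝔤 M (dpow (K := K) 𝔤 z q y) ^ n) w := by
  have hzero : ∀ i, q < i → dpow (K := K) 𝔤 z i y = 0 := fun i hi => by
    rw [dpow, LinearMap.smul_apply, Module.End.pow_map_zero_of_le hi hq, smul_zero]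
  induction n with
  | zero =>
    refine ⟨fun m hm => ?_, by simp [dpow]⟩
    rw [pow_zero, dpow, LinearMap.smul_apply, Module.End.one_apply,
      Module.End.pow_map_zero_of_le (k := 1) (by omega) (by simpa using hz), smul_zero]
  | succ n ih =>
    simp only [pow_succ', Module.End.mul_apply, toEnd_apply_apply, dpow_lie]
    constructor
    · intro m hm
      refine Finset.sum_eq_zero fun ij hij => ?_
      have hk : ij.1 + ij.2 = m := Finset.HasAntidiagonal.mem_antidiagonal.mp hij
      rw [Nat.mul_succ] at hm
      rcases lt_or_ge q ij.1 with h | h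
      · rw [hzero _ h, zero_lie]
      · rw [ih.1 _ (by omega), lie_zero]
    -- At most `q` derivatives can fall on one factor and at most `q * n` on the other `n`, so a
    -- total of `q * (n + 1)` leaves a single term.
    · rw [Finset.sum_eq_single (q, q * n), ih.2]
      · intro ij hij hne
        have hk : ij.1 + ij.2 = q * (n + 1) := Finset.HasAntidiagonal.mem_antidiagonal.mp hij
        rw [Nat.mul_succ] at hk
        rcases lt_trichotomy q ij.1 with h | h | h
        · rw [hzero _ h, zero_lie]
        · exact absurd (Prod.ext h.symm (by simp only; omega)) hne
        · rw [ih.1 _ (by omega), lie_zero]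
      · intro h
        exact absurd (Finset.HasAntidiagonal.mem_antidiagonal.mpr (by simp only; ring)) h

lemma toEnd_smul_pow (c : K) (y : 𝔤) (n : ℕ) (w : M) :
    (toEnd K 𝔤 M (c • y) ^ n) w = c ^ n • (toEnd K 𝔤 M y ^ n) w := by
  rw [map_smul, smul_pow, LinearMap.smul_apply]

section Prime

variable {p : ℕ} [hprime : Fact p.Prime]

/-- The coefficient is a product of structure constants along the `β`-string; the string avoids
`±β`, so each of them is prime to `p`. -/
lemma ad_pow_e_eq_unit (D : ChevalleyDatum K 𝔤 𝔱 P)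
    (hp : ∀ β : P, ∀ t, t ≠ Sum.inl β → ∀ m : ℤ, D.rt t (D.h (Sum.inl β)) = m → m ≠ 0 →
      ¬ (p : ℤ) ∣ m) {β : P} {t : P ⊕ P} (h1 : t ≠ Sum.inl β) (h2 : t ≠ Sum.inr β) (k : ℕ) :
    (toEnd K 𝔤 𝔤 (D.e (Sum.inl β)) ^ k) (D.e t) = 0 ∨ ∃ u, ∃ N : ℤ,
      D.rt u = D.rt t + k • D.rt (Sum.inl β) ∧ ¬ (p : ℤ) ∣ N ∧
      (toEnd K 𝔤 𝔤 (D.e (Sum.inl β)) ^ k) (D.e t) = N • D.e u := by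
  induction k with
  | zero =>
    exact Or.inr ⟨t, 1, by simp, (Nat.prime_iff_prime_int.mp hprime.out).not_dvd_one, by simp⟩
  | succ k ih =>
    rw [pow_succ', Module.End.mul_apply]
    rcases ih with h | ⟨u, N, hu, hN0, hN⟩
    · left; rw [h, map_zero]
    · rw [hN, map_zsmul, toEnd_apply_apply]
      have hsum : D.rt (Sum.inl β) + D.rt u = D.rt t + (k + 1) • D.rt (Sum.inl β) := by
        rw [hu]; module
      have hadd : ∀ c : K, D.rt u + c • D.rt (Sum.inl β) ≠ 0 := fun c => by
        have := D.add_smul_rt_ne_zero h1 h2 (k + c)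
        rwa [hu, add_assoc, ← Nat.cast_smul_eq_nsmul K, ← add_smul]
      by_cases hv : ∃ v, D.rt v = D.rt (Sum.inl β) + D.rt u
      · obtain ⟨v, hv⟩ := hv
        have hu1 : u ≠ Sum.inl β := by
          rintro rfl
          exact hadd (-1) (by module)
        have hu2 : u ≠ Sum.inr β := by
          rintro rfl
          exact hadd 1 (by rw [D.rt_inr]; module)
        obtain ⟨N', hN', hN'0⟩ := D.exists_structure_const hp hu1 hu2 hv
        refine Or.inr ⟨v, N * N', hv.trans hsum, ?_, by rw [hN', smul_smul]⟩
        rw [(Nat.prime_iff_prime_int.mp hprime.out).dvd_mul]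
        tauto
      · push Not at hv
        left
        rw [D.lie_eq_zero _ hv, smul_zero]
        have := hadd 1
        rwa [one_smul, add_comm] at this

/-- Some integral operator carries `y_γ^n v` to a unit multiple of `y_α^n v`, with `α` a simple root
outside `I`. -/
lemma exists_operator (D : ChevalleyDatum K 𝔤 𝔱 P)
    (hp : ∀ β : P, ∀ t, t ≠ Sum.inl β → ∀ m : ℤ, D.rt t (D.h (Sum.inl β)) = m → m ≠ 0 →
      ¬ (p : ℤ) ∣ m) (hpA : ∀ n : ℤ, ¬ (p : ℤ) ∣ n → (n : K)⁻¹ ∈ A)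
    {lam : Module.Dual K 𝔱} {v : M} (hv : D.IsMaxVec D.S lam v)
    (hA : ∀ β : P, lam (D.h (Sum.inl β)) ∈ A) (I : Finset P) (n : ℕ) (γ : P) (hγ : γ ∉ D.PJ I) :
    ∃ α ∈ D.S, α ∉ I ∧ ∃ (E : M →ₗ[K] M) (u : K), u ≠ 0 ∧ u⁻¹ ∈ A ∧
      E ((toEnd K 𝔤 M (D.e (Sum.inr γ)) ^ n) v) = u • (toEnd K 𝔤 M (D.e (Sum.inr α)) ^ n) v ∧
      ∀ d μ m, m ∈ D.Fil A D.S v d μ →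
        E m ∈ D.Fil A D.S v d (μ + n • D.rt (Sum.inl α) - n • D.rt (Sum.inl γ)) := by
  have hall : ∀ β : P, β ∈ D.PJ D.S := fun β α hα h => absurd hα h
  have hpA' : ∀ n : ℕ, ¬ p ∣ n → (n : K)⁻¹ ∈ A := fun n hn => by
    have := hpA n (by rwa [Int.natCast_dvd_natCast])
    exact_mod_cast this
  have hunit : ∀ N : ℤ, ¬ (p : ℤ) ∣ N → (N : K) ≠ 0 := fun N hN h => hN (by
    rw [Int.cast_eq_zero.mp h]; exact dvd_zero _)
  induction hh : D.ht γ using Nat.strong_induction_on generalizing γ with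
  | _ k IH =>
  subst hh
  -- `α₀` witnesses that `γ` lies outside `Φ_I`; removing simple roots of `I` from `γ` does not
  -- change this coefficient.
  obtain ⟨α₀, hα₀, hα₀I, hcf⟩ : ∃ α ∈ D.S, α ∉ I ∧ D.cf γ α ≠ 0 := by
    by_contra! h
    exact hγ fun α hα hI => h α hα hI
  by_cases hγS : γ ∈ D.S
  · have hγα : α₀ = γ := by
      by_contra hne
      exact hcf (D.cf_ne hγS hα₀ fun h => hne h.symm)
    subst hγα
    refine ⟨α₀, hα₀, hα₀I, LinearMap.id, 1, one_ne_zero, by rw [inv_one]; exact A.one_mem,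
      by rw [one_smul]; rfl, fun d μ m hm => ?_⟩
    rwa [add_sub_cancel_right]
  obtain ⟨α, hα, -, m, hm, hpair⟩ := D.exists_simple_pos_pairing γ
  have hγα : γ ≠ α := fun h => hγS (h ▸ hα)
  have hγα' : (Sum.inl γ : P ⊕ P) ≠ Sum.inl α := fun h => hγα (Sum.inl_injective h)
  obtain ⟨s, hs⟩ := D.exists_rt_sub (s := Sum.inl α) (t := Sum.inl γ) hγα' (by simp) hm hpair
  obtain ⟨β, rfl⟩ := D.exists_inl_of_sub_smul (β := γ) (m := 1) hα hγα (by rw [hs, one_smul])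
  -- For `α ∈ I`, raise every factor `y_γ` to the end of its `α`-string. The root becomes `γ' = γ -
  -- qα`, with `q > 0` because `β = γ - α` is a root, and the induction on height continues from
  -- `γ'`.
  by_cases hαI : α ∈ I
  · have hne : (Sum.inr γ : P ⊕ P) ≠ Sum.inr α := fun h => hγα (Sum.inr_injective h)
    obtain ⟨q, r, -, hq, hq', -⟩ := D.exists_nat_string (s := Sum.inl α) (t := Sum.inr γ)
      (by simp) hne
    have hqk := D.not_dvd_factorial hp (by simp) hq
    obtain ⟨u, N, hu, hN0, hN⟩ := (D.ad_pow_e_eq_unit hp (β := α) (by simp) hne q).resolve_left hq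
    have hq0 : q ≠ 0 := by
      rintro rfl
      obtain ⟨N, hN, hN0⟩ := D.exists_structure_const hp (β := α) (t := Sum.inr γ)
        (u := Sum.inr β) (by simp) hne (by rw [D.rt_inr, D.rt_inr, hs]; module)
      rw [zero_add, pow_one, toEnd_apply_apply, hN, ← Int.cast_smul_eq_zsmul K] at hq'
      exact (smul_ne_zero (hunit N hN0) (D.e_ne_zero _)) hq'
    have hαα₀ : α ≠ α₀ := fun h => hα₀I (h ▸ hαI)
    have hcoef : D.rt u (D.coweight α₀) = -(D.cf γ α₀ : K) := by
      rw [hu, LinearMap.add_apply, LinearMap.smul_apply, D.rt_coweight_ne α hα α₀ hα₀ hαα₀,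
        D.rt_inr, LinearMap.neg_apply, D.rt_coweight γ hα₀, smul_zero, add_zero]
    obtain ⟨γ', rfl⟩ : ∃ γ', u = Sum.inr γ' := by
      rcases u with γ' | γ'
      · rw [D.rt_coweight γ' hα₀] at hcoef
        have : ((D.cf γ' α₀ + D.cf γ α₀ : ℕ) : K) = 0 := by push_cast; rw [hcoef]; ring
        have := Nat.cast_eq_zero.mp this
        omega
      · exact ⟨γ', rfl⟩
    have hγ'rt : D.rt (Sum.inl γ') = D.rt (Sum.inl γ) - q • D.rt (Sum.inl α) := by
      rw [D.rt_inr, D.rt_inr] at hu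
      rw [← neg_inj, hu]
      module
    have hγ' : γ' ∉ D.PJ I := fun h => by
      have := h α₀ hα₀ hα₀I
      rw [D.rt_inr, LinearMap.neg_apply, D.rt_coweight γ' hα₀, this] at hcoef
      have : (D.cf γ α₀ : K) = 0 := by rw [← neg_inj, ← hcoef]; simp
      exact hcf (by exact_mod_cast this)
    have hht : D.ht γ' < D.ht γ := by
      have h1 := congrArg (fun f => f D.rho) hγ'rt
      simp only [LinearMap.sub_apply, LinearMap.smul_apply, D.rt_rho] at h1
      have h2 : D.ht γ' + q * D.ht α = D.ht γ := by
        have : ((D.ht γ' + q * D.ht α : ℕ) : K) = D.ht γ := by push_cast; rw [h1]; simp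
        exact_mod_cast this
      have := Nat.mul_pos (Nat.pos_of_ne_zero hq0) (D.ht_pos α)
      omega
    obtain ⟨α₁, hα₁, hα₁I, E, c, hc0, hcA, hE, hEF⟩ := IH _ hht γ' hγ' rfl
    have hz := (dpow_pow_apply (K := K) (hv.lie_x α (hall α)) hq' n).2
    have hdq : dpow (K := K) 𝔤 (D.e (Sum.inl α)) q (D.e (Sum.inr γ)) =
        ((q.factorial : K)⁻¹ * N) • D.e (Sum.inr γ') := by
      rw [dpow, LinearMap.smul_apply, hN, ← Int.cast_smul_eq_zsmul K, smul_smul]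
    rw [hdq, toEnd_smul_pow] at hz
    refine ⟨α₁, hα₁, hα₁I, E ∘ₗ dpow (K := K) M (D.e (Sum.inl α)) (q * n),
      ((q.factorial : K)⁻¹ * N) ^ n * c, ?_, ?_, ?_, fun d μ m hm => ?_⟩
    · exact mul_ne_zero (pow_ne_zero _ (mul_ne_zero
        (inv_ne_zero (Nat.cast_ne_zero.mpr (Nat.factorial_ne_zero _))) (hunit N hN0))) hc0
    · rw [mul_inv, ← inv_pow, mul_inv, inv_inv]
      exact A.mul_mem (A.pow_mem (A.mul_mem (natCast_mem A _) (hpA N hN0)) _) hcA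
    · rw [LinearMap.comp_apply, hz, map_smul, hE, smul_smul]
    · have := hEF _ _ _ (D.dpow_mem_Fil hp hpA' hv (fun β _ => hA β) (hall α) (q * n) hm)
      rw [LinearMap.comp_apply]
      convert this using 2
      rw [hγ'rt]
      module
  -- For `α ∉ I`, use the `n`-th divided power of `x_β` with `β = γ - α`. The string through `-γ`
  -- may continue beyond `-α`, so the unwanted Leibniz terms are eliminated by weight and degree.
  · have hβα : β ≠ α := by
      rintro rfl
      refine D.rt_ne_two_smul (Sum.inl β) (Sum.inl γ) ?_
      have : D.rt (Sum.inl γ) = D.rt (Sum.inl β) + D.rt (Sum.inl β) := by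
        conv_lhs => rw [← sub_add_cancel (D.rt (Sum.inl γ)) (D.rt (Sum.inl β)), ← hs]
      rw [this]; module
    have hγβ : (Sum.inr γ : P ⊕ P) ≠ Sum.inr β := by
      intro h
      obtain rfl := Sum.inr_injective h
      rw [eq_comm, sub_eq_self] at hs
      exact D.rt_ne_zero _ hs
    obtain ⟨N, hN, hN0⟩ := D.exists_structure_const hp (β := β) (t := Sum.inr γ)
      (u := Sum.inr α) (by simp) hγβ (by rw [D.rt_inr, D.rt_inr, hs]; module)
    obtain ⟨α', hα', hne', hpos'⟩ := D.exists_cf_pos_of_ne hα hβα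
    have hcβ : D.rt (Sum.inl γ) (D.coweight α') = D.cf β α' := by
      rw [← D.rt_coweight β hα', hs, LinearMap.sub_apply, D.rt_coweight_ne α hα α' hα' hne'.symm,
        sub_zero]
    have hFil : ∀ n, (toEnd K 𝔤 M (D.e (Sum.inr γ)) ^ n) v ∈
        D.Fil A D.S v n (n • D.rt (Sum.inl γ)) := fun n => by
      rw [← D.prodY_replicate, ← D.wt_replicate]
      exact D.prodY_mem_Fil (fun β _ => hall β) (by simp)
    have key : ∀ n, dpow (K := K) M (D.e (Sum.inl β)) n ((toEnd K 𝔤 M (D.e (Sum.inr γ)) ^ n) v) =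
        (N : K) ^ n • (toEnd K 𝔤 M (D.e (Sum.inr α)) ^ n) v := by
      intro n
      induction n with
      | zero => simp [dpow]
      | succ n ih =>
        simp only [pow_succ' (toEnd K 𝔤 M _), Module.End.mul_apply, toEnd_apply_apply, dpow_lie]
        have hd : ∀ k, dpow (K := K) M (D.e (Sum.inl β)) k
            ((toEnd K 𝔤 M (D.e (Sum.inr γ)) ^ n) v) ∈
            D.Fil A D.S v n (n • D.rt (Sum.inl γ) - k • D.rt (Sum.inl β)) :=
          fun k => D.dpow_mem_Fil hp hpA' hv (fun β _ => hA β) (hall β) k (hFil n)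
        rw [Finset.sum_eq_single (1, n), ih]
        · have : dpow (K := K) 𝔤 (D.e (Sum.inl β)) 1 (D.e (Sum.inr γ)) =
              (N : K) • D.e (Sum.inr α) := by
            simp only [dpow, Nat.factorial_one, Nat.cast_one, inv_one, one_smul, pow_one,
              toEnd_apply_apply, hN, Int.cast_smul_eq_zsmul]
          simp only [this, smul_lie, lie_smul, smul_smul, pow_succ']
          rw [mul_comm]
        · intro ij hij hne
          have hk : ij.1 + ij.2 = n + 1 := Finset.HasAntidiagonal.mem_antidiagonal.mp hij
          -- For `ij.1 = 0`, the inner vector would have a negative `α'`-coefficient in its weight.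
          -- For `ij.1 ≥ 2`, the outer factor is a positive root vector or zero, so the term has
          -- weight `(n + 1)α` but at most `n` factors. Both vanish; only `(1, n)` remains.
          rcases Nat.lt_trichotomy ij.1 1 with h | h | h
          · have hz : dpow (K := K) M (D.e (Sum.inl β)) ij.2
                ((toEnd K 𝔤 M (D.e (Sum.inr γ)) ^ n) v) = 0 := by
              refine D.eq_zero_of_mem_Fil_of_neg hα' hpos' ?_ (hd ij.2)
              rw [show ij.2 = n + 1 by omega, LinearMap.sub_apply, LinearMap.smul_apply,
                LinearMap.smul_apply, hcβ, D.rt_coweight β hα', nsmul_eq_mul, nsmul_eq_mul]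
              push_cast
              ring
            rw [hz, lie_zero]
          · exact absurd (Prod.ext h (by simp only; omega)) hne
          · rcases D.ad_pow_e_eq (s := Sum.inl β) (t := Sum.inr γ) (by simp) hγβ ij.1 with
              h0 | ⟨u, N', hu, hN'⟩
            · rw [dpow, LinearMap.smul_apply, h0, smul_zero, zero_lie]
            · obtain ⟨ε, rfl⟩ : ∃ ε, u = Sum.inl ε := by
                obtain ⟨i, hi⟩ := Nat.exists_eq_add_of_le h
                refine D.exists_eq_inl hα' (n := ((i + 1) * D.cf β α' : ℕ))
                  (by exact_mod_cast Nat.mul_pos (by omega) hpos') ?_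
                rw [hu, LinearMap.add_apply, LinearMap.smul_apply, D.rt_inr, LinearMap.neg_apply,
                  hcβ, D.rt_coweight β hα', hi, nsmul_eq_mul]
                push_cast
                ring
              rw [dpow, LinearMap.smul_apply, hN', smul_lie, zsmul_lie]
              have hx := D.lie_x_mem_Fil hv (fun β _ => hA β) (hall ε) (hd ij.2)
              have hx0 : ⁅D.e (Sum.inl ε), dpow (K := K) M (D.e (Sum.inl β)) ij.2
                  ((toEnd K 𝔤 M (D.e (Sum.inr γ)) ^ n) v)⁆ = 0 := by
                refine D.eq_zero_of_mem_Fil (A := A) (J := D.S) (w := v) hα (k := n + 1)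
                  (Nat.lt_succ_self n) ?_
                convert hx using 2
                rw [hu, D.rt_inr]
                have hα_eq : D.rt (Sum.inl α) = D.rt (Sum.inl γ) - D.rt (Sum.inl β) := by
                  rw [hs]; module
                have hn : ij.2 • D.rt (Sum.inl β) =
                    (n + 1) • D.rt (Sum.inl β) - ij.1 • D.rt (Sum.inl β) := by
                  rw [← hk]; module
                rw [hn, hα_eq]
                module
              rw [hx0, smul_zero, smul_zero]
        · intro h
          exact absurd (Finset.HasAntidiagonal.mem_antidiagonal.mpr (by simp only; ring)) h
    refine ⟨α, hα, hαI, dpow (K := K) M (D.e (Sum.inl β)) n, (N : K) ^ n,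
      pow_ne_zero _ (hunit N hN0), ?_, key n, fun d μ m hm => ?_⟩
    · rw [← inv_pow]
      exact A.pow_mem (hpA N hN0) _
    · convert D.dpow_mem_Fil hp hpA' hv (fun β _ => hA β) (hall β) n hm using 2
      rw [hs]
      module

end Prime
end Reach

/-! ### The norm estimate. -/

section Norm

variable {p : ℕ} [hprime : Fact p.Prime]
  {K 𝔤 : Type*} [NormedField K] [IsUltrametricDist K] [CharZero K] [LieRing 𝔤] [LieAlgebra K 𝔤]
  [FiniteDimensional K 𝔤]
  {𝔱 : LieSubalgebra K 𝔤} [𝔱.IsCartanSubalgebra] [LieModule.IsTriangularizable K 𝔱 𝔤]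
  {P : Type*} (D : ChevalleyDatum K 𝔤 𝔱 P)
  {M : Type*} [AddCommGroup M] [Module K M] [LieRingModule 𝔤 M] [LieModule K 𝔤 M]

/-- Apply the operator of `exists_operator` to the relation and compare coefficients of the nonzero
vector `y_α ^ n v`: if every `c i` with a long list had norm below `1`, so would `u`, whose inverse
is integral. -/
lemma exists_one_le_norm
    (hp : ∀ β : P, ∀ t, t ≠ Sum.inl β → ∀ m : ℤ, D.rt t (D.h (Sum.inl β)) = m → m ≠ 0 →
      ¬ (p : ℤ) ∣ m) (hpn : ∀ n : ℤ, ¬ (p : ℤ) ∣ n → ‖(n : K)‖ = 1)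
    {lam : Module.Dual K 𝔱} {v : M} (hv : D.IsMaxVec D.S lam v)
    (hlam : ∀ α ∈ D.S, ‖lam (D.h (Sum.inl α))‖ ≤ 1) (I : Finset P)
    (hne : ∀ α ∈ D.S, α ∉ I → ∀ n, (toEnd K 𝔤 M (D.e (Sum.inr α)) ^ n) v ≠ 0)
    (n : ℕ) (γ : P) (hγ : γ ∉ D.PJ I) {ι : Type*} (s : Finset ι) (c : ι → K) (l : ι → List P)
    (hl : ∀ i ∈ s, D.wt (l i) = n • D.rt (Sum.inl γ))
    (hrel : (toEnd K 𝔤 M (D.e (Sum.inr γ)) ^ n) v = ∑ i ∈ s, c i • D.prodY (l i) v) :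
    ∃ i ∈ s, n ≤ (l i).length ∧ 1 ≤ ‖c i‖ := by
  have hA : ∀ β : P, lam (D.h (Sum.inl β)) ∈ normIntegers K := fun β => by
    obtain ⟨z, hz⟩ := D.h_int (Sum.inl β)
    rw [hz, map_sum]
    refine Subring.sum_mem _ fun α hα => ?_
    rw [map_zsmul]
    exact Subring.zsmul_mem _ (hlam α hα) _
  obtain ⟨α, hα, hαI, E, u, hu0, huA, hE, hEF⟩ := D.exists_operator hp
    (A := normIntegers K) (fun n hn => by rw [mem_normIntegers, norm_inv, hpn n hn, inv_one])
    hv hA I n γ hγ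
  by_contra! hsmall
  have hterm : ∀ i, ∃ a : K, i ∈ s → E (c i • D.prodY (l i) v) =
      a • (toEnd K 𝔤 M (D.e (Sum.inr α)) ^ n) v ∧ ‖a‖ < 1 := by
    intro i
    by_cases hi : i ∈ s
    · have h1 := hEF _ _ _ (D.prodY_mem_Fil (A := normIntegers K) (J := D.S) (w := v) (l := l i)
        (fun β _ α hα h => absurd hα h) le_rfl)
      rw [hl i hi, add_sub_cancel_left] at h1
      obtain ⟨a, ha, ha1, ha2⟩ := D.exists_smul_of_mem_Fil hα h1
      refine ⟨c i * a, fun _ => ⟨by rw [map_smul, ha1, smul_smul], ?_⟩⟩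
      rw [norm_mul]
      rcases lt_or_ge (l i).length n with h | h
      · rw [ha2 h]; simp
      · calc ‖c i‖ * ‖a‖ ≤ ‖c i‖ * 1 := mul_le_mul_of_nonneg_left ha (norm_nonneg _)
          _ < 1 := by rw [mul_one]; exact hsmall i hi h
    · exact ⟨0, fun h => absurd h hi⟩
  choose a ha using hterm
  have h1 := congrArg E hrel
  rw [hE, map_sum, Finset.sum_congr rfl fun i hi => (ha i hi).1, ← Finset.sum_smul] at h1
  have h2 := smul_left_injective K (hne α hα hαI n) h1
  have h3 : ‖∑ i ∈ s, a i‖ < 1 := Finset.sum_induction a (fun x => ‖x‖ < 1)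
    (fun x y hx hy => (IsUltrametricDist.norm_add_le_max x y).trans_lt (max_lt hx hy))
    (by simp) (fun i hi => (ha i hi).2)
  rw [← h2] at h3
  have h4 : ‖u⁻¹‖ ≤ 1 := huA
  rw [norm_inv] at h4
  have h5 : 0 < ‖u‖ := norm_pos_iff.mpr hu0
  have h6 := (inv_le_one₀ h5).mp h4
  linarith

end Norm
end ChevalleyDatum
end SplitReductive

/-! ### Highest weight modules: weights and local nilpotency. -/

namespace SplitReductive
open LieModule
namespace ChevalleyDatum

section HighestWeight

variable {K 𝔤 : Type*} [Field K] [CharZero K] [LieRing 𝔤] [LieAlgebra K 𝔤]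
  [FiniteDimensional K 𝔤]
  {𝔱 : LieSubalgebra K 𝔤} [𝔱.IsCartanSubalgebra] [LieModule.IsTriangularizable K 𝔱 𝔤]
  {P : Type*} (D : ChevalleyDatum K 𝔤 𝔱 P)
  {M : Type*} [AddCommGroup M] [Module K M] [LieRingModule 𝔤 M] [LieModule K 𝔤 M]
  {J : Finset P}

/-- The signed roots that are combinations of the simple roots in `J`. -/
def RJ (J : Finset P) : Set (P ⊕ P) := {s | ∀ α ∈ D.S, α ∉ J → D.rt s (D.coweight α) = 0}

lemma inl_mem_RJ {β : P} : Sum.inl β ∈ D.RJ J ↔ β ∈ D.PJ J := (D.mem_PJ_iff J).symm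

lemma inr_mem_RJ {β : P} : Sum.inr β ∈ D.RJ J ↔ β ∈ D.PJ J := by
  rw [D.mem_PJ_iff]
  refine forall₃_congr fun α hα hJ => ?_
  rw [D.rt_inr, LinearMap.neg_apply, neg_eq_zero]

lemma swap_mem_RJ {s : P ⊕ P} : s.swap ∈ D.RJ J ↔ s ∈ D.RJ J := by
  rcases s with β | β
  · rw [Sum.swap_inl, inr_mem_RJ, inl_mem_RJ]
  · rw [Sum.swap_inr, inr_mem_RJ, inl_mem_RJ]

lemma mem_RJ_S (s : P ⊕ P) : s ∈ D.RJ D.S := fun _ hα h => absurd hα h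

/-- A subspace of a representation that is stable under the Levi subalgebra attached to `J`. -/
structure IsStable (J : Finset P) (N : Submodule K M) : Prop where
  lie_t : ∀ t : 𝔱, ∀ m ∈ N, ⁅(t : 𝔤), m⁆ ∈ N
  lie_e : ∀ s ∈ D.RJ J, ∀ m ∈ N, ⁅D.e s, m⁆ ∈ N

/-- The span of the vectors `y_{β₁} ⋯ y_{βₖ} w` with roots in `Φ_J`. -/
def cyc (J : Finset P) (w : M) : Submodule K M :=
  Submodule.span K {m | ∃ l : List P, (∀ β ∈ l, β ∈ D.PJ J) ∧ D.prodY l w = m}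

lemma prodY_mem_cyc {w : M} {l : List P} (hl : ∀ β ∈ l, β ∈ D.PJ J) : D.prodY l w ∈ D.cyc J w :=
  Submodule.subset_span ⟨l, hl, rfl⟩

lemma mem_cyc_self (w : M) : w ∈ D.cyc J w := D.prodY_mem_cyc (l := []) (by simp)

lemma Fil_le_cyc {w m : M} {d : ℕ} {μ : Module.Dual K 𝔱} (hm : m ∈ D.Fil ⊤ J w d μ) :
    m ∈ D.cyc J w := by
  induction hm using Submodule.span_induction with
  | mem m hm =>
    obtain ⟨l, hl, -, -, rfl⟩ := hm
    exact D.prodY_mem_cyc hl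
  | zero => exact Submodule.zero_mem _
  | add m m' _ _ h h' => exact Submodule.add_mem _ h h'
  | smul c m _ h => exact Submodule.smul_mem _ (c : K) h

lemma span_induction_lie {X : Set M} (z : 𝔤) {N : Submodule K M} (h : ∀ m ∈ X, ⁅z, m⁆ ∈ N) :
    ∀ m ∈ Submodule.span K X, ⁅z, m⁆ ∈ N := by
  have : Submodule.span K X ≤ N.comap (toEnd K 𝔤 M z) := Submodule.span_le.mpr h
  exact this

/-- The filtration lemmas are reused with `A = ⊤`, for which the integrality condition on the weight
is void. -/
lemma isStable_cyc {μ : Module.Dual K 𝔱} {w : M} (hw : D.IsMaxVec J μ w) :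
    D.IsStable J (D.cyc J w) where
  lie_t t := by
    refine span_induction_lie _ ?_
    rintro _ ⟨l, hl, rfl⟩
    rw [D.prodY_mem_wsp hw.mem_wsp l t]
    exact Submodule.smul_mem _ _ (D.prodY_mem_cyc hl)
  lie_e s hs := by
    refine span_induction_lie _ ?_
    rintro _ ⟨l, hl, rfl⟩
    exact D.Fil_le_cyc (D.lie_e_mem_Fil hw (by simp) hs
      (D.prodY_mem_Fil (A := ⊤) (d := l.length) hl le_rfl))

/-- The elements of `𝔤` that preserve a subspace of a representation. -/
def stabilizer (N : Submodule K M) : LieSubalgebra K 𝔤 where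
  carrier := {z | ∀ m ∈ N, ⁅z, m⁆ ∈ N}
  add_mem' ha hb m hm := by rw [add_lie]; exact N.add_mem (ha m hm) (hb m hm)
  zero_mem' m _ := by rw [zero_lie]; exact N.zero_mem
  smul_mem' c _ hz m hm := by rw [smul_lie]; exact N.smul_mem c (hz m hm)
  lie_mem' ha hb m hm := by
    rw [lie_lie]
    exact N.sub_mem (ha _ (hb m hm)) (hb _ (ha m hm))

lemma IsStable.lie_mem {N : Submodule K M} (hN : D.IsStable D.S N) (z : 𝔤) :
    ∀ m ∈ N, ⁅z, m⁆ ∈ N :=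
  D.top_le (stabilizer N).toSubmodule hN.lie_t (fun s => hN.lie_e s (D.mem_RJ_S s)) z

lemma IsStable.eq_top {N : Submodule K M} (hN : D.IsStable D.S N) {v : M} (hv : v ∈ N)
    (hgen : LieSubmodule.lieSpan K 𝔤 ({v} : Set M) = ⊤) : N = ⊤ := by
  let N' : LieSubmodule K 𝔤 M := { N with lie_mem := fun {z m} hm => hN.lie_mem D z m hm }
  have : LieSubmodule.lieSpan K 𝔤 ({v} : Set M) ≤ N' :=
    LieSubmodule.lieSpan_le.mpr (Set.singleton_subset_iff.mpr hv)
  rw [hgen, top_le_iff] at this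
  exact congrArg LieSubmodule.toSubmodule this

variable {lam : Module.Dual K 𝔱} {v : M}

lemma cyc_eq_top (hv : D.IsMaxVec D.S lam v)
    (hgen : LieSubmodule.lieSpan K 𝔤 ({v} : Set M) = ⊤) : D.cyc D.S v = ⊤ :=
  (D.isStable_cyc hv).eq_top D (D.mem_cyc_self v) hgen

lemma exists_wt_eq {w : M} {μ : Module.Dual K 𝔱} (hw : w ∈ wsp 𝔱 M μ) {χ : Module.Dual K 𝔱}
    {u : M} (hu : u ∈ wsp 𝔱 M χ) (hcyc : u ∈ D.cyc J w) :
    u ∈ Submodule.span K {m | ∃ l : List P, (∀ β ∈ l, β ∈ D.PJ J) ∧ μ = χ + D.wt l ∧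
      D.prodY l w = m} := by
  have := mem_span_same_weight (ι := {l : List P // ∀ β ∈ l, β ∈ D.PJ J})
    (fun l => D.prodY l.1 w) (fun l => μ - D.wt l.1) (fun l => D.prodY_mem_wsp hw l.1) hu (by
      have e : Set.range (fun l : {l : List P // ∀ β ∈ l, β ∈ D.PJ J} => D.prodY l.1 w) =
          {m | ∃ l : List P, (∀ β ∈ l, β ∈ D.PJ J) ∧ D.prodY l w = m} := by
        ext m
        simp [Subtype.exists]
      rw [e]
      exact hcyc)
  refine Submodule.span_mono ?_ this
  rintro _ ⟨⟨l, hl⟩, h, rfl⟩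
  exact ⟨l, hl, by rw [← (show μ - D.wt l = χ from h)]; abel, rfl⟩

lemma exists_wt (hv : D.IsMaxVec D.S lam v)
    (hgen : LieSubmodule.lieSpan K 𝔤 ({v} : Set M) = ⊤) {χ : Module.Dual K 𝔱}
    {u : M} (hu : u ∈ wsp 𝔱 M χ) (hu0 : u ≠ 0) : ∃ l : List P, lam = χ + D.wt l := by
  by_contra! h
  have := D.exists_wt_eq hv.mem_wsp hu (D.cyc_eq_top hv hgen ▸ Submodule.mem_top)
  refine hu0 ?_
  rw [Submodule.span_eq_bot.mpr, Submodule.mem_bot] at this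
  · exact this
  · rintro _ ⟨l, -, hl, -⟩
    exact absurd hl (h l)

lemma exists_coweight (hv : D.IsMaxVec D.S lam v)
    (hgen : LieSubmodule.lieSpan K 𝔤 ({v} : Set M) = ⊤) {χ : Module.Dual K 𝔱}
    {u : M} (hu : u ∈ wsp 𝔱 M χ) (hu0 : u ≠ 0) {α : P} (hα : α ∈ D.S) :
    ∃ n : ℕ, χ (D.coweight α) = lam (D.coweight α) - n := by
  obtain ⟨l, rfl⟩ := D.exists_wt hv hgen hu hu0
  exact ⟨_, by rw [LinearMap.add_apply, D.wt_coweight hα, add_sub_cancel_right]⟩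

lemma wt_rho (l : List P) : D.wt l D.rho = ((l.map D.ht).sum : ℕ) := by
  induction l with
  | nil => simp [wt]
  | cons β l ih => rw [wt_cons, LinearMap.add_apply, ih, D.rt_rho]; simp

lemma exists_rho (hv : D.IsMaxVec D.S lam v)
    (hgen : LieSubmodule.lieSpan K 𝔤 ({v} : Set M) = ⊤) {χ : Module.Dual K 𝔱}
    {u : M} (hu : u ∈ wsp 𝔱 M χ) (hu0 : u ≠ 0) : ∃ n : ℕ, χ D.rho = lam D.rho - n := by
  obtain ⟨l, rfl⟩ := D.exists_wt hv hgen hu hu0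
  exact ⟨_, by rw [LinearMap.add_apply, D.wt_rho, add_sub_cancel_right]⟩

lemma locNil_iff {z : 𝔤} : LocNil K M z ↔ (toEnd K 𝔤 M z).maxGenEigenspace 0 = ⊤ := by
  rw [LocNil, eq_top_iff]
  refine ⟨fun h m _ => ?_, fun h m => ?_⟩
  · rw [Module.End.mem_maxGenEigenspace]
    simpa using h m
  · have := h (Submodule.mem_top (x := m))
    rw [Module.End.mem_maxGenEigenspace] at this
    simpa using this

lemma locNil_e_of_wsp (hv : D.IsMaxVec D.S lam v)
    (hgen : LieSubmodule.lieSpan K 𝔤 ({v} : Set M) = ⊤) {s : P ⊕ P}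
    (h : ∀ χ : Module.Dual K 𝔱, ∃ k : ℕ, wsp 𝔱 M (χ + k • D.rt s) = ⊥) :
    LocNil K M (D.e s) := by
  rw [locNil_iff, eq_top_iff, ← D.cyc_eq_top hv hgen, cyc, Submodule.span_le]
  rintro _ ⟨l, -, rfl⟩
  rw [SetLike.mem_coe, Module.End.mem_maxGenEigenspace]
  obtain ⟨k, hk⟩ := h (lam - D.wt l)
  refine ⟨k, ?_⟩
  have := pow_mem_wsp (D.e_mem_wsp s) (D.prodY_mem_wsp hv.mem_wsp l) k
  rw [hk, Submodule.mem_bot] at this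
  simpa using this

/-- If `χ` lies at depth `n` below `lam`, measured by `rho`, then `χ + (n + 1) β` would lie above
`lam`. -/
lemma locNil_x (hv : D.IsMaxVec D.S lam v)
    (hgen : LieSubmodule.lieSpan K 𝔤 ({v} : Set M) = ⊤) (β : P) :
    LocNil K M (D.e (Sum.inl β)) := by
  refine D.locNil_e_of_wsp hv hgen fun χ => ?_
  by_contra! h
  obtain ⟨u, hu, hu0⟩ := Submodule.exists_mem_ne_zero_of_ne_bot (h 0)
  obtain ⟨n, hn⟩ := D.exists_rho hv hgen hu hu0
  obtain ⟨u', hu', hu0'⟩ := Submodule.exists_mem_ne_zero_of_ne_bot (h (n + 1))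
  obtain ⟨n', hn'⟩ := D.exists_rho hv hgen hu' hu0'
  rw [LinearMap.add_apply, LinearMap.smul_apply, D.rt_rho, nsmul_eq_mul] at hn hn'
  have h1 : (((n + 1) * D.ht β + n' : ℕ) : K) = (n : ℕ) := by
    push_cast at hn hn' ⊢
    linear_combination hn' - hn
  have h2 := Nat.cast_injective h1
  nlinarith [D.ht_pos β]

/-- As `ad e_s` is nilpotent, the vectors killed by a power of `e_s` form a `𝔤`-submodule; it
contains the generator. -/
lemma locNil_of_pow_apply_eq_zero
    (hgen : LieSubmodule.lieSpan K 𝔤 ({v} : Set M) = ⊤) (s : P ⊕ P) {k : ℕ}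
    (hk : (toEnd K 𝔤 M (D.e s) ^ k) v = 0) : LocNil K M (D.e s) := by
  rw [locNil_iff]
  have had := locNil_iff.mp (D.locNil_ad_e s)
  let N : LieSubmodule K 𝔤 M :=
    { (toEnd K 𝔤 M (D.e s)).maxGenEigenspace 0 with
      lie_mem := fun {z m} hm => by
        have := lie_mem_maxGenEigenspace_toEnd (R := K) (χ₁ := 0) (χ₂ := 0) (x := D.e s) (y := z)
          (by rw [had]; exact Submodule.mem_top) hm
        rwa [add_zero] at this }
  have : LieSubmodule.lieSpan K 𝔤 ({v} : Set M) ≤ N := by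
    refine LieSubmodule.lieSpan_le.mpr (Set.singleton_subset_iff.mpr ?_)
    exact (Module.End.mem_maxGenEigenspace _ _ _).mpr ⟨k, by simpa using hk⟩
  rw [hgen, top_le_iff] at this
  exact congrArg LieSubmodule.toSubmodule this

/-- Only simple root vectors are assumed locally nilpotent. Their reflections preserve the set of
weights, and reflecting in a simple `α` with `⟨β, α^∨⟩ > 0` carries the ray `χ - kβ` to a ray along
a lower positive root of `Φ_J`, or, for `β = α`, to an upward ray, which leaves the weights below
`lam`. -/
lemma locNil_y (hv : D.IsMaxVec D.S lam v)
    (hgen : LieSubmodule.lieSpan K 𝔤 ({v} : Set M) = ⊤)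
    (hJ : ∀ α ∈ J, LocNil K M (D.e (Sum.inr α))) (β : P) (hβ : β ∈ D.PJ J) :
    LocNil K M (D.e (Sum.inr β)) := by
  suffices H : ∀ χ : Module.Dual K 𝔱, ∃ k₀ : ℕ, ∀ k ≥ k₀,
      wsp 𝔱 M (χ - k • D.rt (Sum.inl β)) = ⊥ by
    refine D.locNil_e_of_wsp hv hgen fun χ => ?_
    obtain ⟨k, hk⟩ := H χ
    refine ⟨k, ?_⟩
    rw [D.rt_inr, smul_neg, ← sub_eq_add_neg]
    exact hk k le_rfl
  induction hn : D.ht β using Nat.strong_induction_on generalizing β with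
  | _ n IH =>
  intro χ
  by_cases hall : ∀ k : ℕ, wsp 𝔱 M (χ - k • D.rt (Sum.inl β)) = ⊥
  · exact ⟨0, fun k _ => hall k⟩
  push Not at hall
  obtain ⟨k₁, hk₁⟩ := hall
  obtain ⟨u₁, hu₁, hu₁0⟩ := Submodule.exists_mem_ne_zero_of_ne_bot hk₁
  obtain ⟨α, hα, hcf, m, hm, hpair⟩ := D.exists_simple_pos_pairing β
  have hαJ : α ∈ J := by
    by_contra h
    exact hcf.ne' (hβ α hα h)
  have hrefl := fun {χ : Module.Dual K 𝔱} {u : M} =>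
    D.exists_reflect (V := M) (s := Sum.inl α) (D.locNil_x hv hgen α) (hJ α hαJ) (χ := χ) (u := u)
  obtain ⟨c, hc⟩ : ∃ c : ℤ, χ (D.h (Sum.inl α)) = c := by
    obtain ⟨m', hm', -⟩ := hrefl hu₁ hu₁0
    rw [LinearMap.sub_apply, LinearMap.smul_apply, hpair, nsmul_eq_mul] at hm'
    exact ⟨m' + k₁ * m, by push_cast; linear_combination hm'⟩
  have hrefl' : ∀ k : ℕ, wsp 𝔱 M (χ - k • D.rt (Sum.inl β)) ≠ ⊥ →
      ∃ w ∈ wsp 𝔱 M (χ - k • D.rt (Sum.inl β) - (c - k * m) • D.rt (Sum.inl α)), w ≠ 0 := by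
    intro k hk
    obtain ⟨u, hu, hu0⟩ := Submodule.exists_mem_ne_zero_of_ne_bot hk
    obtain ⟨m', hm', w, hw, hw0⟩ := hrefl hu hu0
    refine ⟨w, ?_, hw0⟩
    rw [LinearMap.sub_apply, LinearMap.smul_apply, hpair, hc, nsmul_eq_mul] at hm'
    have : c - k * m = m' := by exact_mod_cast hm'
    rwa [this]
  by_cases hβα : β = α
  · subst hβα
    have hm2 : m = 2 := by
      rw [D.rt_h] at hpair
      exact_mod_cast hpair.symm
    subst hm2
    obtain ⟨n₁, hn₁⟩ := D.exists_coweight hv hgen hu₁ hu₁0 hα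
    -- The reflected weight is `χ - cα + kα`. Its `α`-depth `n₂` below `lam` satisfies `k = c - (k₁
    -- - n₁) - n₂`, which bounds `k`.
    refine ⟨(c - (k₁ - n₁)).toNat + 1, fun k hk => ?_⟩
    by_contra hne
    obtain ⟨w, hw, hw0⟩ := hrefl' k hne
    obtain ⟨n₂, hn₂⟩ := D.exists_coweight hv hgen hw hw0 hα
    simp only [LinearMap.sub_apply, LinearMap.smul_apply, D.rt_coweight_self _ hα, nsmul_eq_mul,
      zsmul_eq_mul, mul_one] at hn₁ hn₂
    have h3 : (k : ℤ) = c - (k₁ - n₁) - n₂ := by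
      have : (k : K) = ((c - (k₁ - n₁) - n₂ : ℤ) : K) := by
        push_cast at hn₁ hn₂ ⊢
        linear_combination hn₂ - hn₁
      exact_mod_cast this
    omega
  · obtain ⟨m', hm', s, hs⟩ := D.exists_int_reflect (Sum.inl α) (Sum.inl β)
    have hmm : m' = m := by exact_mod_cast hm'.symm.trans hpair
    subst hmm
    obtain ⟨β', rfl⟩ := D.exists_inl_of_sub_smul hα hβα hs
    have hβ' : β' ∈ D.PJ J := (D.mem_PJ_iff J).mpr fun α' hα' hJ' => by
      rw [hs, LinearMap.sub_apply, LinearMap.smul_apply, (D.mem_PJ_iff J).mp hβ α' hα' hJ',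
        D.rt_coweight_ne α hα α' hα' (fun h => hJ' (h ▸ hαJ)), smul_zero, sub_zero]
    have hht : D.ht β' < D.ht β := by
      have h1 := congrArg (fun f => f D.rho) hs
      simp only [LinearMap.sub_apply, LinearMap.smul_apply, D.rt_rho, zsmul_eq_mul] at h1
      have h2 : (D.ht β' : ℤ) = D.ht β - m' * D.ht α := by exact_mod_cast h1
      nlinarith [D.ht_pos α]
    obtain ⟨k₀, hk₀⟩ := IH _ (hn ▸ hht) β' hβ' rfl (χ - c • D.rt (Sum.inl α))
    refine ⟨k₀, fun k hk => ?_⟩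
    by_contra hne
    obtain ⟨w, hw, hw0⟩ := hrefl' k hne
    have := hk₀ k hk
    refine hw0 ((Submodule.eq_bot_iff _).mp this w ?_)
    convert hw using 2
    rw [hs]
    module

end HighestWeight
end ChevalleyDatum
end SplitReductive

/-! ### Local finiteness under a Levi subalgebra. -/

namespace SplitReductive
open LieModule

section LocallyFinite

variable {K : Type*} [Field K] {M : Type*} [AddCommGroup M] [Module K M]

/-- Every vector lies in a finite-dimensional subspace stable under `f`. -/
def LocFin (f : Module.End K M) : Prop :=
  ∀ m : M, ∃ W : Submodule K M, FiniteDimensional K W ∧ m ∈ W ∧ ∀ w ∈ W, f w ∈ W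

lemma LocFin.exists_le {f : Module.End K M} (hf : LocFin f) (U : Submodule K M)
    [FiniteDimensional K U] :
    ∃ W : Submodule K M, FiniteDimensional K W ∧ U ≤ W ∧ ∀ w ∈ W, f w ∈ W := by
  obtain ⟨s, rfl⟩ := (Submodule.fg_iff_finiteDimensional U).mpr inferInstance
  choose W hfin hmem hst using hf
  refine ⟨s.sup W, Submodule.finiteDimensional_finset_sup s W, ?_, ?_⟩
  · rw [Submodule.span_le]
    exact fun m hm => Finset.le_sup (f := W) hm (hmem m)
  · have : s.sup W ≤ (s.sup W).comap f :=
      Finset.sup_le fun m hm w hw => Finset.le_sup (f := W) hm (hst m w hw)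
    exact this

lemma locFin_of_span {f : Module.End K M} {X : Set M} (hX : Submodule.span K X = ⊤)
    (h : ∀ m ∈ X, ∃ W : Submodule K M, FiniteDimensional K W ∧ m ∈ W ∧ ∀ w ∈ W, f w ∈ W) :
    LocFin f := by
  intro m
  have hm : m ∈ Submodule.span K X := hX ▸ Submodule.mem_top
  induction hm using Submodule.span_induction with
  | mem m hm => exact h m hm
  | zero => exact ⟨⊥, inferInstance, Submodule.zero_mem _, by simp⟩
  | add a b _ _ ha hb =>
    obtain ⟨W, h1, h2, h3⟩ := ha
    obtain ⟨W', h1', h2', h3'⟩ := hb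
    refine ⟨W ⊔ W', inferInstance, Submodule.add_mem_sup h2 h2', ?_⟩
    have : W ⊔ W' ≤ (W ⊔ W').comap f :=
      sup_le (fun w hw => Submodule.mem_sup_left (h3 w hw))
        (fun w hw => Submodule.mem_sup_right (h3' w hw))
    exact this
  | smul c a _ ha =>
    obtain ⟨W, h1, h2, h3⟩ := ha
    exact ⟨W, h1, W.smul_mem c h2, h3⟩

lemma locFin_of_pow {f : Module.End K M} (h : ∀ m, ∃ k : ℕ, (f ^ k) m = 0) : LocFin f := by
  intro m
  obtain ⟨k, hk⟩ := h m
  refine ⟨Submodule.span K ((fun i => (f ^ i) m) '' (Finset.range (k + 1) : Set ℕ)),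
    FiniteDimensional.span_of_finite K ((Finset.finite_toSet _).image _),
    Submodule.subset_span ⟨0, by simp, by simp⟩, ?_⟩
  set W := Submodule.span K ((fun i => (f ^ i) m) '' (Finset.range (k + 1) : Set ℕ))
  have : W ≤ W.comap f := by
    refine Submodule.span_le.mpr ?_
    rintro _ ⟨i, hi, rfl⟩
    rw [SetLike.mem_coe, Submodule.mem_comap, ← Module.End.mul_apply, ← pow_succ']
    by_cases hik : i < k
    · exact Submodule.subset_span ⟨i + 1, by simpa using hik, rfl⟩
    · rw [Module.End.pow_map_zero_of_le (by omega) hk]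
      exact Submodule.zero_mem _
  exact this

/-- If finitely many locally finite operators span a space closed under commutators, every vector
lies in a finite-dimensional subspace stable under all of them. -/
lemma exists_finite_stable {n : ℕ} (z : Fin n → Module.End K M) (hz : ∀ i, LocFin (z i))
    (hbr : ∀ i j, z i * z j - z j * z i ∈ Submodule.span K (Set.range z)) (m : M) :
    ∃ W : Submodule K M, FiniteDimensional K W ∧ m ∈ W ∧ ∀ i, ∀ w ∈ W, z i w ∈ W := by
  choose ext hfin hle hst using fun (i : Fin n) (U : {U : Submodule K M // FiniteDimensional K U}) =>
    have := U.2
    (hz i).exists_le U.1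
  -- Stage `k` enlarges the previous space to one stable under `z k` only; from `n` on the sequence
  -- is constant.
  let U : ℕ → {U : Submodule K M // FiniteDimensional K U} := fun k => Nat.rec
    ⟨Submodule.span K {m}, inferInstance⟩
    (fun k V => if h : k < n then ⟨ext ⟨k, h⟩ V, hfin _ V⟩ else V) k
  have hU1 : ∀ i : Fin n, (U (i + 1)).1 = ext i (U i) := fun i => by
    simp only [U, dif_pos i.2]
  have hmono : Monotone fun k => (U k).1 := monotone_nat_of_le_succ fun k => by
    by_cases h : k < n
    · exact (hle ⟨k, h⟩ (U k)).trans_eq (hU1 ⟨k, h⟩).symm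
    · simp only [U, dif_neg h, le_refl]
  let pr : List (Fin n) → M := fun l => l.foldr (fun i w => z i w) m
  have hcons : ∀ i l, pr (i :: l) = z i (pr l) := fun _ _ => rfl
  -- In a weakly decreasing word the small indices act first, matching the order in which the `U k`
  -- are built.
  have hsorted : ∀ l : List (Fin n), l.Pairwise (· ≥ ·) → ∀ j, (∀ i ∈ l, (i : ℕ) < j) →
      pr l ∈ (U j).1 := by
    intro l
    induction l with
    | nil =>
      intro _ j _
      exact hmono (Nat.zero_le j) (Submodule.mem_span_singleton_self m)
    | cons i l ih =>
      intro hl j hj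
      rw [List.pairwise_cons] at hl
      have h1 := ih hl.2 (i + 1) fun i' hi' => Nat.lt_succ_of_le (hl.1 i' hi')
      rw [hU1] at h1
      have h2 := hst i _ _ h1
      rw [← hU1] at h2
      exact hmono (hj i List.mem_cons_self) h2
  let F : ℕ → Submodule K M := fun d => Submodule.span K {w | ∃ l, l.length ≤ d ∧ pr l = w}
  have hFmem : ∀ l, pr l ∈ F l.length := fun l => Submodule.subset_span ⟨l, le_rfl, rfl⟩
  have hFmono : ∀ {d d'}, d ≤ d' → F d ≤ F d' := fun h =>
    Submodule.span_mono fun _ ⟨l, hl, hw⟩ => ⟨l, hl.trans h, hw⟩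
  have hFz : ∀ i d, ∀ w ∈ F d, z i w ∈ F (d + 1) := fun i d => by
    have : F d ≤ (F (d + 1)).comap (z i) := by
      refine Submodule.span_le.mpr ?_
      rintro _ ⟨l, hl, rfl⟩
      exact Submodule.subset_span ⟨i :: l, by simpa using hl, rfl⟩
    exact this
  -- As in the Poincaré–Birkhoff–Witt theorem, a swap costs a commutator, hence a shorter word. With
  -- the sorted words this places every word in `U n`.
  have hperm : ∀ l l' : List (Fin n), l.Perm l' → ∀ d, l.length = d + 1 → pr l - pr l' ∈ F d := by
    intro l l' h
    induction h with
    | nil => intro d hd; simp at hd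
    | cons i h ih =>
      intro d hd
      rw [hcons, hcons, ← map_sub]
      rcases d with _ | d
      · have h0 := List.length_eq_zero_iff.mp (by simpa using hd)
        subst h0
        rw [List.nil_perm.mp h, sub_self, map_zero]
        exact Submodule.zero_mem _
      · exact hFz i d _ (ih d (by simpa using hd))
    | swap i j l =>
      intro d hd
      have hd' : d = l.length + 1 := by simpa using hd.symm
      have h1 : pr (j :: i :: l) - pr (i :: j :: l) = (z j * z i - z i * z j) (pr l) := rfl
      have h2 : Submodule.span K (Set.range z) ≤
          (F d).comap (LinearMap.applyₗ (R := K) (pr l)) := by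
        refine Submodule.span_le.mpr ?_
        rintro _ ⟨k, rfl⟩
        rw [hd']
        exact hFz k _ _ (hFmem l)
      rw [h1]
      exact h2 (hbr j i)
    | trans h₁ h₂ ih₁ ih₂ =>
      intro d hd
      have := (F d).add_mem (ih₁ d hd) (ih₂ d (h₁.length_eq ▸ hd))
      rwa [sub_add_sub_cancel] at this
  have hF : ∀ d, F d ≤ (U n).1 := by
    intro d
    induction d with
    | zero =>
      refine Submodule.span_le.mpr ?_
      rintro _ ⟨l, hl, rfl⟩
      rw [List.length_eq_zero_iff.mp (Nat.le_zero.mp hl)]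
      exact hsorted [] List.Pairwise.nil n (by simp)
    | succ d ih =>
      refine Submodule.span_le.mpr ?_
      rintro _ ⟨l, hl, rfl⟩
      rcases Nat.lt_or_ge d l.length with h | h
      · have h1 := hperm l (l.mergeSort (· ≥ ·)) (List.mergeSort_perm l _).symm d (by omega)
        have h2 := hsorted (l.mergeSort (· ≥ ·)) (by
          simpa using List.pairwise_mergeSort (le := fun a b : Fin n => decide (a ≥ b))
            (fun a b c h1 h2 => by simp at *; omega) (fun a b => by simp; omega) l) n
          fun i _ => i.2
        have := Submodule.add_mem _ (ih h1) h2
        rwa [sub_add_cancel] at this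
      · exact ih (Submodule.subset_span ⟨l, h, rfl⟩)
  refine ⟨⨆ d, F d, ?_, ?_, fun i => ?_⟩
  · have := (U n).2
    exact Submodule.finiteDimensional_of_le (iSup_le hF)
  · exact Submodule.mem_iSup_of_mem 0 (hFmem [])
  · have : (⨆ d, F d) ≤ (⨆ d, F d).comap (z i) :=
      iSup_le fun d w hw => Submodule.mem_iSup_of_mem (d + 1) (hFz i d w hw)
    exact this

end LocallyFinite

namespace ChevalleyDatum

section LeviFinite

variable {K 𝔤 : Type*} [Field K] [CharZero K] [LieRing 𝔤] [LieAlgebra K 𝔤]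
  [FiniteDimensional K 𝔤]
  {𝔱 : LieSubalgebra K 𝔤} [𝔱.IsCartanSubalgebra] [LieModule.IsTriangularizable K 𝔱 𝔤]
  {P : Type*} (D : ChevalleyDatum K 𝔤 𝔱 P)
  {M : Type*} [AddCommGroup M] [Module K M] [LieRingModule 𝔤 M] [LieModule K 𝔤 M]
  {J : Finset P}

/-- The bracket of two root vectors is zero, a coroot, or proportional to a root vector. -/
lemma lie_e_e (s t : P ⊕ P) : t = s.swap ∨ ⁅D.e s, D.e t⁆ = 0 ∨
    ∃ u, ∃ c : K, D.rt u = D.rt s + D.rt t ∧ ⁅D.e s, D.e t⁆ = c • D.e u := by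
  by_cases h : D.rt s + D.rt t = 0
  · left
    apply D.rt_injective
    rw [D.rt_swap, eq_neg_of_add_eq_zero_right h]
  · right
    by_cases hu : ∃ u, D.rt u = D.rt s + D.rt t
    · obtain ⟨u, hu⟩ := hu
      obtain ⟨N, hN⟩ := D.lie_int _ _ _ hu
      exact Or.inr ⟨u, N, hu, by rw [hN, Int.cast_smul_eq_zsmul]⟩
    · push Not at hu
      exact Or.inl (D.lie_eq_zero h hu)

lemma add_mem_RJ {s t u : P ⊕ P} (hs : s ∈ D.RJ J) (ht : t ∈ D.RJ J)
    (hu : D.rt u = D.rt s + D.rt t) : u ∈ D.RJ J := fun α hα hJ => by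
  rw [hu, LinearMap.add_apply, hs α hα hJ, ht α hα hJ, add_zero]

variable {lam : Module.Dual K 𝔱} {v : M}

/-- `exists_finite_stable` applied to a basis of `𝔱`, diagonal on weight vectors, and to the root
vectors of `Φ_J`, locally nilpotent by assumption. -/
lemma exists_finite_isStable [Finite P] (hv : D.IsMaxVec D.S lam v)
    (hgen : LieSubmodule.lieSpan K 𝔤 ({v} : Set M) = ⊤)
    (hJ : ∀ s ∈ D.RJ J, LocNil K M (D.e s)) (m : M) :
    ∃ W : Submodule K M, FiniteDimensional K W ∧ m ∈ W ∧ D.IsStable J W := by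
  classical
  have := Fintype.ofFinite P
  let b := Module.finBasis K 𝔱
  let g : Fin (Module.finrank K 𝔱) ⊕ {s // s ∈ D.RJ J} → 𝔤 :=
    Sum.elim (fun i => (b i : 𝔤)) (fun s => D.e s.1)
  have hgt : ∀ t : 𝔱, (t : 𝔤) ∈ Submodule.span K (Set.range g) := fun t => by
    have h1 : (t : 𝔤) = ∑ i, b.repr t i • (b i : 𝔤) := by
      conv_lhs => rw [← b.sum_repr t]
      exact map_sum 𝔱.toSubmodule.subtype _ _
    rw [h1]
    exact Submodule.sum_mem _ fun i _ => Submodule.smul_mem _ _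
      (Submodule.subset_span ⟨Sum.inl i, rfl⟩)
  have hge : ∀ s ∈ D.RJ J, D.e s ∈ Submodule.span K (Set.range g) := fun s hs =>
    Submodule.subset_span ⟨Sum.inr ⟨s, hs⟩, rfl⟩
  have hbr : ∀ i j, ⁅g i, g j⁆ ∈ Submodule.span K (Set.range g) := by
    rintro (i | ⟨s, hs⟩) (j | ⟨t, ht⟩)
    · exact hgt ⁅b i, b j⁆
    · simp only [g, Sum.elim_inl, Sum.elim_inr]
      rw [D.lie_t]
      exact Submodule.smul_mem _ _ (hge t ht)
    · simp only [g, Sum.elim_inl, Sum.elim_inr]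
      rw [← lie_skew, D.lie_t]
      exact Submodule.neg_mem _ (Submodule.smul_mem _ _ (hge s hs))
    · simp only [g, Sum.elim_inr]
      rcases D.lie_e_e s t with rfl | h | ⟨u, c, hu, h⟩
      · rw [D.lie_e_swap]
        exact hgt _
      · rw [h]
        exact Submodule.zero_mem _
      · rw [h]
        exact Submodule.smul_mem _ _ (hge u (D.add_mem_RJ hs ht hu))
  have hLF : ∀ i, LocFin (toEnd K 𝔤 M (g i)) := by
    rintro (i | ⟨s, hs⟩)
    · refine locFin_of_span (D.cyc_eq_top hv hgen) ?_
      rintro _ ⟨l, -, rfl⟩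
      refine ⟨Submodule.span K {D.prodY l v}, inferInstance,
        Submodule.mem_span_singleton_self _, fun w hw => ?_⟩
      obtain ⟨c, rfl⟩ := Submodule.mem_span_singleton.mp hw
      have h1 := D.prodY_mem_wsp hv.mem_wsp l (b i)
      simp only [g, Sum.elim_inl, toEnd_apply_apply, lie_smul, h1]
      exact Submodule.smul_mem _ _ (Submodule.smul_mem _ _ (Submodule.mem_span_singleton_self _))
    · exact locFin_of_pow (hJ s hs)
  let ε := Fintype.equivFin (Fin (Module.finrank K 𝔱) ⊕ {s // s ∈ D.RJ J})
  have hmap : ∀ x ∈ Submodule.span K (Set.range g), toEnd K 𝔤 M x ∈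
      Submodule.span K (Set.range fun i => toEnd K 𝔤 M (g (ε.symm i))) := by
    intro x hx
    induction hx using Submodule.span_induction with
    | mem x hx =>
      obtain ⟨i, rfl⟩ := hx
      exact Submodule.subset_span ⟨ε i, by simp⟩
    | zero => rw [map_zero]; exact Submodule.zero_mem _
    | add a b _ _ ha hb => rw [map_add]; exact Submodule.add_mem _ ha hb
    | smul c a _ ha => rw [map_smul]; exact Submodule.smul_mem _ c ha
  obtain ⟨W, hW, hm, hst⟩ := exists_finite_stable (fun i => toEnd K 𝔤 M (g (ε.symm i)))
    (fun i => hLF _) (fun i j => by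
      have h1 : toEnd K 𝔤 M (g (ε.symm i)) * toEnd K 𝔤 M (g (ε.symm j)) -
          toEnd K 𝔤 M (g (ε.symm j)) * toEnd K 𝔤 M (g (ε.symm i)) =
          toEnd K 𝔤 M ⁅g (ε.symm i), g (ε.symm j)⁆ := LinearMap.ext fun m => (lie_lie _ _ m).symm
      rw [h1]
      exact hmap _ (hbr (ε.symm i) (ε.symm j))) m
  have hst' : ∀ j, ∀ w ∈ W, ⁅g j, w⁆ ∈ W := fun j w hw => by
    have := hst (ε j) w hw
    rwa [Equiv.symm_apply_apply] at this
  have hsp : ∀ z ∈ Submodule.span K (Set.range g), ∀ w ∈ W, ⁅z, w⁆ ∈ W := fun z hz => by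
    have : Submodule.span K (Set.range g) ≤ (stabilizer W).toSubmodule :=
      Submodule.span_le.mpr (by rintro _ ⟨j, rfl⟩; exact hst' j)
    exact this hz
  exact ⟨W, hW, hm, fun t => hsp _ (hgt t), fun s hs => hsp _ (hge s hs)⟩

/-- The Lie subalgebra generated by `𝔱` and the root vectors for the roots in `Φ_J`. -/
def leviJ (J : Finset P) : LieSubalgebra K 𝔤 :=
  LieSubalgebra.lieSpan K 𝔤 ((𝔱 : Set 𝔤) ∪ D.e '' D.RJ J)

lemma coe_mem_leviJ (t : 𝔱) : (t : 𝔤) ∈ D.leviJ J :=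
  LieSubalgebra.subset_lieSpan (Or.inl t.2)

lemma e_mem_leviJ {s : P ⊕ P} (hs : s ∈ D.RJ J) : D.e s ∈ D.leviJ J :=
  LieSubalgebra.subset_lieSpan (Or.inr ⟨s, hs, rfl⟩)

lemma IsStable.lie_mem_leviJ {N : Submodule K M} (hN : D.IsStable J N) :
    ∀ z ∈ D.leviJ J, ∀ m ∈ N, ⁅z, m⁆ ∈ N := by
  have : D.leviJ J ≤ stabilizer N := by
    refine LieSubalgebra.lieSpan_le.mpr ?_
    rintro z (hz | ⟨s, hs, rfl⟩)
    · exact hN.lie_t ⟨z, hz⟩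
    · exact hN.lie_e s hs
  exact this

/-- A stable subspace, as a representation of the Levi subalgebra. -/
def IsStable.toLieSubmodule {N : Submodule K M} (hN : D.IsStable J N) :
    LieSubmodule K (D.leviJ J) M :=
  { N with lie_mem := fun {z m} hm => hN.lie_mem_leviJ D z z.2 m hm }

lemma isStable_toSubmodule (N : LieSubmodule K (D.leviJ J) M) : D.IsStable J N.toSubmodule where
  lie_t t _ hm := N.lie_mem (x := ⟨t, D.coe_mem_leviJ t⟩) hm
  lie_e s hs _ hm := N.lie_mem (x := ⟨D.e s, D.e_mem_leviJ hs⟩) hm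

lemma finiteDimensional_lieSpan_leviJ [Finite P] (hv : D.IsMaxVec D.S lam v)
    (hgen : LieSubmodule.lieSpan K 𝔤 ({v} : Set M) = ⊤)
    (hJ : ∀ s ∈ D.RJ J, LocNil K M (D.e s)) (m : M) :
    FiniteDimensional K (LieSubmodule.lieSpan K (D.leviJ J) ({m} : Set M)) := by
  obtain ⟨W, hW, hm, hst⟩ := D.exists_finite_isStable hv hgen hJ m
  have hle : LieSubmodule.lieSpan K (D.leviJ J) ({m} : Set M) ≤ hst.toLieSubmodule D :=
    LieSubmodule.lieSpan_le.mpr (Set.singleton_subset_iff.mpr hm)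
  exact Submodule.finiteDimensional_of_le (S₂ := W) hle

end LeviFinite
end ChevalleyDatum
end SplitReductive

/-! ### The Casimir operator of a Levi subalgebra. -/

namespace SplitReductive
open LieModule

/-- By invariance of the Killing form, the matrices of `ad z` on the two dual families are negative
transposes, so the correction terms cancel. The families need only have `z`-stable spans, not span
`𝔤`, whose Killing form may be degenerate. -/
lemma lie_sum_dual {K 𝔤 : Type*} [Field K] [LieRing 𝔤] [LieAlgebra K 𝔤] [FiniteDimensional K 𝔤]
    {M : Type*} [AddCommGroup M] [Module K M] [LieRingModule 𝔤 M] [LieModule K 𝔤 M]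
    {ι : Type*} [Fintype ι] [DecidableEq ι] (b f : ι → 𝔤)
    (hdual : ∀ i j, killingForm K 𝔤 (b i) (f j) = if i = j then 1 else 0) {z : 𝔤}
    (hb : ∀ i, ⁅z, b i⁆ ∈ Submodule.span K (Set.range b))
    (hf : ∀ i, ⁅z, f i⁆ ∈ Submodule.span K (Set.range f)) (m : M) :
    ⁅z, ∑ i, ⁅b i, ⁅f i, m⁆⁆⁆ = ∑ i, ⁅b i, ⁅f i, ⁅z, m⁆⁆⁆ := by
  have expb : ∀ x ∈ Submodule.span K (Set.range b), x = ∑ j, killingForm K 𝔤 x (f j) • b j := by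
    intro x hx
    obtain ⟨c, rfl⟩ := (Submodule.mem_span_range_iff_exists_fun K).mp hx
    refine Finset.sum_congr rfl fun j _ => ?_
    rw [map_sum, LinearMap.sum_apply, Finset.sum_eq_single j]
    · rw [map_smul, LinearMap.smul_apply, hdual, if_pos rfl, smul_eq_mul, mul_one]
    · intro i _ hij
      rw [map_smul, LinearMap.smul_apply, hdual, if_neg hij, smul_zero]
    · exact fun h => absurd (Finset.mem_univ j) h
  have expf : ∀ x ∈ Submodule.span K (Set.range f), x = ∑ j, killingForm K 𝔤 (b j) x • f j := by
    intro x hx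
    obtain ⟨c, rfl⟩ := (Submodule.mem_span_range_iff_exists_fun K).mp hx
    refine Finset.sum_congr rfl fun j _ => ?_
    rw [map_sum, Finset.sum_eq_single j]
    · rw [map_smul, hdual, if_pos rfl, smul_eq_mul, mul_one]
    · intro i _ hij
      rw [map_smul, hdual, if_neg hij.symm, smul_zero]
    · exact fun h => absurd (Finset.mem_univ j) h
  have e1 : ∑ i, ⁅⁅z, b i⁆, ⁅f i, m⁆⁆ =
      ∑ i, ∑ j, killingForm K 𝔤 ⁅z, b i⁆ (f j) • ⁅b j, ⁅f i, m⁆⁆ := by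
    refine Finset.sum_congr rfl fun i _ => ?_
    conv_lhs => rw [expb _ (hb i)]
    rw [sum_lie]
    exact Finset.sum_congr rfl fun j _ => smul_lie _ _ _
  have e2 : ∑ i, ⁅b i, ⁅⁅z, f i⁆, m⁆⁆ =
      ∑ i, ∑ j, -(killingForm K 𝔤 ⁅z, b i⁆ (f j) • ⁅b j, ⁅f i, m⁆⁆) := by
    rw [Finset.sum_comm]
    refine Finset.sum_congr rfl fun i _ => ?_
    conv_lhs => rw [expf _ (hf i)]
    rw [sum_lie, lie_sum]
    refine Finset.sum_congr rfl fun j _ => ?_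
    rw [smul_lie, lie_smul, ← neg_smul]
    congr 1
    exact (neg_eq_iff_eq_neg.mpr (traceForm_apply_lie_apply' K 𝔤 𝔤 z (b j) (f i))).symm
  have e3 : ∑ i, ⁅⁅z, b i⁆, ⁅f i, m⁆⁆ + ∑ i, ⁅b i, ⁅⁅z, f i⁆, m⁆⁆ = 0 := by
    rw [e1, e2, ← Finset.sum_add_distrib]
    refine Finset.sum_eq_zero fun i _ => ?_
    rw [← Finset.sum_add_distrib]
    exact Finset.sum_eq_zero fun j _ => add_neg_cancel _
  rw [lie_sum]
  have e4 : ∀ i, ⁅z, ⁅b i, ⁅f i, m⁆⁆⁆ =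
      ⁅⁅z, b i⁆, ⁅f i, m⁆⁆ + ⁅b i, ⁅⁅z, f i⁆, m⁆⁆ + ⁅b i, ⁅f i, ⁅z, m⁆⁆⁆ := fun i => by
    rw [leibniz_lie z (b i), leibniz_lie z (f i), lie_add, add_assoc]
  simp only [e4, Finset.sum_add_distrib]
  rw [e3, zero_add]

namespace ChevalleyDatum

section Casimir

variable {K 𝔤 : Type*} [Field K] [CharZero K] [LieRing 𝔤] [LieAlgebra K 𝔤]
  [FiniteDimensional K 𝔤]
  {𝔱 : LieSubalgebra K 𝔤} [𝔱.IsCartanSubalgebra] [LieModule.IsTriangularizable K 𝔱 𝔤]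
  {P : Type*} (D : ChevalleyDatum K 𝔤 𝔱 P)
  {M : Type*} [AddCommGroup M] [Module K M] [LieRingModule 𝔤 M] [LieModule K 𝔤 M]
  {J : Finset P}

/-- The normalization making `e_s` and `e_{-s}` dual for the Killing form. -/
noncomputable def cs (s : P ⊕ P) : K := (killingForm K 𝔤 (D.e s) (D.e s.swap))⁻¹

lemma cs_mul_killing (s : P ⊕ P) (t : 𝔱) :
    D.cs s * killingForm K 𝔤 (D.h s : 𝔤) t = D.rt s t := by
  rw [← D.killing_rt_mul, cs, mul_comm, mul_assoc, mul_inv_cancel₀ (D.killing_e_swap_ne_zero s),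
    mul_one]

lemma cs_mul_rt (s t : P ⊕ P) : D.cs t * D.rt s (D.h t) = D.cs s * D.rt t (D.h s) := by
  rw [← D.cs_mul_killing, ← D.cs_mul_killing, LieModule.traceForm_comm]
  ring

lemma exists_cs_eq (s : P ⊕ P) : ∃ q : ℚ, 0 < q ∧ D.cs s = q := by
  obtain ⟨n, hn0, hn⟩ := D.killing_h_h s
  rw [← D.two_mul_killing_e_swap] at hn
  refine ⟨2 / n, by positivity, ?_⟩
  have h0 := D.killing_e_swap_ne_zero s
  rw [cs, Rat.cast_div, Rat.cast_ofNat, Rat.cast_natCast, ← hn]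
  field_simp

/-- The simple coroots. -/
def simpleCoroot (α : D.S) : 𝔱 := D.h (Sum.inl α.1)

/-- The Gram matrix of the simple coroots for the Killing form. -/
noncomputable def gram : Matrix D.S D.S K :=
  Matrix.of fun α α' => killingForm K 𝔤 (D.simpleCoroot α : 𝔤) (D.simpleCoroot α')

lemma gram_apply (α α' : D.S) :
    D.gram α α' = killingForm K 𝔤 (D.simpleCoroot α : 𝔤) (D.simpleCoroot α') := rfl

lemma killing_sum_left (a : D.S → K) (z : 𝔤) (g : D.S → 𝔱) :
    killingForm K 𝔤 ((∑ α, a α • g α : 𝔱) : 𝔤) z = ∑ α, a α * killingForm K 𝔤 (g α : 𝔤) z := by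
  have : ((∑ α, a α • g α : 𝔱) : 𝔤) = ∑ α, a α • (g α : 𝔤) :=
    (map_sum 𝔱.toSubmodule.subtype _ _)
  rw [this, map_sum, LinearMap.sum_apply]
  exact Finset.sum_congr rfl fun α _ => by rw [map_smul, LinearMap.smul_apply, smul_eq_mul]

/-- A null vector gives a combination `t` of simple coroots on which all roots vanish, so `κ(t, ·) =
0` on `𝔱`; pairing with the coweights isolates each coefficient. -/
lemma gram_det_ne_zero [DecidableEq P] : D.gram.det ≠ 0 := by
  intro h
  obtain ⟨a, ha0, ha⟩ := Matrix.exists_mulVec_eq_zero_iff.mpr h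
  set t : 𝔱 := ∑ α, a α • D.simpleCoroot α with ht
  have hsimple : ∀ α ∈ D.S, D.rt (Sum.inl α) t = 0 := fun α hα => by
    rw [← D.cs_mul_killing, LieModule.traceForm_comm, killing_sum_left]
    have h1 := congrFun ha ⟨α, hα⟩
    rw [Matrix.mulVec, dotProduct, Pi.zero_apply] at h1
    refine mul_eq_zero_of_right _ (Eq.trans (Finset.sum_congr rfl fun α' _ => ?_) h1)
    rw [gram_apply, mul_comm, LieModule.traceForm_comm]
    rfl
  have hroot : ∀ s, D.rt s t = 0 := fun s => by
    have h1 : ∀ β, D.rt (Sum.inl β) t = 0 := fun β => by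
      rw [D.rt_cf, LinearMap.sum_apply]
      exact Finset.sum_eq_zero fun α hα => by rw [LinearMap.smul_apply, hsimple α hα, smul_zero]
    rcases s with β | β
    · exact h1 β
    · rw [D.rt_inr, LinearMap.neg_apply, h1, neg_zero]
  have hkill : ∀ t' : 𝔱, killingForm K 𝔤 (t : 𝔤) t' = 0 := fun t' => by
    rw [killing_apply]
    refine Finset.sum_eq_zero fun χ _ => ?_
    rcases D.weight_eq_zero_or χ with h | ⟨s, h⟩
    · rw [h, zero_mul, smul_zero]
    · rw [h, hroot, zero_mul, smul_zero]
  refine ha0 (funext fun α' => ?_)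
  have h1 := hkill (D.coweight α'.1)
  rw [ht, killing_sum_left, Finset.sum_eq_single α'] at h1
  · rw [simpleCoroot, ← D.killing_rt_mul, D.rt_coweight_self _ α'.2, one_mul] at h1
    exact (mul_eq_zero.mp h1).resolve_right (D.killing_e_swap_ne_zero _)
  · intro α _ hne
    rw [simpleCoroot, ← D.killing_rt_mul, D.rt_coweight_ne _ α.2 _ α'.2
      (fun h => hne (Subtype.ext h)), zero_mul, mul_zero]
  · exact fun h => absurd (Finset.mem_univ _) h

/-- The basis of the span of the coroots that is dual to the simple coroots. -/
noncomputable def dualCoroot [DecidableEq P] (α : D.S) : 𝔱 :=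
  ∑ α', D.gram⁻¹ α α' • D.simpleCoroot α'

variable [DecidableEq P]

lemma killing_dualCoroot (α α' : D.S) :
    killingForm K 𝔤 (D.simpleCoroot α : 𝔤) (D.dualCoroot α') = if α = α' then 1 else 0 := by
  have h := congrFun (congrFun (Matrix.nonsing_inv_mul D.gram
    (isUnit_iff_ne_zero.mpr D.gram_det_ne_zero)) α') α
  rw [LieModule.traceForm_comm, dualCoroot, killing_sum_left]
  rw [Matrix.mul_apply, Matrix.one_apply] at h
  rw [show (if α = α' then (1 : K) else 0) = if α' = α then 1 else 0 from by simp only [eq_comm],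
    ← h]
  rfl

lemma sum_gram_smul_dualCoroot (α : D.S) :
    ∑ α', D.gram α α' • D.dualCoroot α' = D.simpleCoroot α := by
  have h := Matrix.mul_nonsing_inv D.gram (isUnit_iff_ne_zero.mpr D.gram_det_ne_zero)
  simp only [dualCoroot, Finset.smul_sum, smul_smul]
  rw [Finset.sum_comm]
  simp only [← Finset.sum_smul]
  rw [Finset.sum_eq_single α]
  · have := congrFun (congrFun h α) α
    rw [Matrix.mul_apply, Matrix.one_apply_eq] at this
    rw [this, one_smul]
  · intro α'' _ hne
    have := congrFun (congrFun h α) α''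
    rw [Matrix.mul_apply, Matrix.one_apply_ne hne.symm] at this
    rw [this, zero_smul]
  · exact fun h => absurd (Finset.mem_univ _) h

lemma exists_sum_simpleCoroot (s : P ⊕ P) : ∃ a : D.S → K, D.h s = ∑ α, a α • D.simpleCoroot α := by
  obtain ⟨z, hz⟩ := D.h_int s
  refine ⟨fun α => (z α.1 : K), ?_⟩
  rw [hz, ← Finset.sum_coe_sort]
  exact Finset.sum_congr rfl fun α _ => by rw [Int.cast_smul_eq_zsmul]; rfl

lemma sum_killing_smul_dualCoroot (s : P ⊕ P) :
    ∑ α, killingForm K 𝔤 (D.h s : 𝔤) (D.simpleCoroot α) • D.dualCoroot α = D.h s := by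
  obtain ⟨a, ha⟩ := D.exists_sum_simpleCoroot s
  simp only [ha, killing_sum_left, Finset.sum_smul]
  rw [Finset.sum_comm]
  refine Finset.sum_congr rfl fun α _ => ?_
  rw [← D.sum_gram_smul_dualCoroot α, Finset.smul_sum]
  exact Finset.sum_congr rfl fun α' _ => by rw [smul_smul, gram_apply, D.sum_gram_smul_dualCoroot]

lemma sum_killing_smul_simpleCoroot (s : P ⊕ P) :
    ∑ α, killingForm K 𝔤 (D.h s : 𝔤) (D.dualCoroot α) • D.simpleCoroot α = D.h s := by
  obtain ⟨a, ha⟩ := D.exists_sum_simpleCoroot s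
  simp only [ha, killing_sum_left]
  refine Finset.sum_congr rfl fun α _ => ?_
  congr 1
  simp [killing_dualCoroot]

/-- The bilinear form on weights induced by the Killing form on the span of the coroots. -/
noncomputable def wform (μ ν : Module.Dual K 𝔱) : K :=
  ∑ α, μ (D.simpleCoroot α) * ν (D.dualCoroot α)

lemma wform_rt_right (μ : Module.Dual K 𝔱) (s : P ⊕ P) :
    D.wform μ (D.rt s) = D.cs s * μ (D.h s) := by
  conv_rhs => rw [← D.sum_killing_smul_simpleCoroot s, map_sum, Finset.mul_sum]
  refine Finset.sum_congr rfl fun α _ => ?_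
  rw [← D.cs_mul_killing, map_smul, smul_eq_mul]
  ring

lemma wform_rt_left (μ : Module.Dual K 𝔱) (s : P ⊕ P) :
    D.wform (D.rt s) μ = D.cs s * μ (D.h s) := by
  conv_rhs => rw [← D.sum_killing_smul_dualCoroot s, map_sum, Finset.mul_sum]
  refine Finset.sum_congr rfl fun α _ => ?_
  rw [← D.cs_mul_killing, map_smul, smul_eq_mul]
  ring

variable [Fintype P]

/-- Index set of a basis of the span of the simple coroots and the root vectors for `Φ_J`. -/
abbrev CasIdx (J : Finset P) : Type _ := ({β // β ∈ D.PJ J} ⊕ {β // β ∈ D.PJ J}) ⊕ D.S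

/-- The signed root attached to an index. -/
def idxRoot (s : {β // β ∈ D.PJ J} ⊕ {β // β ∈ D.PJ J}) : P ⊕ P :=
  Sum.map Subtype.val Subtype.val s

/-- A basis of the span of the simple coroots and the root vectors for `Φ_J`. -/
def casBasis (J : Finset P) : D.CasIdx J → 𝔤 :=
  Sum.elim (fun s => D.e (D.idxRoot s)) (fun α => (D.simpleCoroot α : 𝔤))

/-- The basis dual to `casBasis` for the Killing form. -/
noncomputable def casDual (J : Finset P) : D.CasIdx J → 𝔤 :=
  Sum.elim (fun s => D.cs (D.idxRoot s) • D.e (D.idxRoot s).swap) (fun α => (D.dualCoroot α : 𝔤))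

lemma idxRoot_mem (s : {β // β ∈ D.PJ J} ⊕ {β // β ∈ D.PJ J}) : D.idxRoot s ∈ D.RJ J := by
  rcases s with s | s
  · exact D.inl_mem_RJ.mpr s.2
  · exact D.inr_mem_RJ.mpr s.2

lemma exists_idxRoot {s : P ⊕ P} (hs : s ∈ D.RJ J) :
    ∃ i : {β // β ∈ D.PJ J} ⊕ {β // β ∈ D.PJ J}, D.idxRoot i = s := by
  rcases s with β | β
  · exact ⟨Sum.inl ⟨β, D.inl_mem_RJ.mp hs⟩, rfl⟩
  · exact ⟨Sum.inr ⟨β, D.inr_mem_RJ.mp hs⟩, rfl⟩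

lemma idxRoot_injective : Function.Injective (D.idxRoot (J := J)) :=
  Subtype.val_injective.sumMap Subtype.val_injective

lemma killing_dualCoroot_e (α : D.S) (s : P ⊕ P) :
    killingForm K 𝔤 (D.dualCoroot α : 𝔤) (D.e s) = 0 := by
  rw [dualCoroot, killing_sum_left]
  exact Finset.sum_eq_zero fun α' _ => by rw [simpleCoroot, D.killing_h_e, mul_zero]

lemma killing_casBasis_casDual (i j : D.CasIdx J) :
    killingForm K 𝔤 (D.casBasis J i) (D.casDual J j) = if i = j then 1 else 0 := by
  rcases i with i | i <;> rcases j with j | j <;>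
    simp only [casBasis, casDual, Sum.elim_inl, Sum.elim_inr, map_smul, Sum.inl.injEq,
      Sum.inr.injEq, reduceCtorEq, if_false, smul_eq_mul]
  · by_cases h : i = j
    · rw [if_pos h, h, cs, inv_mul_cancel₀ (D.killing_e_swap_ne_zero _)]
    · rw [if_neg h, D.killing_e_e, mul_zero]
      rw [D.rt_swap, ← sub_eq_add_neg, sub_ne_zero]
      exact fun h' => h (D.idxRoot_injective (D.rt_injective h'))
  · rw [LieModule.traceForm_comm, D.killing_dualCoroot_e]
  · rw [simpleCoroot, D.killing_h_e, mul_zero]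
  · exact D.killing_dualCoroot i j

lemma e_mem_span_casBasis {s : P ⊕ P} (hs : s ∈ D.RJ J) :
    D.e s ∈ Submodule.span K (Set.range (D.casBasis J)) := by
  obtain ⟨i, rfl⟩ := D.exists_idxRoot hs
  exact Submodule.subset_span ⟨Sum.inl i, rfl⟩

lemma e_mem_span_casDual {s : P ⊕ P} (hs : s ∈ D.RJ J) :
    D.e s ∈ Submodule.span K (Set.range (D.casDual J)) := by
  obtain ⟨i, hi⟩ := D.exists_idxRoot (D.swap_mem_RJ.mpr hs)
  have h1 : D.casDual J (Sum.inl i) = D.cs s.swap • D.e s := by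
    simp only [casDual, Sum.elim_inl, hi, Sum.swap_swap]
  have h2 : D.e s = (D.cs s.swap)⁻¹ • D.casDual J (Sum.inl i) := by
    rw [h1, smul_smul, inv_mul_cancel₀, one_smul]
    exact inv_ne_zero (D.killing_e_swap_ne_zero _)
  rw [h2]
  exact Submodule.smul_mem _ _ (Submodule.subset_span ⟨_, rfl⟩)

lemma h_mem_span_casBasis (s : P ⊕ P) :
    (D.h s : 𝔤) ∈ Submodule.span K (Set.range (D.casBasis J)) := by
  have h1 : (D.h s : 𝔤) = ∑ α, killingForm K 𝔤 (D.h s : 𝔤) (D.dualCoroot α) •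
      (D.simpleCoroot α : 𝔤) := by
    conv_lhs => rw [← D.sum_killing_smul_simpleCoroot s]
    exact map_sum 𝔱.toSubmodule.subtype _ _
  rw [h1]
  exact Submodule.sum_mem _ fun α _ => Submodule.smul_mem _ _
    (Submodule.subset_span ⟨Sum.inr α, rfl⟩)

lemma h_mem_span_casDual (s : P ⊕ P) :
    (D.h s : 𝔤) ∈ Submodule.span K (Set.range (D.casDual J)) := by
  have h1 : (D.h s : 𝔤) = ∑ α, killingForm K 𝔤 (D.h s : 𝔤) (D.simpleCoroot α) •
      (D.dualCoroot α : 𝔤) := by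
    conv_lhs => rw [← D.sum_killing_smul_dualCoroot s]
    exact map_sum 𝔱.toSubmodule.subtype _ _
  rw [h1]
  exact Submodule.sum_mem _ fun α _ => Submodule.smul_mem _ _
    (Submodule.subset_span ⟨Sum.inr α, rfl⟩)

/-- The Casimir operator of the Levi subalgebra attached to `J` (without its central part). -/
noncomputable def cas (J : Finset P) (M : Type*) [AddCommGroup M] [Module K M] [LieRingModule 𝔤 M]
    [LieModule K 𝔤 M] : Module.End K M := by
  classical
  exact ∑ i, toEnd K 𝔤 M (D.casBasis J i) * toEnd K 𝔤 M (D.casDual J i)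

lemma cas_apply [Fintype {β // β ∈ D.PJ J}] (m : M) :
    D.cas J M m = ∑ i, ⁅D.casBasis J i, ⁅D.casDual J i, m⁆⁆ := by
  rw [cas, LinearMap.sum_apply]
  convert rfl
  rfl

lemma lie_e_cas {s : P ⊕ P} (hs : s ∈ D.RJ J) (m : M) :
    ⁅D.e s, D.cas J M m⁆ = D.cas J M ⁅D.e s, m⁆ := by
  classical
  rw [cas_apply, cas_apply]
  refine lie_sum_dual _ _ D.killing_casBasis_casDual (fun i => ?_) (fun i => ?_) m
  · rcases i with i | α
    · change ⁅D.e s, D.e (D.idxRoot i)⁆ ∈ _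
      rcases D.lie_e_e s (D.idxRoot i) with h | h | ⟨u, c, hu, h⟩
      · rw [h, D.lie_e_swap]
        exact D.h_mem_span_casBasis s
      · rw [h]
        exact Submodule.zero_mem _
      · rw [h]
        exact Submodule.smul_mem _ _ (D.e_mem_span_casBasis (D.add_mem_RJ hs (D.idxRoot_mem i) hu))
    · change ⁅D.e s, (D.simpleCoroot α : 𝔤)⁆ ∈ _
      rw [← lie_skew, D.lie_t]
      exact Submodule.neg_mem _ (Submodule.smul_mem _ _ (D.e_mem_span_casBasis hs))
  · rcases i with i | α
    · change ⁅D.e s, D.cs (D.idxRoot i) • D.e (D.idxRoot i).swap⁆ ∈ _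
      rw [lie_smul]
      refine Submodule.smul_mem _ _ ?_
      rcases D.lie_e_e s (D.idxRoot i).swap with h | h | ⟨u, c, hu, h⟩
      · rw [h, D.lie_e_swap]
        exact D.h_mem_span_casDual s
      · rw [h]
        exact Submodule.zero_mem _
      · rw [h]
        exact Submodule.smul_mem _ _ (D.e_mem_span_casDual
          (D.add_mem_RJ hs (D.swap_mem_RJ.mpr (D.idxRoot_mem i)) hu))
    · change ⁅D.e s, (D.dualCoroot α : 𝔤)⁆ ∈ _
      rw [← lie_skew, D.lie_t]
      exact Submodule.neg_mem _ (Submodule.smul_mem _ _ (D.e_mem_span_casDual hs))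

lemma lie_t_dualCoroot (t : 𝔱) (α : D.S) : ⁅(t : 𝔤), (D.dualCoroot α : 𝔤)⁆ = 0 := by
  have h1 : (D.dualCoroot α : 𝔤) = ∑ α', D.gram⁻¹ α α' • (D.simpleCoroot α' : 𝔤) :=
    map_sum 𝔱.toSubmodule.subtype _ _
  rw [h1, lie_sum]
  exact Finset.sum_eq_zero fun α' _ => by rw [lie_smul, simpleCoroot, D.lie_h_h, smul_zero]

lemma lie_t_cas (t : 𝔱) (m : M) : ⁅(t : 𝔤), D.cas J M m⁆ = D.cas J M ⁅(t : 𝔤), m⁆ := by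
  classical
  rw [cas_apply, cas_apply]
  refine lie_sum_dual _ _ D.killing_casBasis_casDual (fun i => ?_) (fun i => ?_) m
  · rcases i with i | α
    · change ⁅(t : 𝔤), D.e (D.idxRoot i)⁆ ∈ _
      rw [D.lie_t]
      exact Submodule.smul_mem _ _ (D.e_mem_span_casBasis (D.idxRoot_mem i))
    · change ⁅(t : 𝔤), (D.simpleCoroot α : 𝔤)⁆ ∈ _
      rw [simpleCoroot, D.lie_h_h]
      exact Submodule.zero_mem _
  · rcases i with i | α
    · change ⁅(t : 𝔤), D.cs (D.idxRoot i) • D.e (D.idxRoot i).swap⁆ ∈ _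
      rw [lie_smul, D.lie_t]
      exact Submodule.smul_mem _ _ (Submodule.smul_mem _ _
        (D.e_mem_span_casDual (D.swap_mem_RJ.mpr (D.idxRoot_mem i))))
    · change ⁅(t : 𝔤), (D.dualCoroot α : 𝔤)⁆ ∈ _
      rw [D.lie_t_dualCoroot]
      exact Submodule.zero_mem _

lemma cas_mem {N : Submodule K M} (hN : D.IsStable J N) {m : M} (hm : m ∈ N) :
    D.cas J M m ∈ N := by
  classical
  rw [cas_apply]
  refine Submodule.sum_mem _ fun i _ => ?_
  rcases i with i | α
  · refine hN.lie_e _ (D.idxRoot_mem i) _ ?_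
    change ⁅D.cs (D.idxRoot i) • D.e (D.idxRoot i).swap, m⁆ ∈ N
    rw [smul_lie]
    exact Submodule.smul_mem _ _ (hN.lie_e _ (D.swap_mem_RJ.mpr (D.idxRoot_mem i)) _ hm)
  · exact hN.lie_t _ _ (hN.lie_t (D.dualCoroot α) _ hm)

open Classical in
/-- The scalar by which the Casimir operator acts on a maximal vector of weight `μ`. -/
noncomputable def casEig (J : Finset P) (μ : Module.Dual K 𝔱) : K :=
  ∑ β : {β // β ∈ D.PJ J}, D.cs (Sum.inl β.1) * μ (D.h (Sum.inl β.1)) + D.wform μ μ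

/-- Reordering `x_β y_β = y_β x_β + h_β` leaves a scalar modulo `N`. It is used with `N = ⊥` for
maximal vectors and with `N` the socle. -/
lemma cas_sub_mem {N : Submodule K M} (hN : D.IsStable J N) {μ : Module.Dual K 𝔱} {u : M}
    (hu : u ∈ wsp 𝔱 M μ) (hx : ∀ β ∈ D.PJ J, ⁅D.e (Sum.inl β), u⁆ ∈ N) :
    D.cas J M u - D.casEig J μ • u ∈ N := by
  classical
  rw [cas_apply, Fintype.sum_sum_type, Fintype.sum_sum_type, casEig, add_smul, Finset.sum_smul,
    wform, Finset.sum_smul]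
  have h1 : ∀ β : {β // β ∈ D.PJ J}, ⁅D.casBasis J (Sum.inl (Sum.inl β)),
      ⁅D.casDual J (Sum.inl (Sum.inl β)), u⁆⁆ =
      D.cs (Sum.inl β.1) • ⁅D.e (Sum.inr β.1), ⁅D.e (Sum.inl β.1), u⁆⁆ +
      (D.cs (Sum.inl β.1) * μ (D.h (Sum.inl β.1))) • u := fun β => by
    change ⁅D.e (Sum.inl β.1), ⁅D.cs (Sum.inl β.1) • D.e (Sum.inr β.1), u⁆⁆ = _
    have h2 : ⁅D.e (Sum.inl β.1), D.e (Sum.inr β.1)⁆ = (D.h (Sum.inl β.1) : 𝔤) :=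
      D.lie_e_swap (Sum.inl β.1)
    rw [smul_lie, lie_smul, leibniz_lie, h2, hu, smul_add, smul_smul, add_comm]
  have h3 : ∀ α : D.S, ⁅D.casBasis J (Sum.inr α), ⁅D.casDual J (Sum.inr α), u⁆⁆ =
      (μ (D.simpleCoroot α) * μ (D.dualCoroot α)) • u := fun α => by
    change ⁅(D.simpleCoroot α : 𝔤), ⁅(D.dualCoroot α : 𝔤), u⁆⁆ = _
    rw [hu, lie_smul, hu, smul_smul, mul_comm]
  simp only [h1, h3, Finset.sum_add_distrib]
  have h4 : ∀ a b c d : M, a + b + c + d - (b + d) = a + c := fun a b c d => by abel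
  rw [h4]
  refine N.add_mem (Submodule.sum_mem _ fun β _ => Submodule.smul_mem _ _
    (hN.lie_e _ (D.inr_mem_RJ.mpr β.2) _ (hx _ β.2))) (Submodule.sum_mem _ fun β _ => ?_)
  refine hN.lie_e _ (D.idxRoot_mem _) _ ?_
  change ⁅D.cs (Sum.inr β.1) • D.e (Sum.inl β.1), u⁆ ∈ N
  rw [smul_lie]
  exact Submodule.smul_mem _ _ (hx _ β.2)

/-- The identity `⟨2ρ_J, α^∨⟩ = 2`: the reflection in `α` permutes the positive roots of `Φ_J` other
than `α` and negates their pairings with `α^∨`. -/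
lemma sum_rt_simple [Fintype {β // β ∈ D.PJ J}] (hJ : J ⊆ D.S) {α : P} (hα : α ∈ J) :
    ∑ β : {β // β ∈ D.PJ J}, D.rt (Sum.inl β.1) (D.h (Sum.inl α)) = 2 := by
  have hαS := hJ hα
  have key : ∀ β : {β // β ∈ D.PJ J}, ∃ δ : {β // β ∈ D.PJ J}, β.1 ≠ α →
      D.rt (Sum.inl δ.1) = D.rt (Sum.inl β.1) -
        D.rt (Sum.inl β.1) (D.h (Sum.inl α)) • D.rt (Sum.inl α) := by
    intro β
    by_cases h : β.1 = α
    · exact ⟨β, fun h' => absurd h h'⟩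
    obtain ⟨m, hm, s, hs⟩ := D.exists_int_reflect (Sum.inl α) (Sum.inl β.1)
    obtain ⟨δ, rfl⟩ := D.exists_inl_of_sub_smul hαS h hs
    refine ⟨⟨δ, (D.mem_PJ_iff J).mpr fun α' hα' hJ' => ?_⟩, fun _ => by
      rw [hm]; exact hs.trans (by module)⟩
    rw [hs, LinearMap.sub_apply, LinearMap.smul_apply, (D.mem_PJ_iff J).mp β.2 α' hα' hJ',
      D.rt_coweight_ne α hαS α' hα' (fun h => hJ' (h ▸ hα)), smul_zero, sub_zero]
  choose g hg using key
  have hval : ∀ β : {β // β ∈ D.PJ J}, β.1 ≠ α →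
      D.rt (Sum.inl (g β).1) (D.h (Sum.inl α)) = -D.rt (Sum.inl β.1) (D.h (Sum.inl α)) := by
    intro β hβ
    rw [hg β hβ, LinearMap.sub_apply, LinearMap.smul_apply, D.rt_h, smul_eq_mul]
    ring
  have hgα : ∀ β : {β // β ∈ D.PJ J}, β.1 ≠ α → (g β).1 ≠ α := by
    intro β hβ h
    have h1 := hg β hβ
    rw [h] at h1
    have h2 : D.rt (Sum.inl β.1) =
        (1 + D.rt (Sum.inl β.1) (D.h (Sum.inl α))) • D.rt (Sum.inl α) := by
      rw [add_smul, one_smul]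
      exact (sub_eq_iff_eq_add.mp h1.symm)
    rcases D.eq_or_eq_swap h2 with h3 | h3
    · exact hβ (Sum.inl_injective h3)
    · simp at h3
  classical
  rw [← Finset.add_sum_erase _ _ (Finset.mem_univ ⟨α, D.mem_PJ_of_mem hJ hα⟩), D.rt_h,
    add_eq_left]
  refine Finset.sum_involution (fun β _ => g β) (fun β hβ => ?_) (fun β hβ hne heq => ?_)
    (fun β hβ => ?_) (fun β hβ => ?_)
  all_goals have hβα : β.1 ≠ α := fun h => (Finset.mem_erase.mp hβ).1 (Subtype.ext h)
  · rw [hval β hβα, add_neg_cancel]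
  · have h1 := hval β hβα
    rw [heq] at h1
    exact hne (self_eq_neg.mp h1)
  · exact Finset.mem_erase.mpr ⟨fun h => hgα β hβα (congrArg Subtype.val h), Finset.mem_univ _⟩
  · apply Subtype.ext
    apply Sum.inl_injective
    apply D.rt_injective
    rw [hg _ (hgα β hβα), hval β hβα, hg β hβα]
    module

lemma wt_eq_sum_simple (hJ : J ⊆ D.S) {l : List P} (hl : ∀ β ∈ l, β ∈ D.PJ J) (hne : l ≠ []) :
    ∃ k : P → ℕ, D.wt l = ∑ α ∈ J, k α • D.rt (Sum.inl α) ∧ ∃ α ∈ J, k α ≠ 0 := by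
  have hrt : ∀ β ∈ D.PJ J, D.rt (Sum.inl β) = ∑ α ∈ J, D.cf β α • D.rt (Sum.inl α) := by
    intro β hβ
    rw [D.rt_cf]
    refine (Finset.sum_subset hJ fun α hα hαJ => ?_).symm
    rw [hβ α hα hαJ, zero_smul]
  have hsum : ∀ l : List P, (∀ β ∈ l, β ∈ D.PJ J) →
      ∃ k : P → ℕ, D.wt l = ∑ α ∈ J, k α • D.rt (Sum.inl α) := by
    intro l hl
    induction l with
    | nil => exact ⟨0, by simp [wt]⟩
    | cons β l ih =>
      obtain ⟨k, hk⟩ := ih fun β h => hl β (List.mem_cons_of_mem _ h)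
      refine ⟨fun α => D.cf β α + k α, ?_⟩
      rw [wt_cons, hk, hrt β (hl β List.mem_cons_self), ← Finset.sum_add_distrib]
      exact Finset.sum_congr rfl fun α _ => (add_smul _ _ _).symm
  obtain ⟨k, hk⟩ := hsum l hl
  refine ⟨k, hk, ?_⟩
  by_contra! h
  have h0 : D.wt l = 0 := by
    rw [hk]
    exact Finset.sum_eq_zero fun α hα => by rw [h α hα, zero_smul]
  obtain ⟨β, l', rfl⟩ := List.exists_cons_of_ne_nil hne
  have h1 := D.wt_rho (β :: l')
  rw [h0, LinearMap.zero_apply] at h1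
  have h2 : (((β :: l').map D.ht).sum : ℕ) = 0 := by exact_mod_cast h1.symm
  have := D.ht_pos β
  simp at h2
  omega

/-- With `μ - ν = ∑ k_α α`, the eigenvalues differ by `∑ k_α c_α (2 + μ(h_α) + ν(h_α))`. Although
`K` is unordered, this is the image of a positive rational, since the `c_α` are positive rationals
and both weights are dominant. -/
lemma casEig_ne (hJ : J ⊆ D.S) {μ ν : Module.Dual K 𝔱}
    (hμ : ∀ α ∈ J, ∃ n : ℕ, μ (D.h (Sum.inl α)) = n)
    (hν : ∀ α ∈ J, ∃ n : ℕ, ν (D.h (Sum.inl α)) = n)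
    {l : List P} (hl : ∀ β ∈ l, β ∈ D.PJ J) (hne : l ≠ []) (h : μ = ν + D.wt l) :
    D.casEig J μ ≠ D.casEig J ν := by
  classical
  obtain ⟨k, hk, α₀, hα₀, hk₀⟩ := D.wt_eq_sum_simple hJ hl hne
  set τ := D.wt l with hτ
  have h1 : ∑ β : {β // β ∈ D.PJ J}, D.cs (Sum.inl β.1) * τ (D.h (Sum.inl β.1)) =
      ∑ α ∈ J, k α * (D.cs (Sum.inl α) * 2) := by
    have e1 : ∀ β : {β // β ∈ D.PJ J}, D.cs (Sum.inl β.1) * τ (D.h (Sum.inl β.1)) =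
        ∑ α ∈ J, k α * (D.cs (Sum.inl α) * D.rt (Sum.inl β.1) (D.h (Sum.inl α))) := fun β => by
      rw [hk, LinearMap.sum_apply, Finset.mul_sum]
      refine Finset.sum_congr rfl fun α _ => ?_
      rw [← D.cs_mul_rt, LinearMap.smul_apply, nsmul_eq_mul]
      ring
    simp only [e1]
    rw [Finset.sum_comm]
    refine Finset.sum_congr rfl fun α hα => ?_
    rw [← Finset.mul_sum, ← Finset.mul_sum, D.sum_rt_simple hJ hα]
  have h2 : ∀ θ, D.wform τ θ = ∑ α ∈ J, k α * (D.cs (Sum.inl α) * θ (D.h (Sum.inl α))) := by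
    intro θ
    simp only [← D.wform_rt_left]
    simp only [wform, hk, LinearMap.sum_apply, LinearMap.smul_apply, Finset.sum_mul,
      Finset.mul_sum]
    rw [Finset.sum_comm]
    refine Finset.sum_congr rfl fun α _ => Finset.sum_congr rfl fun α' _ => ?_
    rw [nsmul_eq_mul, mul_assoc]
  have h2' : ∀ θ, D.wform θ τ = ∑ α ∈ J, k α * (D.cs (Sum.inl α) * θ (D.h (Sum.inl α))) := by
    intro θ
    simp only [← D.wform_rt_right]
    simp only [wform, hk, LinearMap.sum_apply, LinearMap.smul_apply, Finset.mul_sum]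
    rw [Finset.sum_comm]
    refine Finset.sum_congr rfl fun α _ => Finset.sum_congr rfl fun α' _ => ?_
    rw [nsmul_eq_mul]
    ring
  have h3 : D.wform μ μ = D.wform ν ν + D.wform ν τ + D.wform τ μ := by
    simp only [wform, ← Finset.sum_add_distrib]
    refine Finset.sum_congr rfl fun α _ => ?_
    rw [h, LinearMap.add_apply, LinearMap.add_apply]
    ring
  choose! a ha using hμ
  choose! b hb using hν
  choose q hq hcs using D.exists_cs_eq
  have h4 : D.casEig J μ - D.casEig J ν =
      ((∑ α ∈ J, k α * (q (Sum.inl α) * (2 + a α + b α)) : ℚ) : K) := by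
    have e2 : ∑ β : {β // β ∈ D.PJ J}, D.cs (Sum.inl β.1) * μ (D.h (Sum.inl β.1)) =
        ∑ β : {β // β ∈ D.PJ J}, D.cs (Sum.inl β.1) * ν (D.h (Sum.inl β.1)) +
        ∑ β : {β // β ∈ D.PJ J}, D.cs (Sum.inl β.1) * τ (D.h (Sum.inl β.1)) := by
      rw [← Finset.sum_add_distrib]
      refine Finset.sum_congr rfl fun β _ => ?_
      rw [h, LinearMap.add_apply]
      ring
    rw [casEig, casEig, h3, h2, h2', e2, h1]
    have e3 : ∀ w x y z t : K, w + x + (y + z + t) - (w + y) = x + z + t := by intros; ring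
    rw [e3, ← Finset.sum_add_distrib, ← Finset.sum_add_distrib, Rat.cast_sum]
    refine Finset.sum_congr rfl fun α hα => ?_
    rw [ha α hα, hb α hα, hcs]
    push_cast
    ring
  intro heq
  rw [heq, sub_self] at h4
  have h5 : (∑ α ∈ J, k α * (q (Sum.inl α) * (2 + a α + b α)) : ℚ) = 0 := by exact_mod_cast h4.symm
  have h6 : (0 : ℚ) < ∑ α ∈ J, k α * (q (Sum.inl α) * (2 + a α + b α)) := by
    refine Finset.sum_pos' (fun α _ => ?_) ⟨α₀, hα₀, ?_⟩
    · have := hq (Sum.inl α)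
      positivity
    · have := hq (Sum.inl α₀)
      have : (0 : ℚ) < k α₀ := by exact_mod_cast Nat.pos_of_ne_zero hk₀
      positivity
  exact h6.ne' h5

end Casimir
end ChevalleyDatum
end SplitReductive

/-! ### Semisimplicity under a Levi subalgebra. -/

namespace SplitReductive
open LieModule
namespace ChevalleyDatum

section Semisimple

variable {K 𝔤 : Type*} [Field K] [CharZero K] [LieRing 𝔤] [LieAlgebra K 𝔤]
  [FiniteDimensional K 𝔤]
  {𝔱 : LieSubalgebra K 𝔤} [𝔱.IsCartanSubalgebra] [LieModule.IsTriangularizable K 𝔱 𝔤]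
  {P : Type*} (D : ChevalleyDatum K 𝔤 𝔱 P)
  {M : Type*} [AddCommGroup M] [Module K M] [LieRingModule 𝔤 M] [LieModule K 𝔤 M]
  {J : Finset P}

/-- The weight of a maximal vector modulo a stable subspace is dominant. -/
lemma exists_nat_of_mod (hJ : J ⊆ D.S) {N : Submodule K M} (hN : D.IsStable J N) {α : P}
    (hα : α ∈ J) (hF : LocNil K M (D.e (Sum.inr α))) {ν : Module.Dual K 𝔱} {u : M}
    (hu : u ∈ wsp 𝔱 M ν) (huN : u ∉ N) (hx : ⁅D.e (Sum.inl α), u⁆ ∈ N) :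
    ∃ n : ℕ, ν (D.h (Sum.inl α)) = n := by
  have hαJ := D.mem_PJ_of_mem hJ hα
  set f : ℕ → M := fun k => (toEnd K 𝔤 M (D.e (Sum.inr α)) ^ k) u with hf
  have hsucc : ∀ k, f (k + 1) = ⁅D.e (Sum.inr α), f k⁆ := fun k => by
    simp only [hf, pow_succ', Module.End.mul_apply, toEnd_apply_apply]
  have hxy : ⁅D.e (Sum.inl α), D.e (Sum.inr α)⁆ = (D.h (Sum.inl α) : 𝔤) := D.lie_e_swap (Sum.inl α)
  have hh : ∀ k : ℕ, ⁅(D.h (Sum.inl α) : 𝔤), f k⁆ = (ν (D.h (Sum.inl α)) - 2 * k) • f k :=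
    fun k => by
      rw [pow_mem_wsp (D.e_mem_wsp (Sum.inr α)) hu k (D.h (Sum.inl α)), D.rt_inr,
        LinearMap.add_apply, LinearMap.smul_apply, LinearMap.neg_apply, D.rt_h, nsmul_eq_mul]
      congr 1
      ring
  -- The `sl₂` formula modulo `N`. At the last `f k ∉ N` it makes `(k + 1)(ν(h_α) - k) f k` lie in
  -- `N`, so `ν(h_α) = k`.
  have key : ∀ k : ℕ, ⁅D.e (Sum.inl α), f (k + 1)⁆ -
      ((k + 1) * (ν (D.h (Sum.inl α)) - k)) • f k ∈ N := by
    intro k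
    induction k with
    | zero =>
      have h1 : ⁅D.e (Sum.inl α), f 1⁆ - (((0 : ℕ) + 1 : K) * (ν (D.h (Sum.inl α)) - (0 : ℕ))) • f 0 =
          ⁅D.e (Sum.inr α), ⁅D.e (Sum.inl α), u⁆⁆ := by
        have h0 := hh 0
        have hf0 : f 0 = u := by simp [hf]
        rw [hsucc 0, leibniz_lie, hxy, h0, hf0]
        simp
      rw [h1]
      exact hN.lie_e _ (D.inr_mem_RJ.mpr hαJ) _ hx
    | succ k ih =>
      have h1 : ⁅D.e (Sum.inl α), f (k + 1 + 1)⁆ -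
          (((k + 1 : ℕ) + 1 : K) * (ν (D.h (Sum.inl α)) - (k + 1 : ℕ))) • f (k + 1) =
          ⁅D.e (Sum.inr α), ⁅D.e (Sum.inl α), f (k + 1)⁆ -
            ((k + 1) * (ν (D.h (Sum.inl α)) - k)) • f k⁆ := by
        rw [hsucc (k + 1), leibniz_lie, hxy, hh, lie_sub, lie_smul, ← hsucc k]
        push_cast
        module
      rw [h1]
      exact hN.lie_e _ (D.inr_mem_RJ.mpr hαJ) _ ih
  obtain ⟨k, hk1, hk2⟩ := Nat.exists_not_and_succ_of_not_zero_of_exists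
    (p := fun k => f k ∈ N) (by simpa [hf] using huN) (by
      obtain ⟨k, hk⟩ := hF u
      exact ⟨k, by simp only [hf]; rw [hk]; exact N.zero_mem⟩)
  have h2 := key k
  rw [N.sub_mem_iff_right (hN.lie_e _ (D.inl_mem_RJ.mpr hαJ) _ hk2)] at h2
  refine ⟨k, ?_⟩
  by_contra hne
  have h3 : ((k : K) + 1) * (ν (D.h (Sum.inl α)) - k) ≠ 0 :=
    mul_ne_zero (by exact_mod_cast Nat.succ_ne_zero k) (sub_ne_zero.mpr hne)
  exact hk1 ((N.smul_mem_iff h3).mp h2)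

lemma isStable_bot : D.IsStable J (⊥ : Submodule K M) where
  lie_t t m hm := by rw [(Submodule.mem_bot K).mp hm, lie_zero]; exact Submodule.zero_mem _
  lie_e s _ m hm := by rw [(Submodule.mem_bot K).mp hm, lie_zero]; exact Submodule.zero_mem _

lemma exists_nat_of_isMaxVec (hJ : J ⊆ D.S) (hF : ∀ α ∈ J, LocNil K M (D.e (Sum.inr α)))
    {μ : Module.Dual K 𝔱} {w : M} (hw : D.IsMaxVec J μ w) (hw0 : w ≠ 0) :
    ∀ α ∈ J, ∃ n : ℕ, μ (D.h (Sum.inl α)) = n := fun α hα =>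
  D.exists_nat_of_mod hJ D.isStable_bot hα (hF α hα) hw.mem_wsp (by simpa using hw0)
    (by simpa using hw.lie_x α (D.mem_PJ_of_mem hJ hα))

lemma cyc_le {N : Submodule K M} (hN : D.IsStable J N) {w : M} (hw : w ∈ N) : D.cyc J w ≤ N := by
  refine Submodule.span_le.mpr ?_
  rintro _ ⟨l, hl, rfl⟩
  induction l with
  | nil => exact hw
  | cons β l ih =>
    exact hN.lie_e _ (D.inr_mem_RJ.mpr (hl β List.mem_cons_self)) _
      (ih fun β h => hl β (List.mem_cons_of_mem _ h))

lemma exists_mem_wsp_ne_zero {v : M} {lam : Module.Dual K 𝔱} (hv : D.IsMaxVec D.S lam v)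
    (hgen : LieSubmodule.lieSpan K 𝔤 ({v} : Set M) = ⊤) {N : Submodule K M}
    (hN : D.IsStable J N) (h0 : N ≠ ⊥) : ∃ χ, ∃ u ∈ N, u ∈ wsp 𝔱 M χ ∧ u ≠ 0 := by
  obtain ⟨m, hm, hm0⟩ := Submodule.exists_mem_ne_zero_of_ne_bot h0
  have htop : (⨆ χ, wsp 𝔱 M χ) = ⊤ := by
    rw [eq_top_iff, ← D.cyc_eq_top hv hgen, cyc, Submodule.span_le]
    rintro _ ⟨l, -, rfl⟩
    exact Submodule.mem_iSup_of_mem _ (D.prodY_mem_wsp hv.mem_wsp l)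
  obtain ⟨f, hf, rfl⟩ := (Submodule.mem_iSup_iff_exists_finsupp _ _).mp
    (htop ▸ Submodule.mem_top (x := m))
  obtain ⟨χ, hχ⟩ : ∃ χ, f χ ≠ 0 := by
    by_contra! h
    exact hm0 (Finset.sum_eq_zero fun χ _ => h χ)
  exact ⟨χ, f χ, component_mem N hN.lie_t id Function.injective_id f.support f
    (fun χ _ => hf χ) hm χ (Finsupp.mem_support_iff.mpr hχ), hf χ, hχ⟩

variable [DecidableEq P] [Fintype P]

lemma cas_eq_smul {μ : Module.Dual K 𝔱} {w : M} (hw : D.IsMaxVec J μ w) {m : M}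
    (hm : m ∈ D.cyc J w) : D.cas J M m = D.casEig J μ • m := by
  have : D.cyc J w ≤ LinearMap.ker (D.cas J M - D.casEig J μ • LinearMap.id) := by
    refine Submodule.span_le.mpr ?_
    rintro _ ⟨l, hl, rfl⟩
    simp only [SetLike.mem_coe, LinearMap.mem_ker, LinearMap.sub_apply, LinearMap.smul_apply,
      LinearMap.id_apply]
    induction l with
    | nil =>
      have := D.cas_sub_mem D.isStable_bot hw.mem_wsp (fun β hβ => by
        rw [hw.lie_x β hβ]; exact Submodule.zero_mem _)
      simpa [prodY] using this
    | cons β l ih =>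
      have h1 := ih fun β h => hl β (List.mem_cons_of_mem _ h)
      rw [prodY_cons, ← D.lie_e_cas (D.inr_mem_RJ.mpr (hl β List.mem_cons_self)), ← lie_smul,
        ← lie_sub, h1, lie_zero]
  have h1 := this hm
  rwa [LinearMap.mem_ker, LinearMap.sub_apply, LinearMap.smul_apply, LinearMap.id_apply,
    sub_eq_zero] at h1

variable {lam : Module.Dual K 𝔱} {v : M}

/-- This makes `cyc J w` simple. A weight vector of `N` of greatest height is maximal; the Casimir
acts on it as on `w`, so `casEig_ne` leaves no room for a lower weight and it is a multiple of `w`.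
-/
lemma mem_of_le_cyc (hv : D.IsMaxVec D.S lam v)
    (hgen : LieSubmodule.lieSpan K 𝔤 ({v} : Set M) = ⊤) (hJ : J ⊆ D.S)
    (hF : ∀ α ∈ J, LocNil K M (D.e (Sum.inr α))) {μ : Module.Dual K 𝔱} {w : M}
    (hw : D.IsMaxVec J μ w) {N : Submodule K M} (hN : D.IsStable J N) (h0 : N ≠ ⊥)
    (hle : N ≤ D.cyc J w) : w ∈ N := by
  classical
  have hex : ∃ n : ℕ, ∃ χ : Module.Dual K 𝔱, χ D.rho = lam D.rho - n ∧
      ∃ u ∈ N, u ∈ wsp 𝔱 M χ ∧ u ≠ 0 := by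
    obtain ⟨χ, u, huN, hu, hu0⟩ := D.exists_mem_wsp_ne_zero hv hgen hN h0
    obtain ⟨n, hn⟩ := D.exists_rho hv hgen hu hu0
    exact ⟨n, χ, hn, u, huN, hu, hu0⟩
  obtain ⟨ν, hν, u, huN, hu, hu0⟩ := Nat.find_spec hex
  have hmax : D.IsMaxVec J ν u := ⟨hu, fun β hβ => by
    by_contra hne
    have h1 := lie_mem_wsp (D.e_mem_wsp (Sum.inl β)) hu
    obtain ⟨n', hn'⟩ := D.exists_rho hv hgen h1 hne
    have h2 := Nat.find_min' hex ⟨_, hn', _, hN.lie_e _ (D.inl_mem_RJ.mpr hβ) _ huN, h1, hne⟩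
    rw [LinearMap.add_apply, hν, D.rt_rho] at hn'
    have h3 : ((D.ht β + n' : ℕ) : K) = (Nat.find hex : ℕ) := by
      push_cast
      linear_combination hn'
    have := Nat.cast_injective h3
    have := D.ht_pos β
    omega⟩
  have hw0 : w ≠ 0 := by
    rintro rfl
    have : D.cyc J (0 : M) ≤ ⊥ := D.cyc_le D.isStable_bot (Submodule.zero_mem _)
    exact hu0 (by simpa using this (hle huN))
  have hspan := D.exists_wt_eq hw.mem_wsp hu (hle huN)
  have hcas : D.casEig J μ = D.casEig J ν := by
    have h1 := D.cas_eq_smul hw (hle huN)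
    rw [D.cas_eq_smul hmax (D.mem_cyc_self u), ← sub_eq_zero, ← sub_smul, smul_eq_zero,
      sub_eq_zero] at h1
    exact (h1.resolve_right hu0).symm
  have hsub : {m | ∃ l : List P, (∀ β ∈ l, β ∈ D.PJ J) ∧ μ = ν + D.wt l ∧ D.prodY l w = m} ⊆
      {w} := by
    rintro _ ⟨l, hl, hwt, rfl⟩
    have hl0 : l = [] := by
      by_contra hne
      exact D.casEig_ne hJ (D.exists_nat_of_isMaxVec hJ hF hw hw0)
        (D.exists_nat_of_isMaxVec hJ hF hmax hu0) hl hne hwt hcas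
    subst hl0
    rfl
  obtain ⟨c, rfl⟩ := Submodule.mem_span_singleton.mp (Submodule.span_mono hsub hspan)
  have hc : c ≠ 0 := by
    rintro rfl
    simp at hu0
  exact (N.smul_mem_iff hc).mp huN

/-- Polynomials in an operator commute with every operator commuting with it. -/
lemma aeval_apply_comm {T Ω : Module.End K M} (h : ∀ m, T (Ω m) = Ω (T m)) (Q : Polynomial K)
    (m : M) : T (Polynomial.aeval Ω Q m) = Polynomial.aeval Ω Q (T m) := by
  induction Q using Polynomial.induction_on' with
  | add p q hp hq => rw [map_add, LinearMap.add_apply, map_add, hp, hq, LinearMap.add_apply]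
  | monomial n a =>
    have hpow : ∀ m, T ((Ω ^ n) m) = (Ω ^ n) (T m) := by
      induction n with
      | zero => simp
      | succ n ih => intro m; rw [pow_succ', Module.End.mul_apply, h, ih]; rfl
    rw [Polynomial.aeval_monomial, Module.End.mul_apply, Module.End.mul_apply,
      Module.algebraMap_end_apply, Module.algebraMap_end_apply, map_smul, hpow]

lemma aeval_sub_mem {N : Submodule K M} {Ω : Module.End K M} (hΩ : ∀ m ∈ N, Ω m ∈ N) {a : K}
    {u : M} (hu : Ω u - a • u ∈ N) (Q : Polynomial K) :
    Polynomial.aeval Ω Q u - Q.eval a • u ∈ N := by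
  induction Q using Polynomial.induction_on' with
  | add p q hp hq =>
    have := N.add_mem hp hq
    convert this using 1
    rw [map_add, LinearMap.add_apply, Polynomial.eval_add]
    module
  | monomial n b =>
    have hpow : ∀ n : ℕ, (Ω ^ n) u - a ^ n • u ∈ N := by
      intro n
      induction n with
      | zero => simp
      | succ n ih =>
        have := N.add_mem (hΩ _ ih) (N.smul_mem (a ^ n) hu)
        convert this using 1
        rw [pow_succ', Module.End.mul_apply, map_sub, map_smul]
        module
    have := N.smul_mem b (hpow n)
    convert this using 1
    rw [Polynomial.aeval_monomial, Module.End.mul_apply, Module.algebraMap_end_apply,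
      Polynomial.eval_monomial]
    module

/-- The sum of the cyclic subspaces generated by maximal vectors. -/
def socle (J : Finset P) (M : Type*) [AddCommGroup M] [Module K M] [LieRingModule 𝔤 M]
    [LieModule K 𝔤 M] : Submodule K M :=
  Submodule.span K {m | ∃ μ w l, D.IsMaxVec J μ w ∧ (∀ β ∈ l, β ∈ D.PJ J) ∧ D.prodY l w = m}

lemma cyc_le_socle {μ : Module.Dual K 𝔱} {w : M} (hw : D.IsMaxVec J μ w) :
    D.cyc J w ≤ D.socle J M :=
  Submodule.span_mono fun _ ⟨l, hl, hm⟩ => ⟨μ, w, l, hw, hl, hm⟩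

lemma isStable_socle : D.IsStable J (D.socle J M) where
  lie_t t := by
    refine span_induction_lie _ ?_
    rintro _ ⟨μ, w, l, hw, hl, rfl⟩
    exact D.cyc_le_socle hw ((D.isStable_cyc hw).lie_t t _ (D.prodY_mem_cyc hl))
  lie_e s hs := by
    refine span_induction_lie _ ?_
    rintro _ ⟨μ, w, l, hw, hl, rfl⟩
    exact D.cyc_le_socle hw ((D.isStable_cyc hw).lie_e s hs _ (D.prodY_mem_cyc hl))

/-- Take a weight vector `u` of greatest height outside the socle; then every `x_β u` lies in the
socle. A polynomial in the Casimir corrects `u` to a genuine maximal vector congruent to a nonzero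
multiple of `u`, so `u` was in the socle. -/
lemma socle_eq_top (hv : D.IsMaxVec D.S lam v)
    (hgen : LieSubmodule.lieSpan K 𝔤 ({v} : Set M) = ⊤) (hJ : J ⊆ D.S)
    (hF : ∀ α ∈ J, LocNil K M (D.e (Sum.inr α))) : D.socle J M = ⊤ := by
  classical
  by_contra hne
  have hstab : D.IsStable J (D.socle J M) := D.isStable_socle
  have hex : ∃ n : ℕ, ∃ χ : Module.Dual K 𝔱, χ D.rho = lam D.rho - n ∧
      ∃ u ∈ wsp 𝔱 M χ, u ∉ D.socle J M := by
    by_contra! h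
    refine hne (eq_top_iff.mpr ?_)
    rw [← D.cyc_eq_top hv hgen, cyc, Submodule.span_le]
    rintro _ ⟨l, -, rfl⟩
    exact h _ _ (by rw [LinearMap.sub_apply, D.wt_rho]) _ (D.prodY_mem_wsp hv.mem_wsp l)
  obtain ⟨ν, hν, u, hu, huN⟩ := Nat.find_spec hex
  have hx : ∀ β ∈ D.PJ J, ⁅D.e (Sum.inl β), u⁆ ∈ D.socle J M := fun β hβ => by
    by_contra hmem
    have h1 := lie_mem_wsp (D.e_mem_wsp (Sum.inl β)) hu
    obtain ⟨n', hn'⟩ := D.exists_rho hv hgen h1 (fun h => hmem (h ▸ Submodule.zero_mem _))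
    have h2 := Nat.find_min' hex ⟨_, hn', _, h1, hmem⟩
    rw [LinearMap.add_apply, hν, D.rt_rho] at hn'
    have h3 : ((D.ht β + n' : ℕ) : K) = (Nat.find hex : ℕ) := by
      push_cast
      linear_combination hn'
    have := Nat.cast_injective h3
    have := D.ht_pos β
    omega
  have hdom : ∀ α ∈ J, ∃ n : ℕ, ν (D.h (Sum.inl α)) = n := fun α hα =>
    D.exists_nat_of_mod hJ hstab hα (hF α hα) hu huN (hx α (D.mem_PJ_of_mem hJ hα))
  set Ω := D.cas J M with hΩ
  -- The constituents of `x_β u` come from maximal vectors of weight strictly above `ν`, so their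
  -- Casimir eigenvalues differ from that of `ν` and a product of linear factors kills `x_β u`.
  have hQ : ∀ β : {β // β ∈ D.PJ J}, ∃ Q : Polynomial K, Q.eval (D.casEig J ν) ≠ 0 ∧
      Polynomial.aeval Ω Q ⁅D.e (Sum.inl β.1), u⁆ = 0 := by
    intro β
    have h1 := mem_span_same_weight
      (ι := {q : Module.Dual K 𝔱 × M × List P //
        D.IsMaxVec J q.1 q.2.1 ∧ ∀ β ∈ q.2.2, β ∈ D.PJ J})
      (fun q => D.prodY q.1.2.2 q.1.2.1) (fun q => q.1.1 - D.wt q.1.2.2)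
      (fun q => D.prodY_mem_wsp q.2.1.mem_wsp _) (lie_mem_wsp (D.e_mem_wsp (Sum.inl β.1)) hu) (by
        refine Submodule.span_mono ?_ (hx β.1 β.2)
        rintro _ ⟨μ, w, l, hw, hl, rfl⟩
        exact ⟨⟨⟨μ, w, l⟩, hw, hl⟩, rfl⟩)
    generalize ⁅D.e (Sum.inl β.1), u⁆ = m at h1
    induction h1 using Submodule.span_induction with
    | mem m hm =>
      obtain ⟨⟨⟨μ, w, l⟩, hw, hl⟩, hwt, rfl⟩ := hm
      simp only [Set.mem_ofPred_eq] at hwt hw hl ⊢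
      by_cases hw0 : w = 0
      · refine ⟨1, by simp, ?_⟩
        have : D.cyc J w ≤ ⊥ := D.cyc_le D.isStable_bot (by simp [hw0])
        rw [(Submodule.mem_bot K).mp (this (D.prodY_mem_cyc hl)), map_zero]
      · refine ⟨Polynomial.X - Polynomial.C (D.casEig J μ), ?_, ?_⟩
        · rw [Polynomial.eval_sub, Polynomial.eval_X, Polynomial.eval_C, sub_ne_zero]
          refine (D.casEig_ne hJ (D.exists_nat_of_isMaxVec hJ hF hw hw0) hdom (l := β.1 :: l)
            (fun δ hδ => ?_) (by simp) ?_).symm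
          · rcases List.mem_cons.mp hδ with rfl | h
            exacts [β.2, hl δ h]
          · rw [wt_cons, ← add_assoc, ← hwt, sub_add_cancel]
        · rw [map_sub, Polynomial.aeval_X, Polynomial.aeval_C, LinearMap.sub_apply,
            Module.algebraMap_end_apply, hΩ, D.cas_eq_smul hw (D.prodY_mem_cyc hl), sub_self]
    | zero => exact ⟨1, by simp, by simp⟩
    | add a b _ _ ha hb =>
      obtain ⟨Q, h2, h3⟩ := ha
      obtain ⟨Q', h2', h3'⟩ := hb
      refine ⟨Q * Q', by rw [Polynomial.eval_mul]; exact mul_ne_zero h2 h2', ?_⟩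
      rw [map_add, map_mul, Module.End.mul_apply, Module.End.mul_apply, h3', map_zero, add_zero,
        ← Module.End.mul_apply, ← map_mul, mul_comm, map_mul, Module.End.mul_apply, h3, map_zero]
    | smul c a _ ha =>
      obtain ⟨Q, h2, h3⟩ := ha
      exact ⟨Q, h2, by rw [map_smul, h3, smul_zero]⟩
  choose Q hQ1 hQ2 using hQ
  set R := ∏ β, Q β with hR
  have hR1 : R.eval (D.casEig J ν) ≠ 0 := by
    rw [hR, Polynomial.eval_prod]
    exact Finset.prod_ne_zero_iff.mpr fun β _ => hQ1 β
  have hmax : D.IsMaxVec J ν (Polynomial.aeval Ω R u) := by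
    refine ⟨fun t => ?_, fun β hβ => ?_⟩
    · have := aeval_apply_comm (T := toEnd K 𝔤 M (t : 𝔤)) (Ω := Ω) (D.lie_t_cas t) R u
      rw [toEnd_apply_apply, toEnd_apply_apply, hu t, map_smul] at this
      exact this
    · have := aeval_apply_comm (T := toEnd K 𝔤 M (D.e (Sum.inl β))) (Ω := Ω)
        (D.lie_e_cas (D.inl_mem_RJ.mpr hβ)) R u
      rw [toEnd_apply_apply, toEnd_apply_apply] at this
      rw [this, hR, ← Finset.prod_erase_mul _ _ (Finset.mem_univ ⟨β, hβ⟩), map_mul,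
        Module.End.mul_apply, hQ2 ⟨β, hβ⟩, map_zero]
  have h1 := aeval_sub_mem (fun m hm => D.cas_mem hstab hm) (D.cas_sub_mem hstab hu hx) R
  rw [Submodule.sub_mem_iff_right _ (D.cyc_le_socle hmax (D.mem_cyc_self _))] at h1
  exact huN ((Submodule.smul_mem_iff _ hR1).mp h1)

lemma complementedLattice_leviJ (hv : D.IsMaxVec D.S lam v)
    (hgen : LieSubmodule.lieSpan K 𝔤 ({v} : Set M) = ⊤) (hJ : J ⊆ D.S)
    (hF : ∀ α ∈ J, LocNil K M (D.e (Sum.inr α))) :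
    ComplementedLattice (LieSubmodule K (D.leviJ J) M) := by
  apply complementedLattice_of_sSup_atoms_eq_top
  have hatom : ∀ μ w, D.IsMaxVec J μ w → w ≠ 0 →
      ∃ N : LieSubmodule K (D.leviJ J) M, IsAtom N ∧ N.toSubmodule = D.cyc J w := by
    intro μ w hw hw0
    refine ⟨(D.isStable_cyc hw).toLieSubmodule D, ⟨fun h => hw0 ?_, fun N hN => ?_⟩, rfl⟩
    · have : w ∈ (⊥ : LieSubmodule K (D.leviJ J) M) := h ▸ D.mem_cyc_self w
      simpa using this
    · by_contra h0
      refine hN.not_ge ?_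
      have hN' := D.isStable_toSubmodule N
      exact D.cyc_le hN' (D.mem_of_le_cyc hv hgen hJ hF hw hN'
        (fun h => h0 (by rwa [LieSubmodule.toSubmodule_eq_bot] at h)) hN.le)
  rw [← LieSubmodule.toSubmodule_eq_top, eq_top_iff, ← D.socle_eq_top hv hgen hJ hF, socle,
    Submodule.span_le]
  rintro _ ⟨μ, w, l, hw, hl, rfl⟩
  have hmem : D.prodY l w ∈ D.cyc J w := D.prodY_mem_cyc hl
  by_cases hw0 : w = 0
  · have : D.cyc J w ≤ ⊥ := D.cyc_le D.isStable_bot (by simp [hw0])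
    rw [(Submodule.mem_bot K).mp (this hmem)]
    exact Submodule.zero_mem _
  · obtain ⟨N, hN, hNcyc⟩ := hatom μ w hw hw0
    rw [← hNcyc] at hmem
    exact (le_sSup (show N ∈ {a | IsAtom a} from hN) : N ≤ _) hmem

end Semisimple
end ChevalleyDatum
end SplitReductive

/-! ### Roots and root vectors from a Chevalley basis. -/

namespace SplitReductive
open LieModule

/-- Counterpart of `mem_span_same_weight` for generalized weight spaces, needed before `𝔱` is known
to act diagonally. -/
lemma mem_span_of_iSupIndep {K V ι κ : Type*} [Field K] [AddCommGroup V] [Module K V]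
    {p : κ → Submodule K V} (hp : iSupIndep p) (g : ι → V) (ω : ι → κ) (hg : ∀ i, g i ∈ p (ω i))
    {χ : κ} {z : V} (hz : z ∈ p χ) (hspan : z ∈ Submodule.span K (Set.range g)) :
    z ∈ Submodule.span K (g '' {i | ω i = χ}) := by
  classical
  obtain ⟨c, rfl⟩ := (Finsupp.mem_span_range_iff_exists_finsupp).mp hspan
  have h1 : c.sum (fun i a => a • g i) =
      ∑ i ∈ c.support.filter (fun i => ω i = χ), c i • g i +
      ∑ i ∈ c.support.filter (fun i => ¬ ω i = χ), c i • g i :=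
    (Finset.sum_filter_add_sum_filter_not _ _ _).symm
  have ha : ∑ i ∈ c.support.filter (fun i => ω i = χ), c i • g i ∈ p χ :=
    Submodule.sum_mem _ fun i hi => by
      rw [← (Finset.mem_filter.mp hi).2]
      exact Submodule.smul_mem _ _ (hg i)
  have hb : ∑ i ∈ c.support.filter (fun i => ¬ ω i = χ), c i • g i ∈ ⨆ j, ⨆ _ : j ≠ χ, p j :=
    Submodule.sum_mem _ fun i hi => Submodule.smul_mem _ _
      (Submodule.mem_iSup_of_mem (ω i) (Submodule.mem_iSup_of_mem (Finset.mem_filter.mp hi).2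
        (hg i)))
  have hb' : ∑ i ∈ c.support.filter (fun i => ¬ ω i = χ), c i • g i ∈ p χ := by
    have := Submodule.sub_mem _ hz ha
    rwa [h1, add_sub_cancel_left] at this
  have h0 := (Submodule.disjoint_def.mp (hp χ)) _ hb' hb
  rw [h1, h0, add_zero]
  exact Submodule.sum_mem _ fun i hi => Submodule.smul_mem _ _
    (Submodule.subset_span ⟨i, (Finset.mem_filter.mp hi).2, rfl⟩)

section Extraction

variable {K 𝔤 : Type*} [Field K] [CharZero K] [LieRing 𝔤] [LieAlgebra K 𝔤]
  [FiniteDimensional K 𝔤]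
  {𝔱 : LieSubalgebra K 𝔤} [𝔱.IsCartanSubalgebra] [LieModule.IsTriangularizable K 𝔱 𝔤]

/-- Modulo `[𝔤, 𝔤]`, the nilpotent power `(ad t - χ t) ^ k` acts on `z` as the nonzero scalar `(-χ
t) ^ k`. -/
lemma mem_derivedSeries_of_mem_rootSpace {χ : 𝔱 → K} (hχ : χ ≠ 0) {z : 𝔤}
    (hz : z ∈ LieAlgebra.rootSpace 𝔱 χ) : z ∈ (LieAlgebra.derivedSeries K 𝔤 1).toSubmodule := by
  obtain ⟨t, ht⟩ := Function.ne_iff.mp hχ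
  obtain ⟨k, hk⟩ := (mem_genWeightSpace 𝔤 χ z).mp hz t
  have hlie : ∀ m : 𝔤, ⁅(t : 𝔤), m⁆ ∈ (LieAlgebra.derivedSeries K 𝔤 1).toSubmodule := fun m => by
    have : ⁅(t : 𝔤), m⁆ ∈ ⁅(⊤ : LieIdeal K 𝔤), (⊤ : LieIdeal K 𝔤)⁆ :=
      LieSubmodule.lie_mem_lie (LieSubmodule.mem_top _) (LieSubmodule.mem_top _)
    exact this
  have key : ∀ k : ℕ, ((toEnd K 𝔱 𝔤 t - χ t • 1) ^ k) z - (-χ t) ^ k • z ∈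
      (LieAlgebra.derivedSeries K 𝔤 1).toSubmodule := by
    intro k
    induction k with
    | zero => simp
    | succ k ih =>
      have h1 := Submodule.add_mem _ (hlie (((toEnd K 𝔱 𝔤 t - χ t • 1) ^ k) z))
        (Submodule.smul_mem _ (-χ t) ih)
      convert h1 using 1
      rw [pow_succ', Module.End.mul_apply, LinearMap.sub_apply, LinearMap.smul_apply,
        Module.End.one_apply, toEnd_apply_apply, LieSubalgebra.coe_bracket_of_module]
      module
  have h2 := key k
  rw [hk, zero_sub, Submodule.neg_mem_iff] at h2
  exact (Submodule.smul_mem_iff _ (pow_ne_zero _ (neg_ne_zero.mpr ht))).mp h2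

lemma coe_mem_rootSpace_zero (t : 𝔱) : (t : 𝔤) ∈ LieAlgebra.rootSpace 𝔱 (0 : 𝔱 → K) := by
  rw [LieAlgebra.rootSpace_zero_eq]
  exact t.2

variable {Δ : Finset (LieModule.Weight K 𝔱 𝔤)} {x y : posRoots 𝔱 Δ → 𝔤}

/-- The elements of a Chevalley basis as a family. -/
def chevFamily (x y : posRoots 𝔱 Δ → 𝔤) :
    posRoots 𝔱 Δ ⊕ (posRoots 𝔱 Δ ⊕ {α : posRoots 𝔱 Δ // α.1 ∈ Δ}) → 𝔤 :=
  Sum.elim x (Sum.elim y (fun α : {α : posRoots 𝔱 Δ // α.1 ∈ Δ} => ⁅x α.1, y α.1⁆))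

/-- The weights of the elements of a Chevalley basis. -/
def chevWeight (Δ : Finset (LieModule.Weight K 𝔱 𝔤)) :
    posRoots 𝔱 Δ ⊕ (posRoots 𝔱 Δ ⊕ {α : posRoots 𝔱 Δ // α.1 ∈ Δ}) → (𝔱 → K) :=
  Sum.elim (fun β => (β.1 : 𝔱 → K)) (Sum.elim (fun β => -(β.1 : 𝔱 → K)) 0)

lemma range_chevFamily (x y : posRoots 𝔱 Δ → 𝔤) : Set.range (chevFamily x y) =
    Set.range x ∪ Set.range y ∪ {h | ∃ α : posRoots 𝔱 Δ, α.1 ∈ Δ ∧ h = ⁅x α, y α⁆} := by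
  ext z
  simp only [chevFamily, Set.Sum.elim_range, Set.mem_union, Set.mem_range, Subtype.exists,
    Set.mem_ofPred_eq, or_assoc]
  refine or_congr Iff.rfl (or_congr Iff.rfl ⟨?_, ?_⟩)
  · rintro ⟨a, ha, ha', rfl⟩
    exact ⟨a, ha, ha', rfl⟩
  · rintro ⟨a, ha, ha', rfl⟩
    exact ⟨a, ha, ha', rfl⟩

lemma coe_ne_zero_of_mem_roots {β : LieModule.Weight K 𝔱 𝔤} (hβ : β ∈ roots 𝔱) :
    (β : 𝔱 → K) ≠ 0 := hβ

lemma IsBase.mem_posRoots (hΔ : IsBase 𝔱 Δ) {α : LieModule.Weight K 𝔱 𝔤} (hα : α ∈ Δ) :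
    α ∈ posRoots 𝔱 Δ := by
  classical
  refine ⟨hΔ.subset_roots α hα, fun α' => if α' = α then 1 else 0, ?_⟩
  simp [hα]

lemma IsBase.add_ne_zero (hΔ : IsBase 𝔱 Δ) (β β' : posRoots 𝔱 Δ) :
    (β.1 : 𝔱 → K) + (β'.1 : 𝔱 → K) ≠ 0 := by
  intro h
  obtain ⟨hβ, f, hf⟩ := β.2
  obtain ⟨-, f', hf'⟩ := β'.2
  rw [hf, hf', ← Finset.sum_add_distrib] at h
  simp only [← add_smul] at h
  rw [← Finset.sum_coe_sort Δ] at h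
  have h1 := Fintype.linearIndependent_iff.mp hΔ.linearIndependent
    (fun α => ((f α.1 + f' α.1 : ℕ) : K)) (by simpa only [Nat.cast_smul_eq_nsmul] using h)
  refine coe_ne_zero_of_mem_roots hβ (hf.trans (Finset.sum_eq_zero fun α hα => ?_))
  have h2 : f α + f' α = 0 := by exact_mod_cast h1 ⟨α, hα⟩
  rw [Nat.eq_zero_of_add_eq_zero_right h2, zero_smul]

lemma IsChevalleyBasis.mem_rootSpace (hxy : IsChevalleyBasis 𝔱 Δ x y) (i) :
    chevFamily x y i ∈ LieAlgebra.rootSpace 𝔱 (chevWeight Δ i) := by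
  rcases i with β | β | α
  · exact hxy.x_mem β
  · exact hxy.y_mem β
  · obtain ⟨h, -, hh⟩ := hxy.lie_x_y α.1
    have : chevFamily x y (Sum.inr (Sum.inr α)) = (h : 𝔤) := hh
    rw [this]
    exact coe_mem_rootSpace_zero h

/-- The root vectors of a Chevalley basis, indexed by signed roots. -/
def rootVec (x y : posRoots 𝔱 Δ → 𝔤) : posRoots 𝔱 Δ ⊕ posRoots 𝔱 Δ → 𝔤 := Sum.elim x y

/-- The signed roots as functions. -/
def signedRoot (Δ : Finset (LieModule.Weight K 𝔱 𝔤)) : posRoots 𝔱 Δ ⊕ posRoots 𝔱 Δ → (𝔱 → K) :=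
  Sum.elim (fun β => (β.1 : 𝔱 → K)) (fun β => -(β.1 : 𝔱 → K))

lemma signedRoot_injective (hΔ : IsBase 𝔱 Δ) : Function.Injective (signedRoot Δ) := by
  rintro (β | β) (β' | β') h
  · exact congrArg Sum.inl (Subtype.ext (DFunLike.coe_injective h))
  · exact absurd (eq_neg_iff_add_eq_zero.mp h) (hΔ.add_ne_zero β β')
  · exact absurd (eq_neg_iff_add_eq_zero.mp h.symm) (hΔ.add_ne_zero β' β)
  · exact congrArg Sum.inr (Subtype.ext (DFunLike.coe_injective (neg_injective h)))

lemma signedRoot_ne_zero (s : posRoots 𝔱 Δ ⊕ posRoots 𝔱 Δ) : signedRoot Δ s ≠ 0 := by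
  rcases s with β | β
  · exact coe_ne_zero_of_mem_roots β.2.1
  · exact neg_ne_zero.mpr (coe_ne_zero_of_mem_roots β.2.1)

lemma IsChevalleyBasis.rootVec_mem (hxy : IsChevalleyBasis 𝔱 Δ x y) (s) :
    rootVec x y s ∈ LieAlgebra.rootSpace 𝔱 (signedRoot Δ s) := by
  rcases s with β | β
  · exact hxy.x_mem β
  · exact hxy.y_mem β

lemma IsChevalleyBasis.rootVec_ne_zero (hxy : IsChevalleyBasis 𝔱 Δ x y) (s) :
    rootVec x y s ≠ 0 := by
  rcases s with β | β
  · exact hxy.linearIndependent.ne_zero (Sum.inl β)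
  · exact hxy.linearIndependent.ne_zero (Sum.inr (Sum.inl β))

/-- The signed roots are roots. -/
lemma IsChevalleyBasis.exists_root (hxy : IsChevalleyBasis 𝔱 Δ x y) (s) :
    ∃ β ∈ roots 𝔱, (β : 𝔱 → K) = signedRoot Δ s := by
  refine ⟨⟨signedRoot Δ s, fun h => hxy.rootVec_ne_zero s ?_⟩, signedRoot_ne_zero s, rfl⟩
  have := hxy.rootVec_mem s
  rwa [show LieAlgebra.rootSpace 𝔱 (signedRoot Δ s) = ⊥ from h, LieSubmodule.mem_bot] at this

/-- Root spaces are spanned by the root vectors of the Chevalley basis. -/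
lemma IsChevalleyBasis.exists_smul (hΔ : IsBase 𝔱 Δ) (hxy : IsChevalleyBasis 𝔱 Δ x y) {χ : 𝔱 → K}
    (hχ : χ ≠ 0) {z : 𝔤} (hz : z ∈ LieAlgebra.rootSpace 𝔱 χ) (hz0 : z ≠ 0) :
    ∃ s, signedRoot Δ s = χ ∧ ∃ c : K, z = c • rootVec x y s := by
  have h1 := mem_derivedSeries_of_mem_rootSpace hχ hz
  rw [← hxy.span_eq, ← range_chevFamily] at h1
  have h2 := mem_span_of_iSupIndep (p := fun χ : 𝔱 → K => (genWeightSpace 𝔤 χ).toSubmodule)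
    (LieSubmodule.iSupIndep_toSubmodule.mpr (iSupIndep_genWeightSpace K 𝔱 𝔤))
    (chevFamily x y) (chevWeight Δ) hxy.mem_rootSpace hz h1
  have hsub : chevFamily x y '' {i | chevWeight Δ i = χ} ⊆
      {z | ∃ s, signedRoot Δ s = χ ∧ z = rootVec x y s} := by
    rintro _ ⟨β | β | α, hi, rfl⟩
    · exact ⟨Sum.inl β, hi, rfl⟩
    · exact ⟨Sum.inr β, hi, rfl⟩
    · exact absurd hi.symm hχ
  have h3 := Submodule.span_mono hsub h2
  by_cases hs : ∃ s, signedRoot Δ s = χ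
  · obtain ⟨s, hs⟩ := hs
    have hsub' : {z | ∃ s, signedRoot Δ s = χ ∧ z = rootVec x y s} ⊆ {rootVec x y s} := by
      rintro _ ⟨s', hs', rfl⟩
      rw [signedRoot_injective hΔ (hs'.trans hs.symm)]
      rfl
    obtain ⟨c, hc⟩ := Submodule.mem_span_singleton.mp (Submodule.span_mono hsub' h3)
    exact ⟨s, hs, c, hc.symm⟩
  · push Not at hs
    have hemp : {z | ∃ s, signedRoot Δ s = χ ∧ z = rootVec x y s} = ∅ :=
      Set.eq_empty_iff_forall_notMem.mpr (by rintro z ⟨s, hs', -⟩; exact hs s hs')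
    rw [hemp, Submodule.span_empty, Submodule.mem_bot] at h3
    exact absurd h3 hz0

/-- The signed roots as linear functionals. -/
noncomputable def signedRootLin (Δ : Finset (LieModule.Weight K 𝔱 𝔤)) :
    posRoots 𝔱 Δ ⊕ posRoots 𝔱 Δ → Module.Dual K 𝔱 :=
  Sum.elim (fun β => Weight.toLinear K 𝔱 𝔤 β.1) (fun β => -Weight.toLinear K 𝔱 𝔤 β.1)

lemma coe_signedRootLin (s : posRoots 𝔱 Δ ⊕ posRoots 𝔱 Δ) :
    (signedRootLin Δ s : 𝔱 → K) = signedRoot Δ s := by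
  rcases s with β | β <;> rfl

lemma signedRootLin_apply (s : posRoots 𝔱 Δ ⊕ posRoots 𝔱 Δ) (t : 𝔱) :
    signedRootLin Δ s t = signedRoot Δ s t := congrFun (coe_signedRootLin s) t

/-- Root spaces are a priori generalized eigenspaces. Each contains a genuine eigenvector and is the
line through its Chevalley basis vector, which is therefore an eigenvector. -/
lemma IsChevalleyBasis.lie_t (hΔ : IsBase 𝔱 Δ) (hxy : IsChevalleyBasis 𝔱 Δ x y) (t : 𝔱) (s) :
    ⁅(t : 𝔤), rootVec x y s⁆ = signedRootLin Δ s t • rootVec x y s := by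
  obtain ⟨β, hβ, hβs⟩ := hxy.exists_root s
  obtain ⟨w, hw0, hw⟩ := exists_forall_lie_eq_smul K 𝔱 𝔤 β
  have hwmem : w ∈ LieAlgebra.rootSpace 𝔱 (β : 𝔱 → K) :=
    weightSpace_le_genWeightSpace 𝔤 _ ((mem_weightSpace _ _).mpr hw)
  obtain ⟨s', hs', c, rfl⟩ := hxy.exists_smul hΔ (coe_ne_zero_of_mem_roots hβ) hwmem hw0
  obtain rfl := signedRoot_injective hΔ (hs'.trans hβs)
  have hc : c ≠ 0 := by
    rintro rfl
    simp at hw0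
  have h1 := hw t
  rw [lie_smul, LieSubalgebra.coe_bracket_of_module, hβs, smul_comm] at h1
  rw [signedRootLin_apply]
  exact smul_right_injective 𝔤 hc h1

end Extraction
end SplitReductive

/-! ### Construction of the Chevalley datum. -/

namespace SplitReductive
open LieModule

lemma exists_dual_vector {K V ι : Type*} [Field K] [AddCommGroup V] [Module K V]
    [FiniteDimensional K V] {f : ι → Module.Dual K V} (hf : LinearIndependent K f) (i : ι) :
    ∃ t : V, f i t = 1 ∧ ∀ j, j ≠ i → f j t = 0 := by
  classical
  obtain ⟨φ, hφ⟩ := LinearMap.exists_extend ((Module.Basis.span hf).coord i)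
  have hval : ∀ j, φ (f j) = if j = i then 1 else 0 := fun j => by
    have h1 := LinearMap.congr_fun hφ ⟨f j, Submodule.subset_span ⟨j, rfl⟩⟩
    have h2 : (⟨f j, Submodule.subset_span ⟨j, rfl⟩⟩ : Submodule.span K (Set.range f)) =
        Module.Basis.span hf j := (Module.Basis.span_apply hf j).symm
    rw [LinearMap.comp_apply, Submodule.subtype_apply] at h1
    rw [h1, h2, Module.Basis.coord_apply, Module.Basis.repr_self, Finsupp.single_apply]
  refine ⟨(Module.evalEquiv K V).symm φ, ?_, fun j hj => ?_⟩
  · rw [Module.apply_evalEquiv_symm_apply, hval, if_pos rfl]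
  · rw [Module.apply_evalEquiv_symm_apply, hval, if_neg hj]

lemma exists_int_linearCombination {K V ι : Type*} [Field K] [AddCommGroup V] [Module K V]
    {g : ι → V} (hg : LinearIndependent K g) {l : ι →₀ K}
    (hl : Finsupp.linearCombination K g l ∈ Submodule.span ℤ (Set.range g)) (i : ι) :
    ∃ n : ℤ, l i = n := by
  obtain ⟨c, hc⟩ := (Finsupp.mem_span_range_iff_exists_finsupp).mp hl
  have h1 : Finsupp.linearCombination K g (c.mapRange (fun n : ℤ => (n : K)) Int.cast_zero) =
      Finsupp.linearCombination K g l := by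
    rw [← hc, Finsupp.linearCombination_apply, Finsupp.sum_mapRange_index (by simp)]
    exact Finset.sum_congr rfl fun i _ => Int.cast_smul_eq_zsmul K _ _
  exact ⟨c i, by rw [← hg h1, Finsupp.mapRange_apply]⟩

section Datum

variable {K 𝔤 : Type*} [Field K] [CharZero K] [LieRing 𝔤] [LieAlgebra K 𝔤]
  [FiniteDimensional K 𝔤]
  {𝔱 : LieSubalgebra K 𝔤} [𝔱.IsCartanSubalgebra] [LieModule.IsTriangularizable K 𝔱 𝔤]
  {Δ : Finset (LieModule.Weight K 𝔱 𝔤)} {x y : posRoots 𝔱 Δ → 𝔤}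

open Classical in
/-- A set of simple roots, as a set of positive roots. -/
noncomputable def posFinset (Δ I : Finset (LieModule.Weight K 𝔱 𝔤)) : Finset (posRoots 𝔱 Δ) :=
  I.subtype (fun β => β ∈ posRoots 𝔱 Δ)

lemma mem_posFinset {I : Finset (LieModule.Weight K 𝔱 𝔤)} {α : posRoots 𝔱 Δ} :
    α ∈ posFinset Δ I ↔ α.1 ∈ I := by
  classical
  rw [posFinset, Finset.mem_subtype]

lemma sum_posFinset {I : Finset (LieModule.Weight K 𝔱 𝔤)} (hI : ∀ α ∈ I, α ∈ posRoots 𝔱 Δ)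
    {A : Type*} [AddCommMonoid A] (f : LieModule.Weight K 𝔱 𝔤 → A) :
    ∑ α ∈ posFinset Δ I, f α.1 = ∑ α ∈ I, f α := by
  classical
  rw [posFinset, Finset.sum_subtype_of_mem f hI]

lemma IsBase.exists_coweight (hΔ : IsBase 𝔱 Δ) : ∃ w : posRoots 𝔱 Δ → 𝔱,
    ∀ α ∈ posFinset Δ Δ, α.1 (w α) = 1 ∧ ∀ α' ∈ posFinset Δ Δ, α' ≠ α → α'.1 (w α) = 0 := by
  have hli : LinearIndependent K (fun α : Δ => Weight.toLinear K 𝔱 𝔤 α.1) :=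
    LinearIndependent.of_comp (LinearMap.ltoFun K 𝔱 K K) hΔ.linearIndependent
  have : ∀ α : posRoots 𝔱 Δ, ∃ t : 𝔱, α ∈ posFinset Δ Δ →
      α.1 t = 1 ∧ ∀ α' ∈ posFinset Δ Δ, α' ≠ α → α'.1 t = 0 := by
    intro α
    by_cases hα : α ∈ posFinset Δ Δ
    · obtain ⟨t, h1, h2⟩ := exists_dual_vector hli ⟨α.1, mem_posFinset.mp hα⟩
      exact ⟨t, fun _ => ⟨h1, fun α' hα' hne => h2 ⟨α'.1, mem_posFinset.mp hα'⟩
        fun h => hne (Subtype.ext (Subtype.mk.inj h))⟩⟩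
    · exact ⟨0, fun h => absurd h hα⟩
  choose w hw using this
  exact ⟨w, hw⟩

/-- Applied to `[x_β, y_β]`, this makes every coroot an integral combination of simple ones: only
the weight-zero basis elements, the simple coroots, can occur. -/
lemma IsChevalleyBasis.exists_int_simple (hxy : IsChevalleyBasis 𝔱 Δ x y)
    {h : 𝔱} (hh : (h : 𝔤) ∈ Submodule.span ℤ (Set.range (chevFamily x y))) :
    ∃ z : posRoots 𝔱 Δ → ℤ, (h : 𝔤) = ∑ α ∈ posFinset Δ Δ, z α • ⁅x α, y α⁆ := by
  classical
  have hfin : Finite (posRoots 𝔱 Δ) := inferInstance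
  have := Fintype.ofFinite (posRoots 𝔱 Δ)
  have hK : (h : 𝔤) ∈ Submodule.span K (Set.range (chevFamily x y)) := by
    have h1 : Submodule.span ℤ (Set.range (chevFamily x y)) ≤
        (Submodule.span K (Set.range (chevFamily x y))).restrictScalars ℤ :=
      Submodule.span_le.mpr Submodule.subset_span
    exact h1 hh
  have h2 := mem_span_of_iSupIndep (p := fun χ : 𝔱 → K => (genWeightSpace 𝔤 χ).toSubmodule)
    (LieSubmodule.iSupIndep_toSubmodule.mpr (iSupIndep_genWeightSpace K 𝔱 𝔤))
    (chevFamily x y) (chevWeight Δ) hxy.mem_rootSpace (coe_mem_rootSpace_zero h) hK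
  obtain ⟨l, hl, hlh⟩ := (Finsupp.mem_span_image_iff_linearCombination K).mp h2
  rw [← hlh] at hh
  choose n hn using exists_int_linearCombination hxy.linearIndependent hh
  have hzero : ∀ i, chevWeight Δ i ≠ 0 → l i = 0 := fun i hi => by
    by_contra h0
    exact hi ((Finsupp.mem_supported K l).mp hl (Finsupp.mem_support_iff.mpr h0))
  refine ⟨fun α => if hα : α.1 ∈ Δ then n (Sum.inr (Sum.inr ⟨α, hα⟩)) else 0, ?_⟩
  rw [← hlh, Finsupp.linearCombination_apply, Finsupp.sum_fintype _ _ (by simp),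
    Fintype.sum_sum_type, Fintype.sum_sum_type,
    Finset.sum_subtype (posFinset Δ Δ) (p := fun α => α.1 ∈ Δ) (fun α => mem_posFinset)]
  rw [Finset.sum_eq_zero, zero_add, Finset.sum_eq_zero, zero_add]
  · refine Finset.sum_congr rfl fun α _ => ?_
    beta_reduce
    rw [dif_pos α.2, hn, Int.cast_smul_eq_zsmul]
    rfl
  · intro β _
    rw [hzero, zero_smul]
    exact neg_ne_zero.mpr (coe_ne_zero_of_mem_roots β.2.1)
  · intro β _
    rw [hzero, zero_smul]
    exact coe_ne_zero_of_mem_roots β.2.1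

lemma rootVec_mem_range (s : posRoots 𝔱 Δ ⊕ posRoots 𝔱 Δ) :
    ∃ i, chevFamily x y i = rootVec x y s := by
  rcases s with β | β
  · exact ⟨Sum.inl β, rfl⟩
  · exact ⟨Sum.inr (Sum.inl β), rfl⟩

lemma IsChevalleyBasis.lie_mem_int (hxy : IsChevalleyBasis 𝔱 Δ x y) (s t) :
    ⁅rootVec x y s, rootVec x y t⁆ ∈ Submodule.span ℤ (Set.range (chevFamily x y)) := by
  obtain ⟨i, hi⟩ := rootVec_mem_range (x := x) (y := y) s
  obtain ⟨j, hj⟩ := rootVec_mem_range (x := x) (y := y) t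
  rw [range_chevFamily]
  refine hxy.integral _ ?_ _ ?_
  · rw [← range_chevFamily, ← hi]
    exact ⟨i, rfl⟩
  · rw [← range_chevFamily, ← hj]
    exact ⟨j, rfl⟩

lemma mem_rootSpace_of_mem_wsp {χ : Module.Dual K 𝔱} {w : 𝔤} (hw : w ∈ wsp 𝔱 𝔤 χ) :
    w ∈ LieAlgebra.rootSpace 𝔱 (χ : 𝔱 → K) :=
  weightSpace_le_genWeightSpace 𝔤 _ ((mem_weightSpace _ _).mpr hw)

lemma IsChevalleyBasis.exists_datum (hΔ : IsBase 𝔱 Δ) (hxy : IsChevalleyBasis 𝔱 Δ x y) :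
    ∃ D : ChevalleyDatum K 𝔤 𝔱 (posRoots 𝔱 Δ), D.S = posFinset Δ Δ ∧ D.e = rootVec x y ∧
      D.rt = signedRootLin Δ := by
  choose h hcor hlie using hxy.lie_x_y
  obtain ⟨w, hw⟩ := hΔ.exists_coweight
  have hcf : ∀ β : posRoots 𝔱 Δ, ∃ f : LieModule.Weight K 𝔱 𝔤 → ℕ,
    (β.1 : 𝔱 → K) = ∑ α ∈ Δ, f α • (α : 𝔱 → K) := fun β => β.2.2
  choose f hf using hcf
  have hinj : Function.Injective (signedRootLin Δ) := fun s s' hss =>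
    signedRoot_injective hΔ (by rw [← coe_signedRootLin, hss, coe_signedRootLin])
  have hex : ∀ (χ : Module.Dual K 𝔱) (w : 𝔤), χ ≠ 0 → w ≠ 0 →
      (∀ t : 𝔱, ⁅(t : 𝔤), w⁆ = χ t • w) →
      ∃ s, signedRootLin Δ s = χ ∧ ∃ c : K, w = c • rootVec x y s := by
    intro χ w hχ hw0 hw
    obtain ⟨s, hs, hc⟩ := hxy.exists_smul hΔ (χ := χ)
      (fun h0 => hχ (LinearMap.ext fun t => congrFun h0 t)) (mem_rootSpace_of_mem_wsp hw) hw0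
    exact ⟨s, DFunLike.coe_injective ((coe_signedRootLin s).trans hs), hc⟩
  have hlie' : ∀ s, ⁅rootVec x y s, rootVec x y s.swap⁆ =
      ((Sum.elim h (fun β => -h β) s : 𝔱) : 𝔤) := by
    rintro (β | β)
    · exact hlie β
    · change ⁅y β, x β⁆ = -(h β : 𝔤)
      rw [← hlie β, lie_skew]
  have hint : ∀ s, ∃ z : posRoots 𝔱 Δ → ℤ, (Sum.elim h (fun β => -h β) s : 𝔱) =
      ∑ α ∈ posFinset Δ Δ, z α • h α := by
    intro s
    obtain ⟨z, hz⟩ := hxy.exists_int_simple (hlie' s ▸ hxy.lie_mem_int s s.swap)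
    refine ⟨z, Subtype.ext (hz.trans ?_)⟩
    simp only [hlie]
    exact (map_sum 𝔱.toSubmodule.subtype (fun α => z α • h α) (posFinset Δ Δ)).symm
  refine ⟨{
    S := posFinset Δ Δ
    e := rootVec x y
    h := Sum.elim h (fun β => -h β)
    rt := signedRootLin Δ
    coweight := w
    cf := fun β α => f β α.1
    lie_t := hxy.lie_t hΔ
    e_ne_zero := hxy.rootVec_ne_zero
    lie_e_swap := hlie'
    rt_h := ?_
    rt_swap := ?_
    rt_injective := hinj
    exists_of_weight := hex
    lie_int := ?_
    h_int := hint
    rt_cf := ?_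
    rt_coweight_self := fun α hα => (hw α hα).1
    rt_coweight_ne := fun α hα α' hα' hne => (hw α' hα').2 α hα hne
    top_le := ?_ }, rfl, rfl, rfl⟩
  · rintro (β | β)
    · exact (hcor β).2
    · change -(Weight.toLinear K 𝔱 𝔤 β.1) (-h β) = 2
      rw [map_neg, neg_neg]
      exact (hcor β).2
  · rintro (β | β)
    · rfl
    · exact (neg_neg _).symm
  · intro s t u hu
    by_cases h0 : ⁅rootVec x y s, rootVec x y t⁆ = 0
    · exact ⟨0, by rw [h0, zero_smul]⟩
    have hwt := lie_mem_wsp (𝔱 := 𝔱) (hxy.lie_t hΔ · s) (hxy.lie_t hΔ · t)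
    rw [add_comm, ← hu] at hwt
    obtain ⟨s', hs', c, hc⟩ := hex _ _ (fun h0 => signedRoot_ne_zero u (by
      rw [← coe_signedRootLin, h0]; rfl)) h0 hwt
    obtain rfl := hinj hs'
    obtain ⟨i, hi⟩ := rootVec_mem_range (x := x) (y := y) s'
    obtain ⟨n, hn⟩ := exists_int_linearCombination hxy.linearIndependent
      (l := Finsupp.single i c) (by
        rw [Finsupp.linearCombination_single]
        have := hxy.lie_mem_int s t
        rw [hc, ← hi] at this
        exact this) i
    rw [Finsupp.single_eq_same] at hn
    exact ⟨n, by rw [hc, hn, Int.cast_smul_eq_zsmul]⟩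
  · intro β
    refine LinearMap.ext fun t => ?_
    have h1 := congrFun (hf β) t
    rw [← sum_posFinset (fun α hα => hΔ.mem_posRoots hα)
      (fun α => f β α • (α : 𝔱 → K)), Finset.sum_apply] at h1
    rw [LinearMap.sum_apply]
    exact h1
  · intro N hN he z
    have htop := iSup_genWeightSpace_eq_top K 𝔱 𝔤
    have hle : ∀ χ : 𝔱 → K, (genWeightSpace 𝔤 χ).toSubmodule ≤ N := by
      intro χ z hz
      by_cases hχ : χ = 0
      · subst hχ
        have hz' : z ∈ LieAlgebra.rootSpace 𝔱 (0 : 𝔱 → K) := hz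
        rw [LieAlgebra.rootSpace_zero_eq] at hz'
        exact hN ⟨z, hz'⟩
      · by_cases hz0 : z = 0
        · exact hz0 ▸ N.zero_mem
        obtain ⟨s, -, c, rfl⟩ := hxy.exists_smul hΔ hχ hz hz0
        exact N.smul_mem c (he s)
    have : z ∈ (⨆ χ : 𝔱 → K, genWeightSpace 𝔤 χ).toSubmodule := by
      rw [htop]
      exact Submodule.mem_top
    rw [LieSubmodule.iSup_toSubmodule] at this
    exact (iSup_le hle) this

end Datum
end SplitReductive

/-! ### Maximality of the parabolic and nonvanishing of `y_α ^ n v`. -/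

namespace SplitReductive
open LieModule

section Translation

variable {K 𝔤 : Type*} [Field K] [CharZero K] [LieRing 𝔤] [LieAlgebra K 𝔤]
  [FiniteDimensional K 𝔤]
  {𝔱 : LieSubalgebra K 𝔤} [𝔱.IsCartanSubalgebra] [LieModule.IsTriangularizable K 𝔱 𝔤]
  {Δ : Finset (LieModule.Weight K 𝔱 𝔤)} {x y : posRoots 𝔱 Δ → 𝔤}
  {D : ChevalleyDatum K 𝔤 𝔱 (posRoots 𝔱 Δ)}

lemma posFinset_mono {I J : Finset (LieModule.Weight K 𝔱 𝔤)} (h : I ⊆ J) :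
    posFinset Δ I ⊆ posFinset Δ J := fun _ hα =>
  mem_posFinset.mpr (h (mem_posFinset.mp hα))

lemma signedRoot_mem_of_mem_RJ (hΔ : IsBase 𝔱 Δ) (hS : D.S = posFinset Δ Δ)
    (hrt : D.rt = signedRootLin Δ) {I : Finset (LieModule.Weight K 𝔱 𝔤)} (hI : I ⊆ Δ)
    {s : posRoots 𝔱 Δ ⊕ posRoots 𝔱 Δ} (hs : s ∈ D.RJ (posFinset Δ I)) :
    ∃ f : LieModule.Weight K 𝔱 𝔤 → ℤ, signedRoot Δ s = ∑ α ∈ I, f α • (α : 𝔱 → K) := by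
  classical
  have key : ∀ β ∈ D.PJ (posFinset Δ I), ∃ f : LieModule.Weight K 𝔱 𝔤 → ℤ,
      signedRoot Δ (Sum.inl β) = ∑ α ∈ I, f α • (α : 𝔱 → K) := by
    intro β hβ
    refine ⟨fun α => if h : α ∈ posRoots 𝔱 Δ then D.cf β ⟨α, h⟩ else 0, ?_⟩
    rw [← sum_posFinset fun α hα => hΔ.mem_posRoots (hI hα)]
    have h1 := D.rt_cf β
    rw [hS, ← Finset.sum_subset (posFinset_mono hI) (fun α hα hαI => by
      rw [hβ α (hS ▸ hα) hαI, zero_smul]), hrt] at h1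
    funext t
    have h2 := LinearMap.congr_fun h1 t
    rw [LinearMap.sum_apply] at h2
    rw [Finset.sum_apply, ← signedRootLin_apply, h2]
    refine Finset.sum_congr rfl fun α _ => ?_
    beta_reduce
    rw [dif_pos α.2, LinearMap.smul_apply, signedRootLin_apply, Pi.smul_apply, natCast_zsmul]
    rfl
  rcases s with β | β
  · exact key β (D.inl_mem_RJ.mp hs)
  · obtain ⟨f, hf⟩ := key β (D.inr_mem_RJ.mp hs)
    refine ⟨fun α => -f α, ?_⟩
    simp only [neg_smul, Finset.sum_neg_distrib, ← hf]
    rfl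

lemma mem_RJ_of_signedRoot (hS : D.S = posFinset Δ Δ) (hΔ : IsBase 𝔱 Δ)
    (hrt : D.rt = signedRootLin Δ) {I : Finset (LieModule.Weight K 𝔱 𝔤)} (hI : I ⊆ Δ)
    {s : posRoots 𝔱 Δ ⊕ posRoots 𝔱 Δ} {f : LieModule.Weight K 𝔱 𝔤 → ℤ}
    (hf : signedRoot Δ s = ∑ α ∈ I, f α • (α : 𝔱 → K)) : s ∈ D.RJ (posFinset Δ I) := by
  intro α hα hαI
  rw [hrt, signedRootLin_apply, hf, Finset.sum_apply]
  refine Finset.sum_eq_zero fun α' hα' => ?_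
  have hα'P : α' ∈ posRoots 𝔱 Δ := hΔ.mem_posRoots (hI hα')
  have hα'S : (⟨α', hα'P⟩ : posRoots 𝔱 Δ) ∈ D.S := hS ▸ mem_posFinset.mpr (hI hα')
  have h1 := D.rt_coweight_ne _ hα'S α hα fun h => hαI (mem_posFinset.mpr (h ▸ hα'))
  rw [hrt] at h1
  have h2 : α' (D.coweight α) = 0 := h1
  rw [Pi.smul_apply, h2, smul_zero]

lemma mem_PJ_posFinset (hΔ : IsBase 𝔱 Δ) (hS : D.S = posFinset Δ Δ)
    (hrt : D.rt = signedRootLin Δ) {I : Finset (LieModule.Weight K 𝔱 𝔤)} (hI : I ⊆ Δ)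
    {γ : posRoots 𝔱 Δ} : γ ∈ D.PJ (posFinset Δ I) ↔ γ.1 ∈ leviRoots 𝔱 I := by
  rw [← D.inl_mem_RJ]
  exact ⟨fun h => ⟨γ.2.1, signedRoot_mem_of_mem_RJ hΔ hS hrt hI h⟩,
    fun ⟨_, f, hf⟩ => mem_RJ_of_signedRoot hS hΔ hrt hI (s := Sum.inl γ) hf⟩

lemma levi_eq_leviJ (hΔ : IsBase 𝔱 Δ) (hxy : IsChevalleyBasis 𝔱 Δ x y) (hS : D.S = posFinset Δ Δ)
    (he : D.e = rootVec x y) (hrt : D.rt = signedRootLin Δ)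
    {I : Finset (LieModule.Weight K 𝔱 𝔤)} (hI : I ⊆ Δ) :
    levi 𝔱 I = D.leviJ (posFinset Δ I) := by
  apply le_antisymm
  · refine LieSubalgebra.lieSpan_le.mpr (Set.union_subset (fun t ht => D.coe_mem_leviJ ⟨t, ht⟩) ?_)
    refine Set.iUnion₂_subset fun β hβ z hz => ?_
    by_cases hz0 : z = 0
    · exact hz0 ▸ (D.leviJ (posFinset Δ I)).zero_mem
    obtain ⟨s, hs, c, rfl⟩ := hxy.exists_smul hΔ (coe_ne_zero_of_mem_roots hβ.1) hz hz0
    obtain ⟨f, hf⟩ := hβ.2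
    have h1 := D.e_mem_leviJ (mem_RJ_of_signedRoot hS hΔ hrt hI (hs.trans hf))
    rw [he] at h1
    exact (D.leviJ (posFinset Δ I)).smul_mem c h1
  · refine LieSubalgebra.lieSpan_le.mpr (Set.union_subset
      (fun t ht => LieSubalgebra.subset_lieSpan (Or.inl ht)) ?_)
    rintro _ ⟨s, hs, rfl⟩
    obtain ⟨f, hf⟩ := signedRoot_mem_of_mem_RJ hΔ hS hrt hI hs
    obtain ⟨β, hβ, hβs⟩ := hxy.exists_root s
    refine LieSubalgebra.subset_lieSpan (Or.inr (Set.mem_iUnion₂.mpr ⟨β, ⟨hβ, f, hβs.trans hf⟩, ?_⟩))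
    rw [he, hβs]
    exact hxy.rootVec_mem s

variable {M : Type*} [AddCommGroup M] [Module K M] [LieRingModule 𝔤 M] [LieModule K 𝔤 M]

lemma finiteDimensional_lieSpan_of_le {L L' : LieSubalgebra K 𝔤} (h : L ≤ L') (m : M)
    (hm : FiniteDimensional K (LieSubmodule.lieSpan K L' ({m} : Set M))) :
    FiniteDimensional K (LieSubmodule.lieSpan K L ({m} : Set M)) := by
  let N : LieSubmodule K L M :=
    { (LieSubmodule.lieSpan K L' ({m} : Set M)).toSubmodule with
      lie_mem := fun {z w} hw =>
        (LieSubmodule.lieSpan K L' ({m} : Set M)).lie_mem (x := ⟨z.1, h z.2⟩) hw }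
  have hle : LieSubmodule.lieSpan K L ({m} : Set M) ≤ N :=
    LieSubmodule.lieSpan_le.mpr
      (Set.singleton_subset_iff.mpr (LieSubmodule.subset_lieSpan (Set.mem_singleton m)))
  exact Submodule.finiteDimensional_of_le
    (S₂ := (LieSubmodule.lieSpan K L' ({m} : Set M)).toSubmodule) hle

lemma nilrad_anti {I J : Finset (LieModule.Weight K 𝔱 𝔤)} (h : I ⊆ J) :
    nilrad 𝔱 Δ J ≤ nilrad 𝔱 Δ I := by
  classical
  refine LieSubalgebra.lieSpan_mono (Set.biUnion_subset_biUnion_left fun β hβ => ⟨hβ.1, ?_⟩)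
  rintro ⟨hβr, f, hf⟩
  refine hβ.2 ⟨hβr, fun α => if α ∈ I then f α else 0, ?_⟩
  rw [hf, ← Finset.sum_subset h fun α _ hα => by simp [hα]]
  exact Finset.sum_congr rfl fun α hα => by beta_reduce; rw [if_pos hα]

lemma IsHighestWeightVector.isMaxVec {lam : Module.Dual K 𝔱} {v : M}
    (hv : IsHighestWeightVector 𝔱 Δ lam v) (hxy : IsChevalleyBasis 𝔱 Δ x y)
    (he : D.e = rootVec x y) : D.IsMaxVec D.S lam v where
  mem_wsp t := hv.weight t
  lie_x β _ := by
    rw [he]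
    exact hv.pos β.1 β.2 _ (hxy.x_mem β)

/-- Root vectors of a Levi subalgebra acting locally finitely act nilpotently on weight vectors. -/
lemma exists_pow_eq_zero_of_finite {s : posRoots 𝔱 Δ ⊕ posRoots 𝔱 Δ} {χ : Module.Dual K 𝔱} {v : M}
    (hv : v ∈ wsp 𝔱 M χ) (W : Submodule K M) [FiniteDimensional K W] (hvW : v ∈ W)
    (hW : ∀ w ∈ W, ⁅D.e s, w⁆ ∈ W) : ∃ k, (toEnd K 𝔤 M (D.e s) ^ k) v = 0 := by
  by_contra! h
  have hmem : ∀ k, (toEnd K 𝔤 M (D.e s) ^ k) v ∈ W := fun k => by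
    induction k with
    | zero => exact hvW
    | succ k ih => rw [pow_succ', Module.End.mul_apply]; exact hW _ ih
  -- If no power vanished, these would be eigenvectors of `h_s` with distinct eigenvalues,
  -- infinitely many in the finite-dimensional `W`.
  have hli : LinearIndependent K (fun k : ℕ => (toEnd K 𝔤 M (D.e s) ^ k) v) := by
    refine Module.End.eigenvectors_linearIndependent' (toEnd K 𝔤 M (D.h s : 𝔤))
      (fun k : ℕ => χ (D.h s) + k * 2) (fun a b hab => ?_) _ fun k => ?_
    · simpa using hab
    · refine Module.End.hasEigenvector_iff.mpr ⟨Module.End.mem_eigenspace_iff.mpr ?_, h k⟩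
      have := pow_mem_wsp (D.e_mem_wsp s) hv k (D.h s)
      rw [LinearMap.add_apply, LinearMap.smul_apply, D.rt_h, nsmul_eq_mul] at this
      exact this
  have hliW : LinearIndependent K (fun k : ℕ => (⟨_, hmem k⟩ : W)) :=
    LinearIndependent.of_comp W.subtype hli
  have := hliW.lt_aleph0_of_finiteDimensional
  simp at this

/-- If some `y_α ^ n v` vanished, `M` would satisfy every condition for the parabolic of `I ∪ {α}`,
whose nilradical is smaller, contradicting maximality. -/
lemma IsMaximalParabolicFor.pow_ne_zero (hΔ : IsBase 𝔱 Δ) (hxy : IsChevalleyBasis 𝔱 Δ x y)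
    (hS : D.S = posFinset Δ Δ) (he : D.e = rootVec x y) (hrt : D.rt = signedRootLin Δ)
    {lam : Module.Dual K 𝔱} {v : M} (hv : IsHighestWeightVector 𝔱 Δ lam v)
    {I : Finset (LieModule.Weight K 𝔱 𝔤)} (hI : IsMaximalParabolicFor 𝔱 M Δ I)
    {α : posRoots 𝔱 Δ} (hα : α ∈ D.S) (hαI : α ∉ posFinset Δ I) (n : ℕ) :
    (toEnd K 𝔤 M (D.e (Sum.inr α)) ^ n) v ≠ 0 := by
  classical
  intro h0
  have := Fintype.ofFinite (posRoots 𝔱 Δ)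
  obtain ⟨hIΔ, hcat, hmax⟩ := hI
  have hα' : α.1 ∈ Δ := mem_posFinset.mp (hS ▸ hα)
  have hmv : D.IsMaxVec D.S lam v := hv.isMaxVec hxy he
  have hgen := hv.generates
  set J := insert α.1 I with hJ
  have hJΔ : J ⊆ Δ := Finset.insert_subset hα' hIΔ
  have hJS : posFinset Δ J ⊆ D.S := hS ▸ posFinset_mono hJΔ
  have hF : ∀ δ ∈ posFinset Δ J, LocNil K M (D.e (Sum.inr δ)) := by
    intro δ hδ
    rcases Finset.mem_insert.mp (mem_posFinset.mp hδ) with h | h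
    · obtain rfl : δ = α := Subtype.ext h
      exact D.locNil_of_pow_apply_eq_zero hgen _ h0
    · have hδI : δ ∈ posFinset Δ I := mem_posFinset.mpr h
      have hfin := hcat.levi_locallyFinite v
      rw [levi_eq_leviJ hΔ hxy hS he hrt hIΔ] at hfin
      have hst := D.isStable_toSubmodule
        (LieSubmodule.lieSpan K (D.leviJ (posFinset Δ I)) ({v} : Set M))
      obtain ⟨k, hk⟩ := exists_pow_eq_zero_of_finite (D := D) (s := Sum.inr δ) hmv.mem_wsp
        (LieSubmodule.lieSpan K (D.leviJ (posFinset Δ I)) ({v} : Set M)).toSubmodule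
        (LieSubmodule.subset_lieSpan (Set.mem_singleton v))
        (hst.lie_e _ (D.inr_mem_RJ.mpr (D.mem_PJ_of_mem
          ((posFinset_mono (Finset.subset_insert _ _)).trans hJS) hδI)))
      exact D.locNil_of_pow_apply_eq_zero hgen _ hk
  have hLN : ∀ s ∈ D.RJ (posFinset Δ J), LocNil K M (D.e s) := by
    rintro (β | β) hβ
    · exact D.locNil_x hmv hgen β
    · exact D.locNil_y hmv hgen hF β (D.inr_mem_RJ.mp hβ)
  have hO : IsInCategoryO 𝔱 M Δ J :=
    { nilrad_locallyFinite := fun m => finiteDimensional_lieSpan_of_le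
        (nilrad_anti (Finset.subset_insert _ _)) m (hcat.nilrad_locallyFinite m)
      levi_semisimple := by
        rw [levi_eq_leviJ hΔ hxy hS he hrt hJΔ]
        exact D.complementedLattice_leviJ hmv hgen hJS hF
      levi_locallyFinite := by
        rw [levi_eq_leviJ hΔ hxy hS he hrt hJΔ]
        exact D.finiteDimensional_lieSpan_leviJ hmv hgen hLN
      finitelyGenerated := hcat.finitelyGenerated }
  have hJI := hmax J (Finset.subset_insert _ _) hJΔ hO
  exact hαI (mem_posFinset.mpr (hJI ▸ Finset.mem_insert_self _ _))

lemma prod_pow_apply (D : ChevalleyDatum K 𝔤 𝔱 (posRoots 𝔱 Δ)) {ι : Type*} (L : List ι)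
    (β : ι → posRoots 𝔱 Δ) (ν : ι → ℕ) (v : M) :
    (L.map fun i => toEnd K 𝔤 M (D.e (Sum.inr (β i))) ^ ν i).prod v =
      D.prodY (L.flatMap fun i => List.replicate (ν i) (β i)) v := by
  induction L with
  | nil => rfl
  | cons i L ih =>
    rw [List.map_cons, List.prod_cons, Module.End.mul_apply, ih, List.flatMap_cons, D.prodY_append,
      D.prodY_replicate]

lemma wt_flatMap (D : ChevalleyDatum K 𝔤 𝔱 (posRoots 𝔱 Δ)) {ι : Type*} (L : List ι)
    (β : ι → posRoots 𝔱 Δ) (ν : ι → ℕ) :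
    D.wt (L.flatMap fun i => List.replicate (ν i) (β i)) =
      (L.map fun i => ν i • D.rt (Sum.inl (β i))).sum := by
  induction L with
  | nil => rfl
  | cons i L ih =>
    rw [List.map_cons, List.sum_cons, ← ih, List.flatMap_cons, ← D.wt_replicate]
    simp [ChevalleyDatum.wt]

end Translation
end SplitReductive

/-! ### The theorem. -/

open SplitReductive in
theorem mainTheorem10
    {p : ℕ} [Fact p.Prime]
    {K : Type*} [NormedField K] [NormedAlgebra ℚ_[p] K] [FiniteDimensional ℚ_[p] K]
    {𝔤 : Type*} [LieRing 𝔤] [LieAlgebra K 𝔤] [FiniteDimensional K 𝔤]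
    [LieAlgebra.HasCentralRadical K 𝔤]
    (𝔱 : LieSubalgebra K 𝔤) [𝔱.IsCartanSubalgebra] [LieModule.IsTriangularizable K 𝔱 𝔤]
    (Δ : Finset (LieModule.Weight K 𝔱 𝔤)) (hΔ : IsBase 𝔱 Δ)
    (hp : ∀ α ∈ roots 𝔱, ∀ β ∈ roots 𝔱, α ≠ β → ∀ h : 𝔱, IsCoroot 𝔱 α h →
      ∀ m : ℤ, β h = (m : K) → m ≠ 0 → ¬ (p : ℤ) ∣ m)
    {M : Type*} [AddCommGroup M] [Module K M] [LieRingModule 𝔤 M] [LieModule K 𝔤 M]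
    (lam : Module.Dual K 𝔱) (v : M) (hv : IsHighestWeightVector 𝔱 Δ lam v)
    (hlam : ∀ α ∈ Δ, ∀ h : 𝔱, IsCoroot 𝔱 α h → ‖lam h‖ ≤ 1)
    (I : Finset (LieModule.Weight K 𝔱 𝔤)) (hI : IsMaximalParabolicFor 𝔱 M Δ I)
    (x y : posRoots 𝔱 Δ → 𝔤) (hxy : IsChevalleyBasis 𝔱 Δ x y)
    {r : ℕ} (β : Fin r ≃ posRoots 𝔱 Δ)
    (γ : posRoots 𝔱 Δ) (hγ : γ.1 ∉ leviRoots 𝔱 I)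
    (n : ℕ) (c : (Fin r → ℕ) →₀ K)
    (hc : ∀ ν ∈ c.support, ∑ i, ν i • ((β i).1 : 𝔱 → K) = n • (γ.1 : 𝔱 → K))
    (hrel : ((LieModule.toEnd K 𝔤 M (y γ)) ^ n) v =
      c.sum fun ν a => a • monomialApply K (fun i => y (β i)) ν v) :
    ∃ ν : Fin r → ℕ, ∑ i, ν i • ((β i).1 : 𝔱 → K) = n • (γ.1 : 𝔱 → K) ∧
      n ≤ ∑ i, ν i ∧ 1 ≤ ‖c ν‖ := by
  have : CharZero K := charZero_of_injective_algebraMap (algebraMap ℚ_[p] K).injective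
  have : IsUltrametricDist K := IsUltrametricDist.of_normedAlgebra ℚ_[p]
  have hpn : ∀ m : ℤ, ¬ (p : ℤ) ∣ m → ‖(m : K)‖ = 1 := fun m hm => by
    rw [← map_intCast (algebraMap ℚ_[p] K) m, norm_algebraMap']
    exact (Padic.norm_int_le_one m).eq_of_not_lt
      fun h => hm (Padic.norm_intCast_lt_one_iff.mp h)
  obtain ⟨D, hS, he, hrt⟩ := hxy.exists_datum hΔ
  have hcoroot : ∀ δ, IsCoroot 𝔱 δ.1 (D.h (Sum.inl δ)) := fun δ => by
    obtain ⟨h, hcor, hh⟩ := hxy.lie_x_y δ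
    have h1 := D.lie_e_swap (Sum.inl δ)
    rw [he] at h1
    rwa [← Subtype.ext (hh.symm.trans h1)]
  have hpD : ∀ δ : posRoots 𝔱 Δ, ∀ t, t ≠ Sum.inl δ → ∀ m : ℤ,
      D.rt t (D.h (Sum.inl δ)) = m → m ≠ 0 → ¬ (p : ℤ) ∣ m := by
    intro δ t ht m hm
    obtain ⟨ω, hω, hωt⟩ := hxy.exists_root t
    refine hp δ.1 δ.2.1 ω hω (fun h => ht ?_) _ (hcoroot δ) m ?_
    · exact signedRoot_injective hΔ (hωt.symm.trans (congrArg _ h.symm))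
    · rw [hrt, signedRootLin_apply] at hm
      rw [← hm, ← hωt]
  -- An exponent vector becomes the list of roots with multiplicity, in the given order, so that `∑
  -- ν i` is its length.
  let l : (Fin r → ℕ) → List (posRoots 𝔱 Δ) := fun ν =>
    (List.finRange r).flatMap fun i => List.replicate (ν i) (β i)
  have hlen : ∀ ν, (l ν).length = ∑ i, ν i := fun ν => by
    simp [l, List.length_flatMap, ← List.ofFn_eq_map, List.sum_ofFn]
  have hmono : ∀ ν, monomialApply K (fun i => y (β i)) ν v = D.prodY (l ν) v := fun ν => by
    rw [monomialApply, List.ofFn_eq_map, ← prod_pow_apply, he]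
    rfl
  have hwt : ∀ ν ∈ c.support, D.wt (l ν) = n • D.rt (Sum.inl γ) := fun ν hν => by
    rw [wt_flatMap, ← List.ofFn_eq_map, List.sum_ofFn, hrt]
    refine LinearMap.ext fun t => ?_
    have h1 := congrFun (hc ν hν) t
    rw [Finset.sum_apply] at h1
    rw [LinearMap.sum_apply]
    exact h1
  obtain ⟨ν, hν, h1, h2⟩ := D.exists_one_le_norm hpD hpn (hv.isMaxVec hxy he)
    (fun α hα => hlam α.1 (mem_posFinset.mp (hS ▸ hα)) _ (hcoroot α)) (posFinset Δ I)
    (fun α hα hαI k => hI.pow_ne_zero hΔ hxy hS he hrt hv hα hαI k) n γ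
    (fun h => hγ ((mem_PJ_posFinset hΔ hS hrt hI.1).mp h)) c.support c l hwt (by
      rw [he]
      refine hrel.trans (Finset.sum_congr rfl fun ν _ => ?_)
      beta_reduce
      rw [hmono])
  exact ⟨ν, hc ν hν, hlen ν ▸ h1, h2⟩
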